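/- Let $D=\mathbb R^2/\mathbb Z^2$ be the periodic unit square with coordinates $(x,z)$, let $\|\cdot\|$ be the norm of $L^2(D)$, and for $k\ge 0$ let $H^k_{per0}$ be the space of real functions in $L^2(D)$ with zero mean whose weak derivatives up to order $k$ lie in $L^2(D)$, with the usual Sobolev norm $\|\cdot\|_{H^k}$. Let $\nu>0$, $Pr>0$, $N^2>0$ and consider the thermohaline circulation model without wind forcing $$\Delta\psi_t+J(\Delta\psi,\psi)=\rho_x+\nu\Delta^2\psi,\qquad \rho_t+J(\rho,\psi)=-N^2\psi_x+\frac{\nu}{Pr}\Delta\rho,\qquad J(a,b)=a_xb_z-a_zb_x,$$ for the stream function $\psi$ and the density fluctuation $\rho$, both periodic with period $1$ in $x$ and $z$ and with zero mean; write $\omega=\Delta\psi$ for the vorticity. A solution on $[0,\infty)$ with initial values $(\psi_0,\rho_0)$ is a pair with $\psi,\rho\in C([0,\infty);L^2(D))$, $\psi\in L^\infty(0,\tau;H^3_{per0})\cap L^2(0,\tau;H^4_{per0})$ and $\rho\in L^\infty(0,\tau;H^1_{per0})\cap L^2(0,\tau;H^2_{per0})$ for every $\tau>0$, with $\psi(t)\in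 H^3_{per0}$ and $\rho(t)\in H^1_{per0}$ for every $t\ge 0$ and the $L^\infty$ bounds holding at every time of $[0,\tau]$, which takes the initial values at $t=0$ and satisfies both equations when these are tested with smooth periodic functions of $(x,z)$ and integrated over $[0,t]$, for every $t\ge0$. Let $\psi_0\in H^3_{per0}$ (that is, $\omega_0=\Delta\psi_0\in H^1_{per0}$) and $\rho_0\in H^1_{per0}$. Then a solution on $[0,\infty)$ with initial values $(\psi_0,\rho_0)$ exists, and: 1. $\|\psi\|_{H^3}$ and $\|\rho\|_{H^1}$ tend to zero exponentially fast as $t\to\infty$: there are constants $C$ and $\alpha>0$, depending only on $Pr,N^2,\nu$ and the initial values, such that every solution with these initial values satisfies $\|\psi(t)\|_{H^3}\le Ce^{-\alpha t}$ and $\|\rho(t)\|_{H^1}\le Ce^{-\alpha t}$ for all $t\ge 0$. 2. There are times $t_1,t_2>0$ and constants $M$, $K$, $\beta>0$, depending only on $Pr,N^2,\nu$ and the initial values, such that, with $T=\max\{t_1,t_2\}$, every solution with these initial values satisfies $\|\nabla\rho(t)\|\le M$ and $\|\nabla\omega(t)\|\le M$ for $0\le t\le T$, $\|\nabla\rho(t)\|\le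 Ke^{-\beta t}$ for $t>t_1$, and $\|\nabla\omega(t)\|\le Ke^{-\beta t}$ for $t>t_2$; in particular both gradients decay exponentially for $t>T$. -/

import Mathlib

open MeasureTheory Set
open scoped ContDiff

noncomputable section

namespace Thermohaline

/-- The periodic fluid domain: the unit square in the `(x, z)`-plane with opposite sides
identified. Coordinate `0` is `x`, coordinate `1` is `z`. -/
abbrev Torus : Type := UnitAddTorus (Fin 2)

/-- Lebesgue measure on the periodic unit square (total mass one). -/
abbrev area : Measure Torus := Measure.pi fun _ => AddCircle.haarAddCircle

/-- Real square-integrable functions on the periodic domain. -/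
abbrev L2 : Type := Lp ℝ 2 area

/-- Smooth doubly periodic functions, with periods `1` in both variables. -/
def IsTest (φ : Torus → ℝ) : Prop :=
  ContDiff ℝ ∞ fun x : Fin 2 → ℝ => φ fun i => (x i : UnitAddCircle)

/-- The classical partial derivative in the `i`-th coordinate. -/
def pderiv (i : Fin 2) (φ : Torus → ℝ) : Torus → ℝ :=
  fun p => deriv (fun h : ℝ => φ (p + Pi.single i (h : UnitAddCircle))) 0

/-- The classical Laplacian. -/
def testLaplacian (φ : Torus → ℝ) : Torus → ℝ :=
  fun p => pderiv 0 (pderiv 0 φ) p + pderiv 1 (pderiv 1 φ) p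

/-- `g` is the weak derivative `∂ₓ^a ∂_z^b u`. -/
def IsWeakDeriv (a b : ℕ) (u g : L2) : Prop :=
  ∀ φ : Torus → ℝ, IsTest φ →
    ∫ p, u p * ((pderiv 0)^[a] ((pderiv 1)^[b] φ)) p ∂area
      = (-1) ^ (a + b) * ∫ p, g p * φ p ∂area

open Classical in
/-- The weak derivative `∂ₓ^a ∂_z^b u` (with value `0` if there is none in `L²`). -/
def weakD (a b : ℕ) (u : L2) : L2 :=
  if h : ∃ g : L2, IsWeakDeriv a b u g then h.choose else 0

/-- Membership in the Sobolev space of periodic functions with zero mean all of whose weak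
derivatives up to order `k` are square integrable. -/
def MemHper0 (k : ℕ) (u : L2) : Prop :=
  ∫ p, u p ∂area = 0 ∧ ∀ a b : ℕ, a + b ≤ k → ∃ g : L2, IsWeakDeriv a b u g

/-- The norm of the Sobolev space of order `k`. -/
def sobolevNorm (k : ℕ) (u : L2) : ℝ :=
  Real.sqrt (∑ ab ∈ (Finset.range (k + 1) ×ˢ Finset.range (k + 1)).filter
    (fun ab => ab.1 + ab.2 ≤ k), ‖weakD ab.1 ab.2 u‖ ^ 2)

/-- The mean-square norm `‖∇u‖`. -/
def gradNorm (u : L2) : ℝ :=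
  Real.sqrt (‖weakD 1 0 u‖ ^ 2 + ‖weakD 0 1 u‖ ^ 2)

/-- The weak Laplacian; the vorticity is `lap ψ`. -/
def lap (u : L2) : L2 := weakD 2 0 u + weakD 0 2 u

/-- The Jacobian `J(u, v) = uₓ v_z - u_z vₓ`. -/
def jacobian (u v : L2) : Torus → ℝ :=
  fun p => weakD 1 0 u p * weakD 0 1 v p - weakD 0 1 u p * weakD 1 0 v p

/-- `(ψ, ρ)`, on the time interval `[0, ∞)`, is a solution with initial values `(ψ₀, ρ₀)` of
`Δψ_t + J(Δψ, ψ) = ρₓ + ν Δ²ψ` and `ρ_t + J(ρ, ψ) = -N² ψₓ + (ν / Pr) Δρ`,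
where `Nsq` stands for `N²`. -/
structure IsSolution (ν Pr Nsq : ℝ) (ψ₀ ρ₀ : L2) (ψ ρ : ℝ → L2) : Prop where
  init_psi : ψ 0 = ψ₀
  init_rho : ρ 0 = ρ₀
  cont_psi : ContinuousOn ψ (Ici 0)
  cont_rho : ContinuousOn ρ (Ici 0)
  /-- `ψ ∈ L^∞(0, T; H³)` for all `T`. -/
  mem_psi : ∀ t, 0 ≤ t → MemHper0 3 (ψ t)
  bdd_psi : ∀ T : ℝ, ∃ M : ℝ, ∀ t ∈ Icc 0 T, sobolevNorm 3 (ψ t) ≤ M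
  /-- `ρ ∈ L^∞(0, T; H¹)` for all `T`. -/
  mem_rho : ∀ t, 0 ≤ t → MemHper0 1 (ρ t)
  bdd_rho : ∀ T : ℝ, ∃ M : ℝ, ∀ t ∈ Icc 0 T, sobolevNorm 1 (ρ t) ≤ M
  /-- `ψ ∈ L²(0, T; H⁴)` for all `T`. -/
  mem4_psi : ∀ᵐ t ∂(volume.restrict (Ioi (0 : ℝ))), MemHper0 4 (ψ t)
  sq_psi : ∀ T : ℝ, IntegrableOn (fun t => sobolevNorm 4 (ψ t) ^ 2) (Ioc 0 T)
  /-- `ρ ∈ L²(0, T; H²)` for all `T`. -/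
  mem2_rho : ∀ᵐ t ∂(volume.restrict (Ioi (0 : ℝ))), MemHper0 2 (ρ t)
  sq_rho : ∀ T : ℝ, IntegrableOn (fun t => sobolevNorm 2 (ρ t) ^ 2) (Ioc 0 T)
  /-- The vorticity equation, tested with smooth periodic functions and integrated in time. -/
  eq_psi : ∀ φ : Torus → ℝ, IsTest φ → ∀ t, 0 ≤ t →
    ∫ p, lap (ψ t) p * φ p ∂area - ∫ p, lap ψ₀ p * φ p ∂area
      = ∫ s in (0 : ℝ)..t,
          (-(∫ p, jacobian (lap (ψ s)) (ψ s) p * φ p ∂area)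
            + ∫ p, weakD 1 0 (ρ s) p * φ p ∂area
            + ν * ∫ p, lap (ψ s) p * testLaplacian φ p ∂area)
  /-- The density equation, tested with smooth periodic functions and integrated in time. -/
  eq_rho : ∀ φ : Torus → ℝ, IsTest φ → ∀ t, 0 ≤ t →
    ∫ p, ρ t p * φ p ∂area - ∫ p, ρ₀ p * φ p ∂area
      = ∫ s in (0 : ℝ)..t,
          (-(∫ p, jacobian (ρ s) (ψ s) p * φ p ∂area)
            - Nsq * ∫ p, weakD 1 0 (ψ s) p * φ p ∂area
            + ν / Pr * ∫ p, ρ s p * testLaplacian φ p ∂area)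

end Thermohaline

end

noncomputable section

namespace Thermohaline

open scoped ComplexConjugate

/-! ### Fourier modes and convolution estimates -/

/-! Everything is done on Fourier coefficients: `w` for the vorticity, `b` for the density, `κ = ν /
Pr`. The Jacobian becomes the convolution `adv` with the antisymmetric symbol `cross`, and a Sobolev
norm of a zero-mean function is comparable with `energy n`, the sum of `eig k ^ n * ‖u k‖ ^ 2`.

Decay follows from three estimates, each feeding the next. (1) In the energy `N²‖∇ψ‖² + ‖ρ‖²` the
Jacobians drop out by antisymmetry and the coupling terms cancel, so that its derivative is
`-2νN²‖ω‖² - 2κ‖∇ρ‖²` (`production_basic`); with the Poincaré inequality this bounds the integral of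
`e^{βs}‖∇ρ‖²`, where `β = min ν κ / 2`. (2) The Jacobian also drops out of the balance of `‖ω‖²`
(`production_enstrophy`), and step (1) controls the forcing, which bounds the integral of
`e^{βs}‖∇ω‖²`. (3) For `‖∇ω‖²` and `‖∇ρ‖²` the Jacobian does not cancel, but `H²` embeds into the
Wiener algebra, so its `L²` norm squared is at most `embConst * ‖∇ω‖²` times `‖∇ω‖²` or `‖∇ρ‖²`. In
`gronwall` the first factor is a coefficient whose time integral is bounded by step (2), uniformly
in time. The outcome is `exists_apriori_bound`, with constants depending only on the parameters and
a bound of the initial energies.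

That bound is stated for `IsModeSolution`, the system restricted to a set `S` of modes, and is used
twice. For `S = {0}ᶜ` it applies to every solution (`IsSolution.isModeSolution`), so no uniqueness
is needed: two derivatives of `ω` and `ρ` in `L²` in time put the velocities in `L²`, which
justifies the energy identity. For finite `S` it applies to Galerkin approximations. Their
coefficients are equi-Lipschitz in time, a diagonal subsequence converges mode by mode, and the
convolution passes to the limit by dominated convergence (`exists_modeSolution`). The Riesz–Fischer
theorem turns the limit into functions (`exists_isSolution`). Assertion 2 then follows from decay
that already holds from time zero. -/

/-- Wave vectors of the periodic unit square. -/
abbrev Mode : Type := Fin 2 → ℤ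

/-- The eigenvalue of `-Δ` belonging to the wave vector `k`. -/
def eig (k : Mode) : ℝ := (2 * Real.pi) ^ 2 * ((k 0 : ℝ) ^ 2 + (k 1 : ℝ) ^ 2)

/-- The symbol of the Jacobian. -/
def cross (l k : Mode) : ℝ := (2 * Real.pi) ^ 2 * ((l 0 : ℝ) * k 1 - (l 1 : ℝ) * k 0)

/-- The Fourier coefficients of the Jacobian `J(u, v)` in terms of those of `u` and `v`. -/
def adv (u v : Mode → ℂ) (k : Mode) : ℂ := -∑' l, (cross l k : ℂ) * u l * v (k - l)

/-- The Fourier coefficients of the stream function of the vorticity with coefficients `w`. -/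
def stream (w : Mode → ℂ) (k : Mode) : ℂ := -w k / (eig k : ℂ)

/-- The energy of order `n`, i.e. the squared norm of `(-Δ)^(n/2) u`. -/
def energy (n : ℕ) (u : Mode → ℂ) : ℝ := ∑' k, eig k ^ n * ‖u k‖ ^ 2

/-- Finiteness of the energy of order `n`. -/
def FinEnergy (n : ℕ) (u : Mode → ℂ) : Prop := Summable fun k => eig k ^ n * ‖u k‖ ^ 2

/-- The coefficients of a real function. -/
def Hermitian (u : Mode → ℂ) : Prop := ∀ k, u (-k) = conj (u k)

lemma eig_nonneg (k : Mode) : 0 ≤ eig k := by unfold eig; positivity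

@[simp] lemma eig_zero : eig 0 = 0 := by simp [eig]

@[simp] lemma eig_neg (k : Mode) : eig (-k) = eig k := by simp [eig]

lemma one_le_two_pi_sq : 1 ≤ (2 * Real.pi) ^ 2 := by
  have := Real.pi_gt_three
  nlinarith

/-- Compares `eig` with the sup norm of the wave vector, the norm in which convergence of lattice
sums is known. -/
lemma norm_sq_le_eig (k : Mode) : ‖k‖ ^ 2 ≤ eig k := by
  have h0 : (0 : ℝ) ≤ (k 0 : ℝ) ^ 2 + (k 1 : ℝ) ^ 2 := by positivity
  have h : ‖k‖ ≤ Real.sqrt ((k 0 : ℝ) ^ 2 + (k 1 : ℝ) ^ 2) := by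
    refine (pi_norm_le_iff_of_nonneg (Real.sqrt_nonneg _)).2 fun i => ?_
    rw [Int.norm_eq_abs]
    apply Real.abs_le_sqrt
    fin_cases i <;> simp <;> positivity
  have h2 : ‖k‖ ^ 2 ≤ (k 0 : ℝ) ^ 2 + (k 1 : ℝ) ^ 2 := by
    calc ‖k‖ ^ 2 ≤ (Real.sqrt ((k 0 : ℝ) ^ 2 + (k 1 : ℝ) ^ 2)) ^ 2 := by gcongr
      _ = _ := Real.sq_sqrt h0
  unfold eig
  nlinarith [one_le_two_pi_sq]

/-- The Poincaré inequality on nonzero modes, with the crude constant `1` in place of `4π²`. -/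
lemma one_le_eig {k : Mode} (hk : k ≠ 0) : 1 ≤ eig k := by
  refine le_trans ?_ (norm_sq_le_eig k)
  have : 1 ≤ ‖k‖ := by
    obtain ⟨i, hi⟩ := Function.ne_iff.1 hk
    refine le_trans ?_ (norm_le_pi_norm k i)
    rw [Int.norm_eq_abs]
    exact_mod_cast Int.one_le_abs hi
  nlinarith

lemma eig_pos {k : Mode} (hk : k ≠ 0) : 0 < eig k := lt_of_lt_of_le one_pos (one_le_eig hk)

lemma eig_ne_zero {k : Mode} (hk : k ≠ 0) : eig k ≠ 0 := (eig_pos hk).ne'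

/-- A lattice sum in the plane converges for exponents above `2`; here the exponent is `4`. The zero
mode contributes `0` because `0⁻¹ = 0`. -/
lemma summable_inv_eig_sq : Summable fun k : Mode => (eig k ^ 2)⁻¹ := by
  have h := EisensteinSeries.summable_one_div_norm_rpow (k := 4) (by norm_num)
  refine Summable.of_nonneg_of_le (fun k => by positivity) (fun k => ?_) h
  by_cases hk : k = 0
  · subst hk; simp
  have hn : 0 < ‖k‖ := norm_pos_iff.2 hk
  rw [Real.rpow_neg hn.le]
  refine inv_anti₀ (by positivity) ?_
  have h4 : ‖k‖ ^ (4 : ℝ) = (‖k‖ ^ 2) ^ 2 := by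
    rw [← pow_mul]; exact_mod_cast Real.rpow_natCast ‖k‖ 4
  rw [h4]
  have := norm_sq_le_eig k
  gcongr

/-- The embedding constant of `H²` into the Wiener algebra. -/
def embConst : ℝ := ∑' k : Mode, (eig k ^ 2)⁻¹

lemma embConst_nonneg : 0 ≤ embConst := tsum_nonneg fun k => by positivity

/-- Lagrange's identity in the plane: the two sides differ by the square of the inner product of `l`
and `k`, up to the factor `(2π)⁴`. -/
lemma cross_sq_le (l k : Mode) : cross l k ^ 2 ≤ eig l * eig k := by
  unfold cross eig
  have : ((l 0 : ℝ) * k 1 - (l 1 : ℝ) * k 0) ^ 2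
      ≤ ((l 0 : ℝ) ^ 2 + (l 1 : ℝ) ^ 2) * ((k 0 : ℝ) ^ 2 + (k 1 : ℝ) ^ 2) := by
    nlinarith [sq_nonneg ((l 0 : ℝ) * k 0 + (l 1 : ℝ) * k 1)]
  calc _ = ((2 * Real.pi) ^ 2) ^ 2 * ((l 0 : ℝ) * k 1 - (l 1 : ℝ) * k 0) ^ 2 := by ring
    _ ≤ ((2 * Real.pi) ^ 2) ^ 2 *
      (((l 0 : ℝ) ^ 2 + (l 1 : ℝ) ^ 2) * ((k 0 : ℝ) ^ 2 + (k 1 : ℝ) ^ 2)) := by gcongr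
    _ = _ := by ring

lemma abs_cross_le (l k : Mode) : |cross l k| ≤ Real.sqrt (eig l) * Real.sqrt (eig k) := by
  rw [← Real.sqrt_mul (eig_nonneg l)]
  exact Real.abs_le_sqrt (cross_sq_le l k)

lemma cross_sub (l k : Mode) : cross l (k - l) = cross l k := by
  simp only [cross, Pi.sub_apply, Int.cast_sub]; ring

lemma cross_swap (l k : Mode) : cross l k = -cross k l := by
  simp only [cross]; ring

lemma cross_sub_left (l k : Mode) : cross l (l - k) = -cross l k := by
  simp only [cross, Pi.sub_apply, Int.cast_sub]; ring

lemma energy_nonneg (n : ℕ) (u : Mode → ℂ) : 0 ≤ energy n u :=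
  tsum_nonneg fun k => mul_nonneg (pow_nonneg (eig_nonneg k) n) (sq_nonneg _)

lemma eig_pow_mul_le {u : Mode → ℂ} (hu : u 0 = 0) {m n : ℕ} (hmn : m ≤ n) (k : Mode) :
    eig k ^ m * ‖u k‖ ^ 2 ≤ eig k ^ n * ‖u k‖ ^ 2 := by
  by_cases hk : k = 0
  · simp [hk, hu]
  · have := one_le_eig hk
    gcongr

lemma FinEnergy.mono {u : Mode → ℂ} (hu : u 0 = 0) {m n : ℕ} (hmn : m ≤ n) (h : FinEnergy n u) :
    FinEnergy m u :=
  Summable.of_nonneg_of_le (fun k => mul_nonneg (pow_nonneg (eig_nonneg k) m) (sq_nonneg _))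
    (eig_pow_mul_le hu hmn) h

lemma energy_mono {u : Mode → ℂ} (hu : u 0 = 0) {m n : ℕ} (hmn : m ≤ n) (h : FinEnergy n u) :
    energy m u ≤ energy n u :=
  (h.mono hu hmn).tsum_le_tsum (eig_pow_mul_le hu hmn) h

lemma FinEnergy.le_energy {u : Mode → ℂ} {n : ℕ} (h : FinEnergy n u) (k : Mode) :
    eig k ^ n * ‖u k‖ ^ 2 ≤ energy n u :=
  h.le_tsum k fun j _ => mul_nonneg (pow_nonneg (eig_nonneg j) n) (sq_nonneg _)

lemma eig_pow_mul_norm_stream {w : Mode → ℂ} (hw : w 0 = 0) (n : ℕ) (k : Mode) :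
    eig k ^ (n + 2) * ‖stream w k‖ ^ 2 = eig k ^ n * ‖w k‖ ^ 2 := by
  by_cases hk : k = 0
  · simp [hk, hw]
  · have := eig_pos hk
    rw [stream, norm_div, norm_neg, Complex.norm_real, Real.norm_eq_abs, abs_of_pos this]
    field_simp
    ring

lemma stream_zero (w : Mode → ℂ) : stream w 0 = 0 := by simp [stream]

lemma finEnergy_stream {w : Mode → ℂ} (hw : w 0 = 0) (n : ℕ) :
    FinEnergy (n + 2) (stream w) ↔ FinEnergy n w := by
  simp only [FinEnergy, eig_pow_mul_norm_stream hw]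

lemma energy_stream {w : Mode → ℂ} (hw : w 0 = 0) (n : ℕ) :
    energy (n + 2) (stream w) = energy n w := by
  simp only [energy, eig_pow_mul_norm_stream hw]

lemma Hermitian.stream {w : Mode → ℂ} (hw : Hermitian w) : Hermitian (stream w) := fun k => by
  simp [Thermohaline.stream, hw k]

/-! ### Convolution inequalities and the size of the Jacobian -/

/-- The Cauchy–Schwarz inequality for series of nonnegative terms. -/
lemma summable_mul_and_sq_tsum_le {ι : Type*} {f g : ι → ℝ} (hf : ∀ i, 0 ≤ f i)
    (hg : ∀ i, 0 ≤ g i) (hf2 : Summable fun i => f i ^ 2) (hg2 : Summable fun i => g i ^ 2) :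
    (Summable fun i => f i * g i) ∧
      (∑' i, f i * g i) ^ 2 ≤ (∑' i, f i ^ 2) * ∑' i, g i ^ 2 := by
  have h := Real.summable_and_inner_le_Lp_mul_Lq_tsum_of_nonneg (p := 2) (q := 2)
    Real.HolderConjugate.two_two hf hg (by simpa using hf2) (by simpa using hg2)
  refine ⟨h.1, ?_⟩
  have h2 := h.2
  simp only [Real.rpow_two, ← Real.sqrt_eq_rpow] at h2
  have h0 : 0 ≤ ∑' i, f i * g i := tsum_nonneg fun i => mul_nonneg (hf i) (hg i)
  calc _ ≤ (Real.sqrt (∑' i, f i ^ 2) * Real.sqrt (∑' i, g i ^ 2)) ^ 2 := by gcongr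
    _ = _ := by
      rw [mul_pow, Real.sq_sqrt (tsum_nonneg fun i => sq_nonneg _),
        Real.sq_sqrt (tsum_nonneg fun i => sq_nonneg _)]

/-- A zero-mean function with three derivatives in `L²` has a gradient in the Wiener algebra. -/
lemma summable_sqrt_eig_mul {v : Mode → ℂ} (hv : FinEnergy 3 v) :
    (Summable fun k => Real.sqrt (eig k) * ‖v k‖) ∧
      (∑' k, Real.sqrt (eig k) * ‖v k‖) ^ 2 ≤ embConst * energy 3 v := by
  -- Splitting `eig^{1/2} = eig⁻¹ · eig^{3/2}` prepares Cauchy–Schwarz, with `eig⁻¹` square summable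
  -- in dimension two.
  have key : ∀ k, (eig k)⁻¹ * (Real.sqrt (eig k ^ 3) * ‖v k‖) = Real.sqrt (eig k) * ‖v k‖ := by
    intro k
    by_cases hk : k = 0
    · simp [hk]
    · have := eig_pos hk
      have h3 : Real.sqrt (eig k ^ 3) = eig k * Real.sqrt (eig k) := by
        rw [pow_succ, Real.sqrt_mul (by positivity), Real.sqrt_sq this.le]
      rw [h3]; field_simp
  have sq : ∀ k, (Real.sqrt (eig k ^ 3) * ‖v k‖) ^ 2 = eig k ^ 3 * ‖v k‖ ^ 2 := fun k => by
    rw [mul_pow, Real.sq_sqrt (pow_nonneg (eig_nonneg k) 3)]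
  have h := summable_mul_and_sq_tsum_le (f := fun k : Mode => (eig k)⁻¹)
    (g := fun k => Real.sqrt (eig k ^ 3) * ‖v k‖) (fun k => inv_nonneg.2 (eig_nonneg k))
    (fun k => by positivity) (by simpa only [inv_pow] using summable_inv_eig_sq)
    (by simpa only [sq, FinEnergy] using hv)
  simpa only [key, sq, inv_pow, embConst, energy] using h

/-- Young's inequality `ℓ² * ℓ¹ ⊆ ℓ²`. -/
lemma young_l2_l1 {U V : Mode → ℝ} (hU : ∀ k, 0 ≤ U k) (hV : ∀ k, 0 ≤ V k)
    (hU2 : Summable fun k => U k ^ 2) (hV1 : Summable V) :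
    (∀ k, Summable fun l => U l * V (k - l)) ∧
    (Summable fun k => (∑' l, U l * V (k - l)) ^ 2) ∧
    ∑' k, (∑' l, U l * V (k - l)) ^ 2 ≤ (∑' k, V k) ^ 2 * ∑' k, U k ^ 2 := by
  -- The change of variables `(k, l) ↦ (l, k - l)` decouples the convolution into a product of two
  -- sums.
  let e : Mode × Mode ≃ Mode × Mode :=
    { toFun := fun p => (p.2, p.1 - p.2)
      invFun := fun p => (p.1 + p.2, p.1)
      left_inv := fun p => by simp
      right_inv := fun p => by simp }
  have hprod : Summable fun p : Mode × Mode => U p.1 ^ 2 * V p.2 :=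
    hU2.mul_of_nonneg hV1 (fun k => sq_nonneg _) hV
  have hP : Summable fun p : Mode × Mode => U p.2 ^ 2 * V (p.1 - p.2) :=
    (e.summable_iff (f := fun p : Mode × Mode => U p.1 ^ 2 * V p.2)).2 hprod
  have hPs : ∑' p : Mode × Mode, U p.2 ^ 2 * V (p.1 - p.2) = (∑' k, U k ^ 2) * ∑' k, V k := by
    rw [hU2.tsum_mul_tsum hV1 hprod]
    exact e.tsum_eq (fun p : Mode × Mode => U p.1 ^ 2 * V p.2)
  have hsec : ∀ k, Summable fun l => U l ^ 2 * V (k - l) := fun k => hP.prod_factor k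
  have hVk : ∀ k : Mode, Summable fun l => V (k - l) := fun k =>
    ((Equiv.subLeft k).summable_iff (f := V)).2 hV1
  have hVs : ∀ k : Mode, ∑' l, V (k - l) = ∑' l, V l := fun k => (Equiv.subLeft k).tsum_eq V
  have cs : ∀ k, (Summable fun l => U l * V (k - l)) ∧
      (∑' l, U l * V (k - l)) ^ 2 ≤ (∑' l, U l ^ 2 * V (k - l)) * ∑' l, V l := by
    intro k
    -- Writing `U V = (U √V)(√V)` costs one factor `∑ V` and leaves the convolution `U² * V`, which
    -- is summable in `k`.
    have h := summable_mul_and_sq_tsum_le (f := fun l => U l * Real.sqrt (V (k - l)))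
      (g := fun l => Real.sqrt (V (k - l))) (fun l => mul_nonneg (hU l) (Real.sqrt_nonneg _))
      (fun l => Real.sqrt_nonneg _)
      (by simpa only [mul_pow, Real.sq_sqrt (hV _)] using hsec k)
      (by simpa only [Real.sq_sqrt (hV _)] using hVk k)
    simpa only [mul_pow, Real.sq_sqrt (hV _), mul_assoc, Real.mul_self_sqrt (hV _), hVs] using h
  have hS : Summable fun k => (∑' l, U l ^ 2 * V (k - l)) * ∑' l, V l := hP.prod.mul_right _
  have h2 : Summable fun k => (∑' l, U l * V (k - l)) ^ 2 :=
    Summable.of_nonneg_of_le (fun k => sq_nonneg _) (fun k => (cs k).2) hS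
  refine ⟨fun k => (cs k).1, h2, ?_⟩
  calc _ ≤ ∑' k, (∑' l, U l ^ 2 * V (k - l)) * ∑' l, V l :=
        h2.tsum_le_tsum (fun k => (cs k).2) hS
    _ = (∑' k, V k) ^ 2 * ∑' k, U k ^ 2 := by
        rw [tsum_mul_right, ← hP.tsum_prod, hPs]; ring

/-- Since `cross l k = cross l (k - l)`, exactly one derivative falls on each factor. -/
lemma norm_adv_term_le (u v : Mode → ℂ) (k l : Mode) :
    ‖(cross l k : ℂ) * u l * v (k - l)‖
      ≤ (Real.sqrt (eig l) * ‖u l‖) * (Real.sqrt (eig (k - l)) * ‖v (k - l)‖) := by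
  rw [norm_mul, norm_mul, Complex.norm_real, Real.norm_eq_abs, ← cross_sub]
  calc _ ≤ (Real.sqrt (eig l) * Real.sqrt (eig (k - l))) * ‖u l‖ * ‖v (k - l)‖ := by
        gcongr; exact abs_cross_le _ _
    _ = _ := by ring

lemma FinEnergy.summable_sqrt_sq {u : Mode → ℂ} (hu : FinEnergy 1 u) :
    Summable fun k => (Real.sqrt (eig k) * ‖u k‖) ^ 2 := by
  simpa only [mul_pow, Real.sq_sqrt (eig_nonneg _), FinEnergy, pow_one] using hu

/-- The terms of the convolution defining the Jacobian, in absolute value. -/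
lemma young_adv {u v : Mode → ℂ} (hu : FinEnergy 1 u) (hv : FinEnergy 3 v) :
    (∀ k, Summable fun l =>
      (Real.sqrt (eig l) * ‖u l‖) * (Real.sqrt (eig (k - l)) * ‖v (k - l)‖)) ∧
    (Summable fun k => (∑' l,
      (Real.sqrt (eig l) * ‖u l‖) * (Real.sqrt (eig (k - l)) * ‖v (k - l)‖)) ^ 2) ∧
    ∑' k, (∑' l, (Real.sqrt (eig l) * ‖u l‖) * (Real.sqrt (eig (k - l)) * ‖v (k - l)‖)) ^ 2
      ≤ embConst * energy 3 v * energy 1 u := by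
  have hv' := summable_sqrt_eig_mul hv
  have h := young_l2_l1 (U := fun k => Real.sqrt (eig k) * ‖u k‖)
    (V := fun k => Real.sqrt (eig k) * ‖v k‖) (fun k => by positivity) (fun k => by positivity)
    hu.summable_sqrt_sq hv'.1
  refine ⟨h.1, h.2.1, h.2.2.trans ?_⟩
  have : ∑' k, (Real.sqrt (eig k) * ‖u k‖) ^ 2 = energy 1 u := by
    simp only [mul_pow, Real.sq_sqrt (eig_nonneg _), energy, pow_one]
  rw [this]
  exact mul_le_mul_of_nonneg_right hv'.2 (energy_nonneg 1 u)

lemma summable_norm_adv_term {u v : Mode → ℂ} (hu : FinEnergy 1 u) (hv : FinEnergy 3 v)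
    (k : Mode) : Summable fun l => ‖(cross l k : ℂ) * u l * v (k - l)‖ :=
  Summable.of_nonneg_of_le (fun _ => norm_nonneg _) (norm_adv_term_le u v k)
    ((young_adv hu hv).1 k)

lemma norm_adv_le {u v : Mode → ℂ} (hu : FinEnergy 1 u) (hv : FinEnergy 3 v) (k : Mode) :
    ‖adv u v k‖ ≤
      ∑' l, (Real.sqrt (eig l) * ‖u l‖) * (Real.sqrt (eig (k - l)) * ‖v (k - l)‖) := by
  rw [adv, norm_neg]
  exact (norm_tsum_le_tsum_norm (summable_norm_adv_term hu hv k)).trans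
    ((summable_norm_adv_term hu hv k).tsum_le_tsum (norm_adv_term_le u v k)
      ((young_adv hu hv).1 k))

/-- The Jacobian is bounded from `H¹ × H³` to `L²`. -/
lemma finEnergy_adv {u v : Mode → ℂ} (hu : FinEnergy 1 u) (hv : FinEnergy 3 v) :
    FinEnergy 0 (adv u v) ∧ energy 0 (adv u v) ≤ embConst * energy 3 v * energy 1 u := by
  have h := young_adv hu hv
  have hle : ∀ k, ‖adv u v k‖ ^ 2 ≤ (∑' l,
      (Real.sqrt (eig l) * ‖u l‖) * (Real.sqrt (eig (k - l)) * ‖v (k - l)‖)) ^ 2 := fun k => by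
    have := norm_adv_le hu hv k
    gcongr
  have hs : Summable fun k => ‖adv u v k‖ ^ 2 :=
    Summable.of_nonneg_of_le (fun k => sq_nonneg _) hle h.2.1
  simp only [FinEnergy, energy, pow_zero, one_mul]
  exact ⟨hs, (hs.tsum_le_tsum hle h.2.1).trans h.2.2⟩

/-! ### The trilinear form and its two cancellations -/

/-- Absolute convergence of the trilinear form `∫ z J(u, v)`. -/
lemma summable_trilinear {z u v : Mode → ℂ} (hz : FinEnergy 0 z) (hu : FinEnergy 1 u)
    (hv : FinEnergy 3 v) :
    Summable fun p : Mode × Mode => conj (z p.1) * ((cross p.2 p.1 : ℂ) * u p.2 * v (p.1 - p.2)) := by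
  have h := young_adv hu hv
  set W : Mode → Mode → ℝ := fun k l =>
    (Real.sqrt (eig l) * ‖u l‖) * (Real.sqrt (eig (k - l)) * ‖v (k - l)‖)
  have hz' : Summable fun k => ‖z k‖ ^ 2 := by simpa [FinEnergy] using hz
  have hs : Summable fun p : Mode × Mode => ‖z p.1‖ * W p.1 p.2 := by
    refine (summable_prod_of_nonneg (fun p => by simp only [W]; positivity)).2 ⟨fun k => ?_, ?_⟩
    · exact (h.1 k).mul_left ‖z k‖
    · simp only [tsum_mul_left]
      exact (summable_mul_and_sq_tsum_le (fun k => norm_nonneg _)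
        (fun k => tsum_nonneg fun l => by positivity) hz' h.2.1).1
  refine Summable.of_norm_bounded hs fun p => ?_
  rw [norm_mul, RCLike.norm_conj]
  exact mul_le_mul_of_nonneg_left (norm_adv_term_le u v p.1 p.2) (norm_nonneg _)

lemma tsum_conj_mul_adv {z u v : Mode → ℂ} (hz : FinEnergy 0 z) (hu : FinEnergy 1 u)
    (hv : FinEnergy 3 v) :
    ∑' k, conj (z k) * adv u v k =
      -∑' p : Mode × Mode, conj (z p.1) * ((cross p.2 p.1 : ℂ) * u p.2 * v (p.1 - p.2)) := by
  rw [(summable_trilinear hz hu hv).tsum_prod]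
  simp only [adv, tsum_mul_left, mul_neg, tsum_neg]

/-- This is `∫ u J(u, v) = 0`. Exchanging the two summation indices turns each term into minus its
conjugate, by antisymmetry of `cross` and reality of `v`; so only the real part is claimed, and `u`
need not be real. -/
lemma re_tsum_conj_mul_adv_self {u v : Mode → ℂ} (hu0 : FinEnergy 0 u) (hu : FinEnergy 1 u)
    (hv : FinEnergy 3 v) (hherm : Hermitian v) :
    (∑' k, conj (u k) * adv u v k).re = 0 := by
  rw [tsum_conj_mul_adv hu0 hu hv]
  set f : Mode × Mode → ℂ :=
    fun p => conj (u p.1) * ((cross p.2 p.1 : ℂ) * u p.2 * v (p.1 - p.2)) with hf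
  have h1 : ∑' p, f p = ∑' p, -conj (f p) := by
    rw [← (Equiv.prodComm Mode Mode).tsum_eq]
    refine tsum_congr fun p => ?_
    have hvp : v (p.2 - p.1) = conj (v (p.1 - p.2)) := by rw [← hherm, neg_sub]
    simp only [hf, Equiv.prodComm_apply, Prod.fst_swap, Prod.snd_swap, map_mul, Complex.conj_conj,
      Complex.conj_ofReal, hvp]
    rw [cross_swap p.1 p.2]
    push_cast
    ring
  rw [tsum_neg, ← Complex.conj_tsum] at h1
  have h2 := congrArg Complex.re h1
  rw [Complex.neg_re, Complex.conj_re] at h2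
  rw [Complex.neg_re]
  linarith

/-- This is `∫ v J(u, v) = 0`. For each fixed `l` the reflection `k ↦ l - k` reverses the sign of
the terms. -/
lemma tsum_conj_mul_adv_stream {u v : Mode → ℂ} (hv0 : FinEnergy 0 v) (hu : FinEnergy 1 u)
    (hv : FinEnergy 3 v) (hherm : Hermitian v) :
    ∑' k, conj (v k) * adv u v k = 0 := by
  rw [tsum_conj_mul_adv hv0 hu hv]
  have hs := summable_trilinear hv0 hu hv
  rw [← (Equiv.prodComm Mode Mode).tsum_eq]
  have hs' := (Equiv.prodComm Mode Mode).summable_iff.2 hs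
  rw [neg_eq_zero]
  refine (Summable.tsum_prod hs').trans ?_
  refine (tsum_congr fun l => ?_).trans tsum_zero
  set g : Mode → ℂ := fun k => conj (v k) * ((cross l k : ℂ) * u l * v (k - l)) with hg
  have h1 : ∑' k, g k = ∑' k, -g k := by
    rw [← (Equiv.subLeft l).tsum_eq]
    refine tsum_congr fun k => ?_
    have e1 : v (l - k) = conj (v (k - l)) := by rw [← hherm, neg_sub]
    have e2 : v (l - k - l) = conj (v k) := by rw [← hherm]; congr 1; abel
    simp only [hg, Equiv.subLeft_apply, e1, e2, cross_sub_left, Complex.conj_conj]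
    push_cast
    ring
  rw [tsum_neg] at h1
  have h2 : ∑' k, g k = 0 := by linear_combination h1 / 2
  exact h2

end Thermohaline

end

noncomputable section

namespace Thermohaline

open scoped ComplexConjugate

/-! ### The equations in Fourier space and their energy inequalities -/

/-- The symbol of `∂ₓ`. -/
def dx (k : Mode) : ℂ := 2 * Real.pi * Complex.I * (k 0 : ℂ)

/-- The right-hand side of the vorticity equation in Fourier space. -/
def rhsW (ν : ℝ) (w b : Mode → ℂ) (k : Mode) : ℂ :=
  -adv w (stream w) k + dx k * b k - (ν * eig k : ℝ) * w k

/-- The right-hand side of the density equation in Fourier space. -/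
def rhsB (κ Nsq : ℝ) (w b : Mode → ℂ) (k : Mode) : ℂ :=
  -adv b (stream w) k - Nsq * (dx k * stream w k) - (κ * eig k : ℝ) * b k

lemma norm_dx_sq_le (k : Mode) : ‖dx k‖ ^ 2 ≤ eig k := by
  have : ‖dx k‖ = 2 * Real.pi * |(k 0 : ℝ)| := by
    simp [dx, abs_of_pos Real.pi_pos]
  rw [this, mul_pow, sq_abs, eig]
  have : (0 : ℝ) ≤ (k 1 : ℝ) ^ 2 := sq_nonneg _
  gcongr
  linarith

lemma norm_dx_mul_sq_le (k : Mode) (z : ℂ) : ‖dx k * z‖ ^ 2 ≤ eig k * ‖z‖ ^ 2 := by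
  rw [norm_mul, mul_pow]
  exact mul_le_mul_of_nonneg_right (norm_dx_sq_le k) (sq_nonneg _)

lemma summable_mul_of_sq {ι : Type*} {p q : ι → ℂ} (hp : Summable fun k => ‖p k‖ ^ 2)
    (hq : Summable fun k => ‖q k‖ ^ 2) : Summable fun k => conj (p k) * q k := by
  refine Summable.of_norm_bounded (hp.add hq) fun k => ?_
  rw [norm_mul, RCLike.norm_conj]
  nlinarith [sq_nonneg (‖p k‖ - ‖q k‖), sq_nonneg (‖p k‖), sq_nonneg (‖q k‖)]

lemma FinEnergy.norm_sq {u : Mode → ℂ} (h : FinEnergy 0 u) : Summable fun k => ‖u k‖ ^ 2 := by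
  simpa [FinEnergy] using h

lemma three_sq_le (a b c : ℂ) : ‖a + b - c‖ ^ 2 ≤ 3 * ‖a‖ ^ 2 + 3 * ‖b‖ ^ 2 + 3 * ‖c‖ ^ 2 := by
  have h : ‖a + b - c‖ ≤ ‖a‖ + ‖b‖ + ‖c‖ :=
    (norm_sub_le _ _).trans (by gcongr; exact norm_add_le _ _)
  calc ‖a + b - c‖ ^ 2 ≤ (‖a‖ + ‖b‖ + ‖c‖) ^ 2 := by gcongr
    _ ≤ _ := by nlinarith [sq_nonneg (‖a‖ - ‖b‖), sq_nonneg (‖a‖ - ‖c‖), sq_nonneg (‖b‖ - ‖c‖)]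

section Pointwise

variable {ν κ Nsq : ℝ} {w b : Mode → ℂ}

lemma finEnergy_three_stream (hw0 : w 0 = 0) (hw : FinEnergy 1 w) : FinEnergy 3 (stream w) :=
  (finEnergy_stream hw0 1).2 hw

lemma finEnergy_stream_of_le (hw0 : w 0 = 0) (hw : FinEnergy 1 w) {n : ℕ} (hn : n ≤ 3) :
    FinEnergy n (stream w) := (finEnergy_three_stream hw0 hw).mono (stream_zero w) hn

lemma energy_stream_le (hw0 : w 0 = 0) (hw : FinEnergy 1 w) {n : ℕ} (hn : n ≤ 3) :
    energy n (stream w) ≤ energy 1 w := by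
  rw [← energy_stream hw0 1]
  exact energy_mono (stream_zero w) hn (finEnergy_three_stream hw0 hw)

lemma energy_adv_stream_le (hw0 : w 0 = 0) (hw : FinEnergy 1 w) {u : Mode → ℂ}
    (hu : FinEnergy 1 u) :
    FinEnergy 0 (adv u (stream w)) ∧
      energy 0 (adv u (stream w)) ≤ embConst * energy 1 w * energy 1 u := by
  have h := finEnergy_adv hu (finEnergy_three_stream hw0 hw)
  rwa [energy_stream hw0 1] at h

lemma norm_rhsW_sq_le (k : Mode) : ‖rhsW ν w b k‖ ^ 2 ≤
    3 * ‖adv w (stream w) k‖ ^ 2 + 3 * (eig k * ‖b k‖ ^ 2) + 3 * ν ^ 2 * (eig k ^ 2 * ‖w k‖ ^ 2) := by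
  refine (three_sq_le _ _ _).trans ?_
  have h1 := norm_dx_mul_sq_le k (b k)
  have h2 : ‖((ν * eig k : ℝ) : ℂ) * w k‖ ^ 2 = ν ^ 2 * (eig k ^ 2 * ‖w k‖ ^ 2) := by
    rw [norm_mul, Complex.norm_real, Real.norm_eq_abs, mul_pow, sq_abs]; ring
  rw [h2, norm_neg]
  linarith

lemma norm_rhsB_sq_le (k : Mode) : ‖rhsB κ Nsq w b k‖ ^ 2 ≤
    3 * ‖adv b (stream w) k‖ ^ 2 + 3 * Nsq ^ 2 * (eig k * ‖stream w k‖ ^ 2)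
      + 3 * κ ^ 2 * (eig k ^ 2 * ‖b k‖ ^ 2) := by
  rw [rhsB, sub_eq_add_neg (-adv b (stream w) k)]
  refine (three_sq_le _ _ _).trans ?_
  have h1 := norm_dx_mul_sq_le k (stream w k)
  have h3 : ‖(Nsq : ℂ) * (dx k * stream w k)‖ ^ 2 = Nsq ^ 2 * ‖dx k * stream w k‖ ^ 2 := by
    rw [norm_mul, Complex.norm_real, Real.norm_eq_abs, mul_pow, sq_abs]
  have h2 : ‖((κ * eig k : ℝ) : ℂ) * b k‖ ^ 2 = κ ^ 2 * (eig k ^ 2 * ‖b k‖ ^ 2) := by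
    rw [norm_mul, Complex.norm_real, Real.norm_eq_abs, mul_pow, sq_abs]; ring
  rw [norm_neg, norm_neg, h2, h3]
  nlinarith [mul_le_mul_of_nonneg_left h1 (sq_nonneg Nsq)]

/-- The bound is affine in `energy 2` once the energies of order one are bounded. Hence the velocity
is square integrable in time, as the energy identity requires. -/
lemma finEnergy_rhsW (hw0 : w 0 = 0) (hw : FinEnergy 2 w) (hb : FinEnergy 1 b) :
    FinEnergy 0 (rhsW ν w b) ∧ energy 0 (rhsW ν w b) ≤
      3 * (embConst * energy 1 w * energy 1 w) + 3 * energy 1 b + 3 * ν ^ 2 * energy 2 w := by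
  have hw1 : FinEnergy 1 w := hw.mono hw0 (by norm_num)
  have hA := energy_adv_stream_le hw0 hw1 hw1
  have hA' := hA.1.norm_sq
  have hb' : Summable fun k => eig k * ‖b k‖ ^ 2 := by simpa [FinEnergy] using hb
  have hw' : Summable fun k => eig k ^ 2 * ‖w k‖ ^ 2 := hw
  have hR := ((hA'.mul_left 3).add (hb'.mul_left 3)).add (hw'.mul_left (3 * ν ^ 2))
  have hs : Summable fun k => ‖rhsW ν w b k‖ ^ 2 :=
    Summable.of_nonneg_of_le (fun _ => sq_nonneg _) (fun k => norm_rhsW_sq_le k) hR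
  refine ⟨by simpa [FinEnergy] using hs, ?_⟩
  have h := hs.tsum_le_tsum (fun k => norm_rhsW_sq_le k) hR
  rw [((hA'.mul_left 3).add (hb'.mul_left 3)).tsum_add (hw'.mul_left (3 * ν ^ 2)),
    (hA'.mul_left 3).tsum_add (hb'.mul_left 3), tsum_mul_left, tsum_mul_left, tsum_mul_left] at h
  have h2 := hA.2
  simp only [energy, pow_zero, one_mul, pow_one] at h h2 ⊢
  linarith

lemma finEnergy_rhsB (hw0 : w 0 = 0) (hb0 : b 0 = 0) (hw : FinEnergy 1 w) (hb : FinEnergy 2 b) :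
    FinEnergy 0 (rhsB κ Nsq w b) ∧ energy 0 (rhsB κ Nsq w b) ≤
      3 * (embConst * energy 1 w * energy 1 b) + 3 * Nsq ^ 2 * energy 1 w
        + 3 * κ ^ 2 * energy 2 b := by
  have hb1 : FinEnergy 1 b := hb.mono hb0 (by norm_num)
  have hA := energy_adv_stream_le hw0 hw hb1
  have hA' := hA.1.norm_sq
  have hs' : Summable fun k => eig k * ‖stream w k‖ ^ 2 := by
    simpa [FinEnergy] using finEnergy_stream_of_le hw0 hw (n := 1) (by norm_num)
  have hb' : Summable fun k => eig k ^ 2 * ‖b k‖ ^ 2 := hb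
  have hR := ((hA'.mul_left 3).add (hs'.mul_left (3 * Nsq ^ 2))).add (hb'.mul_left (3 * κ ^ 2))
  have hs : Summable fun k => ‖rhsB κ Nsq w b k‖ ^ 2 :=
    Summable.of_nonneg_of_le (fun _ => sq_nonneg _) (fun k => norm_rhsB_sq_le k) hR
  refine ⟨by simpa [FinEnergy] using hs, ?_⟩
  have h := hs.tsum_le_tsum (fun k => norm_rhsB_sq_le k) hR
  rw [((hA'.mul_left 3).add (hs'.mul_left _)).tsum_add (hb'.mul_left _),
    (hA'.mul_left 3).tsum_add (hs'.mul_left _), tsum_mul_left, tsum_mul_left, tsum_mul_left] at h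
  have h2 := hA.2
  have h3 := mul_le_mul_of_nonneg_left (energy_stream_le hw0 hw (n := 1) (by norm_num))
    (show 0 ≤ 3 * Nsq ^ 2 by positivity)
  simp only [energy, pow_zero, one_mul, pow_one] at h h2 h3 ⊢
  linarith

/-! ### Energy production: the differential inequalities at a fixed time -/

/-- The production of the energy `∑ c |f|²` along the velocity `g`. -/
def production (c : Mode → ℝ) (f g : Mode → ℂ) : ℝ := ∑' k, 2 * c k * (conj (f k) * g k).re

lemma summable_re_conj_mul {p q : Mode → ℂ} (hp : FinEnergy 0 p) (hq : FinEnergy 0 q) :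
    Summable fun k => (conj (p k) * q k).re :=
  (summable_mul_of_sq hp.norm_sq hq.norm_sq).mapL Complex.reCLM

lemma re_tsum_conj_mul {p q : Mode → ℂ} (hp : FinEnergy 0 p) (hq : FinEnergy 0 q) :
    ∑' k, (conj (p k) * q k).re = (∑' k, conj (p k) * q k).re :=
  (Complex.re_tsum (summable_mul_of_sq hp.norm_sq hq.norm_sq)).symm

lemma abs_re_conj_mul_le (p q : ℂ) : |(conj p * q).re| ≤ ‖p‖ * ‖q‖ := by
  refine (Complex.abs_re_le_norm _).trans ?_
  rw [norm_mul, RCLike.norm_conj]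

lemma re_conj_mul_ofReal_mul (p : ℂ) (r : ℝ) : (conj p * ((r : ℂ) * p)).re = r * ‖p‖ ^ 2 := by
  rw [mul_left_comm, Complex.re_ofReal_mul, mul_comm (conj p), Complex.mul_conj,
    Complex.ofReal_re, Complex.normSq_eq_norm_sq]

/-- Dissipation of the basic energy `N² ‖∇ψ‖² + ‖ρ‖²`. -/
lemma production_basic (hw0 : w 0 = 0) (hb0 : b 0 = 0) (hwh : Hermitian w)
    (hw : FinEnergy 2 w) (hb : FinEnergy 2 b) :
    Nsq * production (fun k => (eig k)⁻¹) w (rhsW ν w b)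
        + production (fun _ => 1) b (rhsB κ Nsq w b)
      = -(2 * ν * Nsq * energy 0 w) - 2 * κ * energy 1 b := by
  have hw1 : FinEnergy 1 w := hw.mono hw0 (by norm_num)
  have hb1 : FinEnergy 1 b := hb.mono hb0 (by norm_num)
  have hw00 : FinEnergy 0 w := hw.mono hw0 (by norm_num)
  have hb00 : FinEnergy 0 b := hb.mono hb0 (by norm_num)
  have hs3 := finEnergy_three_stream hw0 hw1
  have hs0 := finEnergy_stream_of_le hw0 hw1 (n := 0) (by norm_num)
  have hAw := (energy_adv_stream_le hw0 hw1 hw1).1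
  have hAb := (energy_adv_stream_le hw0 hw1 hb1).1
  have o1 := tsum_conj_mul_adv_stream hs0 hw1 hs3 hwh.stream
  have o2 := re_tsum_conj_mul_adv_self hb00 hb1 hs3 hwh.stream
  have o1' : ∑' k, (conj (stream w k) * adv w (stream w) k).re = 0 := by
    rw [re_tsum_conj_mul hs0 hAw, o1, Complex.zero_re]
  have o2' : ∑' k, (conj (b k) * adv b (stream w) k).re = 0 := by
    rw [re_tsum_conj_mul hb00 hAb, o2]
  have s1 := summable_re_conj_mul hs0 hAw
  have s2 := summable_re_conj_mul hb00 hAb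
  have s3 := summable_re_conj_mul hs0 (finEnergy_rhsW (ν := ν) hw0 hw hb1).1
  have s4 := summable_re_conj_mul hb00 (finEnergy_rhsB (κ := κ) (Nsq := Nsq) hw0 hb0 hw1 hb).1
  -- The weight `eig⁻¹` turns pairing with the vorticity into pairing with minus the stream
  -- function, for which the Jacobian cancels.
  have e1 : ∀ k, 2 * (eig k)⁻¹ * (conj (w k) * rhsW ν w b k).re
      = -2 * (conj (stream w k) * rhsW ν w b k).re := fun k => by
    have : conj (stream w k) * rhsW ν w b k
        = ((-(eig k)⁻¹ : ℝ) : ℂ) * (conj (w k) * rhsW ν w b k) := by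
      simp only [stream, map_div₀, map_neg, Complex.conj_ofReal]; push_cast; ring
    rw [this, Complex.re_ofReal_mul]; ring
  have key : ∀ k, Nsq * (-2 * (conj (stream w k) * rhsW ν w b k).re)
        + 2 * 1 * (conj (b k) * rhsB κ Nsq w b k).re
      = (2 * Nsq) * (conj (stream w k) * adv w (stream w) k).re
        - 2 * (conj (b k) * adv b (stream w) k).re
        - (2 * ν * Nsq) * (eig k ^ 0 * ‖w k‖ ^ 2) - 2 * κ * (eig k ^ 1 * ‖b k‖ ^ 2) := by
    intro k
    -- As `dx k` is imaginary, `∂ₓ` is skew-adjoint: the coupling terms of the two equations are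
    -- opposite once the first is multiplied by `N²`.
    have h1 : (conj (stream w k) * (dx k * b k)).re = -(conj (b k) * (dx k * stream w k)).re := by
      have : conj (dx k) = -dx k := by
        have h2 : conj (2 : ℂ) = 2 := map_ofNat _ 2
        simp [dx, h2]
      rw [← Complex.conj_re, ← Complex.neg_re]
      congr 1
      simp only [map_mul, Complex.conj_conj, this]; ring
    have h2 : (conj (stream w k) * (((ν * eig k : ℝ) : ℂ) * w k)).re = -(ν * ‖w k‖ ^ 2) := by
      by_cases hk : k = 0
      · simp [hk, hw0]
      have hek : (eig k : ℂ) ≠ 0 := by exact_mod_cast eig_ne_zero hk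
      have : conj (stream w k) * (((ν * eig k : ℝ) : ℂ) * w k)
          = conj (w k) * (((-ν : ℝ) : ℂ) * w k) := by
        simp only [stream, map_div₀, map_neg, Complex.conj_ofReal]
        push_cast
        field_simp
      rw [this, re_conj_mul_ofReal_mul]; ring
    have h3 := re_conj_mul_ofReal_mul (b k) (κ * eig k)
    have h4 : (conj (b k) * ((Nsq : ℂ) * (dx k * stream w k))).re
        = Nsq * (conj (b k) * (dx k * stream w k)).re := by
      rw [mul_left_comm, Complex.re_ofReal_mul]
    simp only [rhsW, rhsB, mul_add, mul_sub, mul_neg, Complex.add_re, Complex.sub_re,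
      Complex.neg_re, h1, h2, h3, h4]
    ring
  unfold production
  simp only [e1]
  rw [← tsum_mul_left, ← ((s3.mul_left (-2)).mul_left Nsq).tsum_add (s4.mul_left (2 * 1))]
  simp only [key]
  rw [(((s1.mul_left _).sub (s2.mul_left _)).sub (hw00.mul_left _)).tsum_sub (hb1.mul_left _),
    ((s1.mul_left _).sub (s2.mul_left _)).tsum_sub (hw00.mul_left _),
    (s1.mul_left _).tsum_sub (s2.mul_left _)]
  simp only [tsum_mul_left, o1', o2', energy]
  ring

/-- The enstrophy inequality. -/
lemma production_enstrophy (hν : 0 < ν) (hw0 : w 0 = 0) (hb0 : b 0 = 0) (hwh : Hermitian w)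
    (hw : FinEnergy 2 w) (hb : FinEnergy 2 b) :
    production (fun _ => 1) w (rhsW ν w b) ≤ -(ν * energy 1 w) + ν⁻¹ * energy 0 b := by
  have hw1 : FinEnergy 1 w := hw.mono hw0 (by norm_num)
  have hb1 : FinEnergy 1 b := hb.mono hb0 (by norm_num)
  have hw00 : FinEnergy 0 w := hw.mono hw0 (by norm_num)
  have hb00 : FinEnergy 0 b := hb.mono hb0 (by norm_num)
  have hs3 := finEnergy_three_stream hw0 hw1
  have hAw := (energy_adv_stream_le hw0 hw1 hw1).1
  have o1 : ∑' k, (conj (w k) * adv w (stream w) k).re = 0 := by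
    rw [re_tsum_conj_mul hw00 hAw, re_tsum_conj_mul_adv_self hw00 hw1 hs3 hwh.stream]
  have s1 := summable_re_conj_mul hw00 hAw
  have s3 := summable_re_conj_mul hw00 (finEnergy_rhsW (ν := ν) hw0 hw hb1).1
  have key : ∀ k, 2 * 1 * (conj (w k) * rhsW ν w b k).re ≤
      -2 * (conj (w k) * adv w (stream w) k).re + -ν * (eig k ^ 1 * ‖w k‖ ^ 2)
        + ν⁻¹ * (eig k ^ 0 * ‖b k‖ ^ 2) := by
    intro k
    have h3 := re_conj_mul_ofReal_mul (w k) (ν * eig k)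
    have h1 : (conj (w k) * (dx k * b k)).re ≤ Real.sqrt (eig k) * ‖w k‖ * ‖b k‖ := by
      refine (le_abs_self _).trans ((abs_re_conj_mul_le _ _).trans ?_)
      rw [norm_mul]
      have : ‖dx k‖ ≤ Real.sqrt (eig k) := Real.le_sqrt_of_sq_le (norm_dx_sq_le k)
      calc ‖w k‖ * (‖dx k‖ * ‖b k‖) ≤ ‖w k‖ * (Real.sqrt (eig k) * ‖b k‖) := by gcongr
        _ = _ := by ring
    -- The `x`-derivative is moved from `b` to `w` and absorbed by half of the viscous dissipation,
    -- so that only `‖ρ‖` remains on the right.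
    have h2 : 2 * (Real.sqrt (eig k) * ‖w k‖ * ‖b k‖)
        ≤ ν * (eig k * ‖w k‖ ^ 2) + ν⁻¹ * ‖b k‖ ^ 2 := by
      have e : eig k * ‖w k‖ ^ 2 = (Real.sqrt (eig k) * ‖w k‖) ^ 2 := by
        rw [mul_pow, Real.sq_sqrt (eig_nonneg k)]
      rw [e]
      have := sq_nonneg (ν * (Real.sqrt (eig k) * ‖w k‖) - ‖b k‖)
      have h : 0 ≤ ν⁻¹ * (ν * (Real.sqrt (eig k) * ‖w k‖) - ‖b k‖) ^ 2 := by positivity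
      have h' : ν⁻¹ * (ν * (Real.sqrt (eig k) * ‖w k‖) - ‖b k‖) ^ 2
          = ν * (Real.sqrt (eig k) * ‖w k‖) ^ 2 - 2 * (Real.sqrt (eig k) * ‖w k‖ * ‖b k‖)
            + ν⁻¹ * ‖b k‖ ^ 2 := by field_simp; ring
      linarith
    simp only [rhsW, mul_add, mul_sub, mul_neg, Complex.add_re, Complex.sub_re,
      Complex.neg_re, h3]
    simp only [pow_zero, one_mul, pow_one]
    linarith
  unfold production
  have hR := ((s1.mul_left (-2)).add (hw1.mul_left (-ν))).add (hb00.mul_left ν⁻¹)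
  refine ((s3.mul_left (2 * 1)).tsum_le_tsum key hR).trans (le_of_eq ?_)
  rw [((s1.mul_left (-2)).add (hw1.mul_left (-ν))).tsum_add (hb00.mul_left ν⁻¹),
    (s1.mul_left (-2)).tsum_add (hw1.mul_left (-ν))]
  simp only [tsum_mul_left, o1, energy]
  ring

/-- The difference of the two sides is `ν⁻¹` times a sum of two squares. -/
lemma two_mul_add_le {ν x p q : ℝ} (hν : 0 < ν) :
    2 * x * (p + q) ≤ ν * x ^ 2 + 2 / ν * (p ^ 2 + q ^ 2) := by
  have h : 0 ≤ ν⁻¹ * ((ν * x - (p + q)) ^ 2 + (p - q) ^ 2) := by positivity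
  have h' : ν⁻¹ * ((ν * x - (p + q)) ^ 2 + (p - q) ^ 2)
      = ν * x ^ 2 - 2 * x * (p + q) + 2 / ν * (p ^ 2 + q ^ 2) := by field_simp; ring
  linarith

lemma summable_eig_mul_re {f g : Mode → ℂ} (hf : FinEnergy 2 f) (hg : FinEnergy 0 g) :
    Summable fun k => 2 * eig k * (conj (f k) * g k).re := by
  have h : FinEnergy 0 fun k => (eig k : ℂ) * f k := by
    simpa [FinEnergy, mul_pow, sq_abs] using hf
  refine ((summable_re_conj_mul h hg).mul_left 2).congr fun k => ?_
  rw [map_mul, Complex.conj_ofReal, mul_assoc (eig k : ℂ), Complex.re_ofReal_mul]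
  ring

/-- Shared by both gradient estimates. No cancellation is used: `A` (the Jacobian) and `q` (the
coupling) are paired with `eig * f` and absorbed by half of the dissipation `2κ * energy 2 f`. -/
lemma production_eig_le {κ : ℝ} (hκ : 0 < κ) {f g A q : Mode → ℂ} (hf : FinEnergy 2 f)
    (hA : FinEnergy 0 A) (hq : FinEnergy 0 q) (hg0 : FinEnergy 0 g)
    (hg : ∀ k, g k = -A k + q k - (κ * eig k : ℝ) * f k) :
    production eig f g ≤ -(κ * energy 2 f) + 2 / κ * (energy 0 A + energy 0 q) := by
  have key : ∀ k, 2 * eig k * (conj (f k) * g k).re ≤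
      -κ * (eig k ^ 2 * ‖f k‖ ^ 2) + 2 / κ * (eig k ^ 0 * ‖A k‖ ^ 2 + eig k ^ 0 * ‖q k‖ ^ 2) := by
    intro k
    have h3 := re_conj_mul_ofReal_mul (f k) (κ * eig k)
    have h1 := (neg_le_abs _).trans (abs_re_conj_mul_le (f k) (A k))
    have h2 := (le_abs_self _).trans (abs_re_conj_mul_le (f k) (q k))
    have h4 := two_mul_add_le (x := eig k * ‖f k‖) (p := ‖A k‖) (q := ‖q k‖) hκ
    rw [hg k]
    simp only [mul_add, mul_sub, mul_neg, Complex.add_re, Complex.sub_re, Complex.neg_re, h3,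
      pow_zero, one_mul] at *
    have he := eig_nonneg k
    nlinarith [mul_le_mul_of_nonneg_left h1 he, mul_le_mul_of_nonneg_left h2 he]
  unfold production
  have hR := (hf.mul_left (-κ)).add ((hA.add hq).mul_left (2 / κ))
  refine ((summable_eig_mul_re hf hg0).tsum_le_tsum key hR).trans (le_of_eq ?_)
  rw [(hf.mul_left (-κ)).tsum_add ((hA.add hq).mul_left (2 / κ)), tsum_mul_left, tsum_mul_left,
    hA.tsum_add hq]
  simp only [energy]
  ring

lemma finEnergy_dx_mul {u : Mode → ℂ} (hu : FinEnergy 1 u) :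
    FinEnergy 0 (fun k => dx k * u k) ∧ energy 0 (fun k => dx k * u k) ≤ energy 1 u := by
  have hle : ∀ k, eig k ^ 0 * ‖dx k * u k‖ ^ 2 ≤ eig k ^ 1 * ‖u k‖ ^ 2 := fun k => by
    simpa using norm_dx_mul_sq_le k (u k)
  have hs : FinEnergy 0 (fun k => dx k * u k) :=
    Summable.of_nonneg_of_le (fun k => by positivity) hle hu
  exact ⟨hs, hs.tsum_le_tsum hle hu⟩

/-- The quadratic term `energy 1 w * energy 1 w` is meant to be read as coefficient times unknown in
Gronwall's inequality, the coefficient being integrable in time by `enstrophy_bound`. -/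
lemma production_grad_w (hν : 0 < ν) (hw0 : w 0 = 0) (hb0 : b 0 = 0)
    (hw : FinEnergy 2 w) (hb : FinEnergy 2 b) :
    production eig w (rhsW ν w b) ≤ -(ν * energy 2 w)
      + 2 / ν * (embConst * energy 1 w * energy 1 w + energy 1 b) := by
  have hw1 : FinEnergy 1 w := hw.mono hw0 (by norm_num)
  have hb1 : FinEnergy 1 b := hb.mono hb0 (by norm_num)
  have hA := energy_adv_stream_le hw0 hw1 hw1
  have hq := finEnergy_dx_mul hb1
  refine (production_eig_le hν hw hA.1 hq.1 (finEnergy_rhsW (ν := ν) hw0 hw hb1).1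
    fun k => rfl).trans ?_
  have := hA.2
  have := hq.2
  gcongr

lemma production_grad_b (hκ : 0 < κ) (hw0 : w 0 = 0) (hb0 : b 0 = 0)
    (hw : FinEnergy 2 w) (hb : FinEnergy 2 b) :
    production eig b (rhsB κ Nsq w b) ≤ -(κ * energy 2 b)
      + 2 / κ * (embConst * energy 1 w * energy 1 b + Nsq ^ 2 * energy 1 w) := by
  have hw1 : FinEnergy 1 w := hw.mono hw0 (by norm_num)
  have hb1 : FinEnergy 1 b := hb.mono hb0 (by norm_num)
  have hA := energy_adv_stream_le hw0 hw1 hb1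
  have hq := finEnergy_dx_mul (finEnergy_stream_of_le hw0 hw1 (n := 1) (by norm_num))
  have e : ∀ k, eig k ^ 0 * ‖-((Nsq : ℂ) * (dx k * stream w k))‖ ^ 2
      = Nsq ^ 2 * (eig k ^ 0 * ‖dx k * stream w k‖ ^ 2) := fun k => by
    rw [norm_neg, norm_mul, Complex.norm_real, Real.norm_eq_abs, mul_pow, sq_abs]; ring
  have hq' : FinEnergy 0 fun k => -((Nsq : ℂ) * (dx k * stream w k)) := by
    simp only [FinEnergy, e]; exact hq.1.mul_left _
  have hq2 : energy 0 (fun k => -((Nsq : ℂ) * (dx k * stream w k))) ≤ Nsq ^ 2 * energy 1 w := by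
    have : energy 0 (fun k => -((Nsq : ℂ) * (dx k * stream w k)))
        = Nsq ^ 2 * energy 0 (fun k => dx k * stream w k) := by
      simp only [energy, e, tsum_mul_left]
    rw [this]
    exact mul_le_mul_of_nonneg_left
      (hq.2.trans (energy_stream_le hw0 hw1 (n := 1) (by norm_num))) (sq_nonneg _)
  refine (production_eig_le hκ hb hA.1 hq' (finEnergy_rhsB (κ := κ) (Nsq := Nsq) hw0 hb0 hw1 hb).1
    fun k => by rw [rhsB]; ring).trans ?_
  have := hA.2
  gcongr

end Pointwise

end Thermohaline

end

noncomputable section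

namespace Thermohaline

open scoped ComplexConjugate

/-! ### The energy identity -/

/-- The exponent `3` still exceeds the dimension `2`. This is the decay in `k - l` of the
coefficients of a stream function whose vorticity is bounded in `H¹`. -/
lemma summable_inv_sqrt_eig_cube : Summable fun k : Mode => (Real.sqrt (eig k ^ 3))⁻¹ := by
  have h := EisensteinSeries.summable_one_div_norm_rpow (k := 3) (by norm_num)
  refine Summable.of_nonneg_of_le (fun k => by positivity) (fun k => ?_) h
  by_cases hk : k = 0
  · subst hk; simp
  have hn : 0 < ‖k‖ := norm_pos_iff.2 hk
  rw [Real.rpow_neg hn.le]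
  refine inv_anti₀ (by positivity) (Real.le_sqrt_of_sq_le ?_)
  have h3 : ‖k‖ ^ (3 : ℝ) = ‖k‖ ^ 3 := by exact_mod_cast Real.rpow_natCast ‖k‖ 3
  rw [h3]
  calc (‖k‖ ^ 3) ^ 2 = (‖k‖ ^ 2) ^ 3 := by ring
    _ ≤ eig k ^ 3 := by have := norm_sq_le_eig k; gcongr

/-- A majorant of the terms of the convolution that depends on bounds of the energies only. -/
lemma norm_adv_stream_term_le {w u : Mode → ℂ} {M : ℝ} (hw0 : w 0 = 0) (hw : FinEnergy 1 w)
    (hu : FinEnergy 1 u) (hwM : energy 1 w ≤ M) (huM : energy 1 u ≤ M) (k l : Mode) :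
    ‖(cross l k : ℂ) * u l * stream w (k - l)‖
      ≤ Real.sqrt (eig k) * M * (Real.sqrt (eig (k - l) ^ 3))⁻¹ := by
  have hM : 0 ≤ M := (energy_nonneg 1 w).trans hwM
  have h1 : Real.sqrt (eig l) * ‖u l‖ ≤ Real.sqrt M := by
    refine Real.le_sqrt_of_sq_le ?_
    rw [mul_pow, Real.sq_sqrt (eig_nonneg l)]
    simpa using (hu.le_energy l).trans huM
  have h2 : ‖stream w (k - l)‖ ≤ Real.sqrt M * (Real.sqrt (eig (k - l) ^ 3))⁻¹ := by
    by_cases hk : k - l = 0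
    · rw [hk, stream_zero]; simp
    have hp : 0 < Real.sqrt (eig (k - l) ^ 3) := Real.sqrt_pos.2 (pow_pos (eig_pos hk) 3)
    rw [← div_eq_mul_inv, le_div_iff₀ hp]
    refine Real.le_sqrt_of_sq_le ?_
    rw [mul_pow, Real.sq_sqrt (pow_nonneg (eig_nonneg _) 3), mul_comm,
      eig_pow_mul_norm_stream hw0 1]
    exact (hw.le_energy _).trans hwM
  rw [norm_mul, norm_mul, Complex.norm_real, Real.norm_eq_abs]
  calc |cross l k| * ‖u l‖ * ‖stream w (k - l)‖
      ≤ (Real.sqrt (eig l) * Real.sqrt (eig k)) * ‖u l‖ *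
        (Real.sqrt M * (Real.sqrt (eig (k - l) ^ 3))⁻¹) := by
        gcongr; exact abs_cross_le l k
    _ = Real.sqrt (eig k) * (Real.sqrt (eig l) * ‖u l‖) * Real.sqrt M
        * (Real.sqrt (eig (k - l) ^ 3))⁻¹ := by ring
    _ ≤ Real.sqrt (eig k) * Real.sqrt M * Real.sqrt M * (Real.sqrt (eig (k - l) ^ 3))⁻¹ := by
        gcongr
    _ = _ := by rw [mul_assoc (Real.sqrt (eig k)), Real.mul_self_sqrt hM]

lemma summable_adv_majorant (M : ℝ) (k : Mode) :
    Summable fun l => Real.sqrt (eig k) * M * (Real.sqrt (eig (k - l) ^ 3))⁻¹ :=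
  (((Equiv.subLeft k).summable_iff (f := fun m : Mode => (Real.sqrt (eig m ^ 3))⁻¹)).2
    summable_inv_sqrt_eig_cube).mul_left _

/-- A bound of the Fourier coefficient `k` of the Jacobian. -/
def advBound (M : ℝ) (k : Mode) : ℝ :=
  ∑' l, Real.sqrt (eig k) * M * (Real.sqrt (eig (k - l) ^ 3))⁻¹

lemma norm_adv_stream_le {w u : Mode → ℂ} {M : ℝ} (hw0 : w 0 = 0) (hw : FinEnergy 1 w)
    (hu : FinEnergy 1 u) (hwM : energy 1 w ≤ M) (huM : energy 1 u ≤ M) (k : Mode) :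
    ‖adv u (stream w) k‖ ≤ advBound M k := by
  rw [adv, norm_neg]
  exact tsum_of_norm_bounded (summable_adv_majorant M k).hasSum
    (norm_adv_stream_term_le hw0 hw hu hwM huM k)

/-- Each term of the convolution is continuous, and for fixed `k` the majorant does not depend on
time, so the series converges uniformly. -/
lemma continuousOn_adv {s : Set ℝ} {w u : ℝ → Mode → ℂ} {M : ℝ} (hw0 : ∀ t ∈ s, w t 0 = 0)
    (hw : ∀ t ∈ s, FinEnergy 1 (w t) ∧ energy 1 (w t) ≤ M)
    (hu : ∀ t ∈ s, FinEnergy 1 (u t) ∧ energy 1 (u t) ≤ M)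
    (hwc : ∀ k, ContinuousOn (fun t => w t k) s) (huc : ∀ k, ContinuousOn (fun t => u t k) s)
    (k : Mode) : ContinuousOn (fun t => adv (u t) (stream (w t)) k) s := by
  unfold adv
  refine ContinuousOn.neg (continuousOn_tsum (fun l => ?_) (summable_adv_majorant M k) ?_)
  · exact (continuousOn_const.mul (huc l)).mul ((hwc (k - l)).neg.div_const _)
  · intro l t ht
    exact norm_adv_stream_term_le (hw0 t ht) (hw t ht).1 (hu t ht).1 (hw t ht).2 (hu t ht).2 k l

lemma hasDerivAt_norm_sq {f : ℝ → ℂ} {f' : ℂ} {t : ℝ} (h : HasDerivAt f f' t) :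
    HasDerivAt (fun s => ‖f s‖ ^ 2) (2 * (conj (f t) * f').re) t := by
  have := h.norm_sq
  convert this using 1
  rw [Complex.inner, mul_comm (conj _)]

/-- The energy identity, with a time-dependent weight `θ`, for a curve of Fourier coefficients
all of whose components are continuously differentiable. -/
lemma energy_identity {T : ℝ} {f f' : ℝ → Mode → ℂ} {c : Mode → ℝ} {θ θ' : ℝ → ℝ}
    (hfc : ∀ k, ContinuousOn (fun t => f t k) (Icc 0 T))
    (hfc' : ∀ k, ContinuousOn (fun t => f' t k) (Icc 0 T))
    (hd : ∀ t ∈ Ioo 0 T, ∀ k, HasDerivAt (fun s => f s k) (f' t k) t)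
    (hf0 : ∀ t ∈ Icc 0 T, f t 0 = 0)
    (hint : IntegrableOn (fun t => ∑' k, (eig k ^ 2 * ‖f t k‖ ^ 2 + ‖f' t k‖ ^ 2)) (Ioc 0 T))
    (hsum : ∀ᵐ t ∂(volume.restrict (Ioc 0 T)),
      Summable fun k => (eig k ^ 2 * ‖f t k‖ ^ 2 + ‖f' t k‖ ^ 2))
    (hc : ∀ k, 0 ≤ c k) (hce : ∀ k, k ≠ 0 → c k ≤ eig k)
    (hcs : ∀ t ∈ Icc 0 T, Summable fun k => c k * ‖f t k‖ ^ 2)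
    (hθ : ContinuousOn θ (Icc 0 T)) (hθ' : ContinuousOn θ' (Icc 0 T))
    (hθd : ∀ t ∈ Ioo 0 T, HasDerivAt θ (θ' t) t) {t : ℝ} (ht : t ∈ Icc 0 T) :
    IntervalIntegrable (fun s => θ' s * (∑' k, c k * ‖f s k‖ ^ 2)
      + θ s * production c (f s) (f' s)) volume 0 t ∧
    θ t * (∑' k, c k * ‖f t k‖ ^ 2) = θ 0 * (∑' k, c k * ‖f 0 k‖ ^ 2) +
      ∫ s in (0 : ℝ)..t, (θ' s * (∑' k, c k * ‖f s k‖ ^ 2)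
        + θ s * production c (f s) (f' s)) := by
  obtain ⟨A, hA⟩ := isCompact_Icc.exists_bound_of_continuousOn hθ
  obtain ⟨A', hA'⟩ := isCompact_Icc.exists_bound_of_continuousOn hθ'
  have h0T : (0 : ℝ) ∈ Icc 0 T := ⟨le_rfl, ht.1.trans ht.2⟩
  have hsub : Icc 0 t ⊆ Icc 0 T := Icc_subset_Icc_right ht.2
  have hIoc : Ioc 0 t ⊆ Ioc 0 T := Ioc_subset_Ioc_right ht.2
  -- `F k` is the time derivative of the contribution `θ * c k * ‖f k‖ ^ 2` of a single mode.
  set F : Mode → ℝ → ℝ := fun k s =>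
    θ' s * (c k * ‖f s k‖ ^ 2) + θ s * (2 * c k * (conj (f s k) * f' s k).re) with hF
  have hFc : ∀ k, ContinuousOn (F k) (Icc 0 T) := fun k => by
    refine (hθ'.mul (continuousOn_const.mul ((hfc k).norm.pow 2))).add
      (hθ.mul (continuousOn_const.mul ?_))
    exact Complex.continuous_re.comp_continuousOn
      ((Complex.continuous_conj.comp_continuousOn (hfc k)).mul (hfc' k))
  have hFTC : ∀ k, ∫ s in (0 : ℝ)..t, F k s
      = θ t * (c k * ‖f t k‖ ^ 2) - θ 0 * (c k * ‖f 0 k‖ ^ 2) := fun k => by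
    refine intervalIntegral.integral_eq_sub_of_hasDerivAt_of_le ht.1
      (f := fun s => θ s * (c k * ‖f s k‖ ^ 2)) ?_ ?_ ?_
    · exact (hθ.mul (continuousOn_const.mul ((hfc k).norm.pow 2))).mono hsub
    · intro s hs
      have hs' : s ∈ Ioo 0 T := ⟨hs.1, hs.2.trans_le ht.2⟩
      have := (hθd s hs').mul ((hasDerivAt_norm_sq (hd s hs' k)).const_mul (c k))
      refine HasDerivAt.congr_deriv this ?_
      change _ = θ' s * (c k * ‖f s k‖ ^ 2) + θ s * (2 * c k * (conj (f s k) * f' s k).re)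
      ring
    · exact ((hFc k).mono hsub).intervalIntegrable_of_Icc ht.1
  -- Off the zero mode `c ≤ eig ≤ eig ^ 2`, and at the zero mode `f` vanishes.
  have hle1 : ∀ s ∈ Icc 0 T, ∀ k, c k * ‖f s k‖ ^ 2 ≤ eig k ^ 2 * ‖f s k‖ ^ 2 := fun s hs k => by
    by_cases hk : k = 0
    · simp [hk, hf0 s hs]
    · have h1 := one_le_eig hk
      have h2 := hce k hk
      gcongr
      nlinarith
  have hle2 : ∀ s ∈ Icc 0 T, ∀ k, |2 * c k * (conj (f s k) * f' s k).re|
      ≤ eig k ^ 2 * ‖f s k‖ ^ 2 + ‖f' s k‖ ^ 2 := fun s hs k => by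
    have h1 : c k * ‖f s k‖ ≤ eig k * ‖f s k‖ := by
      by_cases hk : k = 0
      · simp [hk, hf0 s hs]
      · exact mul_le_mul_of_nonneg_right (hce k hk) (norm_nonneg _)
    rw [abs_mul, abs_of_nonneg (by have := hc k; positivity)]
    have h2 := abs_re_conj_mul_le (f s k) (f' s k)
    calc 2 * c k * |(conj (f s k) * f' s k).re|
        ≤ 2 * c k * (‖f s k‖ * ‖f' s k‖) := by have := hc k; gcongr
      _ = 2 * (c k * ‖f s k‖) * ‖f' s k‖ := by ring
      _ ≤ 2 * (eig k * ‖f s k‖) * ‖f' s k‖ := by gcongr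
      _ ≤ _ := by nlinarith [sq_nonneg (eig k * ‖f s k‖ - ‖f' s k‖)]
  set D : Mode → ℝ → ℝ := fun k s => (A' + A) * (eig k ^ 2 * ‖f s k‖ ^ 2 + ‖f' s k‖ ^ 2) with hD
  have hFD : ∀ s ∈ Icc 0 T, ∀ k, ‖F k s‖ ≤ D k s := fun s hs k => by
    have hA0 := (norm_nonneg _).trans (hA s hs)
    have hA0' := (norm_nonneg _).trans (hA' s hs)
    simp only [hF, hD]
    refine (norm_add_le _ _).trans ?_
    rw [add_mul, norm_mul, norm_mul (θ s)]
    refine add_le_add (mul_le_mul (hA' s hs) ?_ (norm_nonneg _) hA0')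
      (mul_le_mul (hA s hs) ?_ (norm_nonneg _) hA0)
    · rw [Real.norm_eq_abs, abs_of_nonneg (mul_nonneg (hc k) (sq_nonneg _))]
      have := hle1 s hs k
      have := sq_nonneg ‖f' s k‖
      linarith
    · exact hle2 s hs k
  have hsum' : ∀ᵐ s ∂volume, s ∈ Ioc 0 T →
      Summable fun k => (eig k ^ 2 * ‖f s k‖ ^ 2 + ‖f' s k‖ ^ 2) :=
    (ae_restrict_iff' measurableSet_Ioc).1 hsum
  have hFsum : ∀ᵐ s ∂volume, s ∈ Ioc 0 T → HasSum (fun k => F k s)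
      (θ' s * (∑' k, c k * ‖f s k‖ ^ 2) + θ s * production c (f s) (f' s)) := by
    filter_upwards [hsum'] with s hs hsT
    have hsI : s ∈ Icc 0 T := Ioc_subset_Icc_self hsT
    refine ((hcs s hsI).hasSum.mul_left _).add (HasSum.mul_left _ (Summable.hasSum ?_))
    exact Summable.of_norm_bounded (hs hsT) fun k => by
      rw [Real.norm_eq_abs]; exact hle2 s hsI k
  have hDint : IntegrableOn (fun s => ∑' k, D k s) (Ioc 0 T) := by
    simp only [hD, tsum_mul_left]; exact hint.const_mul _
  have huIoc : uIoc 0 t = Ioc 0 t := uIoc_of_le ht.1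
  have hDi : IntervalIntegrable (fun s => ∑' k, D k s) volume 0 t :=
    (intervalIntegrable_iff_integrableOn_Ioc_of_le ht.1).2 (hDint.mono_set hIoc)
  -- Summation over modes is exchanged with integration in time. The conclusion then compares the
  -- resulting sum with the one that `hFTC` computes mode by mode.
  have key := intervalIntegral.hasSum_integral_of_dominated_convergence (μ := volume) (a := 0)
    (b := t) (F := F) (f := fun s => θ' s * (∑' k, c k * ‖f s k‖ ^ 2)
      + θ s * production c (f s) (f' s)) D
    (fun k => by
      rw [huIoc]
      exact ((hFc k).mono (Ioc_subset_Icc_self.trans hsub)).aestronglyMeasurable measurableSet_Ioc)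
    (fun k => ae_of_all _ fun s hs => hFD s (hsub (Ioc_subset_Icc_self (huIoc ▸ hs))) k)
    (by
      filter_upwards [hsum'] with s hs hst
      exact (hs (hIoc (huIoc ▸ hst))).mul_left _)
    hDi
    (by
      filter_upwards [hFsum] with s hs hst
      exact hs (hIoc (huIoc ▸ hst)))
  constructor
  · rw [intervalIntegrable_iff_integrableOn_Ioc_of_le ht.1]
    refine Integrable.mono' (hDint.mono_set hIoc) ?_ ?_
    · have hmeas : AEStronglyMeasurable (fun s => ∑' k, F k s) (volume.restrict (Ioc 0 t)) := by
        refine (AEMeasurable.tsum fun k => ?_).aestronglyMeasurable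
        exact ((hFc k).mono (Ioc_subset_Icc_self.trans hsub)).aemeasurable measurableSet_Ioc
      refine hmeas.congr ?_
      refine (ae_restrict_iff' measurableSet_Ioc).2 ?_
      filter_upwards [hFsum] with s h1 hs
      exact (h1 (hIoc hs)).tsum_eq
    · refine (ae_restrict_iff' measurableSet_Ioc).2 ?_
      filter_upwards [hFsum, hsum'] with s h1 h2 hs
      have hDs : Summable fun k => D k s := (h2 (hIoc hs)).mul_left _
      rw [← (h1 (hIoc hs)).tsum_eq]
      exact tsum_of_norm_bounded hDs.hasSum (hFD s (hsub (Ioc_subset_Icc_self hs)))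
  · simp only [hFTC] at key
    have key2 := ((hcs t ht).hasSum.mul_left (θ t)).sub ((hcs 0 h0T).hasSum.mul_left (θ 0))
    have := key.unique key2
    linarith

end Thermohaline

end

noncomputable section

namespace Thermohaline

open scoped ComplexConjugate

/-! ### A priori estimates -/

/-- `y` is absolutely continuous on `[0, T]` with derivative `g`, expressed by integration by parts
against weights that are continuously differentiable. -/
def HasWeakTimeDeriv (T : ℝ) (y g : ℝ → ℝ) : Prop :=
  ∀ θ θ' : ℝ → ℝ, ContinuousOn θ (Icc 0 T) → ContinuousOn θ' (Icc 0 T) →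
    (∀ t ∈ Ioo 0 T, HasDerivAt θ (θ' t) t) → ∀ t ∈ Icc 0 T,
      IntervalIntegrable (fun s => θ' s * y s + θ s * g s) volume 0 t ∧
      θ t * y t = θ 0 * y 0 + ∫ s in (0 : ℝ)..t, (θ' s * y s + θ s * g s)

lemma HasWeakTimeDeriv.add_const_mul {T : ℝ} {y g y₂ g₂ : ℝ → ℝ} (h : HasWeakTimeDeriv T y g)
    (h₂ : HasWeakTimeDeriv T y₂ g₂) (a : ℝ) :
    HasWeakTimeDeriv T (fun s => a * y s + y₂ s) (fun s => a * g s + g₂ s) := by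
  intro θ θ' hθ hθ' hd t ht
  obtain ⟨i1, e1⟩ := h θ θ' hθ hθ' hd t ht
  obtain ⟨i2, e2⟩ := h₂ θ θ' hθ hθ' hd t ht
  have hfun : (fun s => θ' s * (a * y s + y₂ s) + θ s * (a * g s + g₂ s))
      = fun s => a * (θ' s * y s + θ s * g s) + (θ' s * y₂ s + θ s * g₂ s) := by
    ext s; ring
  rw [hfun]
  refine ⟨(i1.const_mul a).add i2, ?_⟩
  rw [intervalIntegral.integral_add (i1.const_mul a) i2, intervalIntegral.integral_const_mul]
  linear_combination a * e1 + e2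

/-- With weight `1`, `y` is a primitive of an integrable function. This supplies continuity in time
of the energies, where a mode solution assumes it only of single coefficients. -/
lemma HasWeakTimeDeriv.continuousOn {T : ℝ} {y g : ℝ → ℝ} (h : HasWeakTimeDeriv T y g) :
    ContinuousOn y (Icc 0 T) := by
  rcases lt_or_ge T 0 with hT | hT
  · simp [Icc_eq_empty (not_le.2 hT)]
  have h1 := fun t ht => h (fun _ => 1) (fun _ => 0) continuousOn_const continuousOn_const
    (fun t _ => hasDerivAt_const t 1) t ht
  simp only [zero_mul, one_mul, zero_add] at h1
  have hc := intervalIntegral.continuousOn_primitive_interval (f := g) (μ := volume) (a := 0)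
    (b := T) (by
      rw [uIcc_of_le hT, integrableOn_Icc_iff_integrableOn_Ioc]
      exact (intervalIntegrable_iff_integrableOn_Ioc_of_le hT).1 (h1 T ⟨hT, le_rfl⟩).1)
  rw [uIcc_of_le hT] at hc
  exact (hc.const_add (y 0)).congr fun t ht => (h1 t ht).2

/-- A Gronwall inequality that keeps track of the dissipation. -/
lemma HasWeakTimeDeriv.gronwall {T : ℝ} {y g Y z F : ℝ → ℝ} (h : HasWeakTimeDeriv T y g)
    {β q A B : ℝ} (hq : 0 ≤ q)
    (hg : ∀ᵐ s ∂(volume.restrict (Ioc 0 T)), g s ≤ -(2 * Y s) + q * z s * y s + F s)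
    (hyY : ∀ᵐ s ∂(volume.restrict (Ioc 0 T)), β * y s ≤ Y s)
    (hY : IntegrableOn Y (Ioc 0 T)) (hF : IntegrableOn F (Ioc 0 T))
    (hz : ContinuousOn z (Icc 0 T)) (hy0 : ∀ s ∈ Icc 0 T, 0 ≤ y s)
    (hY0 : ∀ s ∈ Icc 0 T, 0 ≤ Y s)
    (hz0 : ∀ s ∈ Icc 0 T, 0 ≤ z s) (hF0 : ∀ s ∈ Icc 0 T, 0 ≤ F s) {t : ℝ} (ht : t ∈ Icc 0 T)
    (hA : ∫ s in (0 : ℝ)..t, z s ≤ A) (hB : ∫ s in (0 : ℝ)..t, Real.exp (β * s) * F s ≤ B) :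
    Real.exp (β * t) * y t + ∫ s in (0 : ℝ)..t, Real.exp (β * s) * Y s
      ≤ Real.exp (q * A) * (y 0 + B) := by
  have hT : 0 ≤ T := ht.1.trans ht.2
  set P : ℝ → ℝ := fun s => ∫ r in (0 : ℝ)..s, z r with hP
  have hzi : IntervalIntegrable z volume 0 T := hz.intervalIntegrable_of_Icc hT
  have hPc : ContinuousOn P (Icc 0 T) := by
    have := intervalIntegral.continuousOn_primitive_interval (f := z) (μ := volume) (a := 0)
      (b := T) (by rw [uIcc_of_le hT]; exact hz.integrableOn_Icc)
    rwa [uIcc_of_le hT] at this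
  have hPd : ∀ s ∈ Ioo 0 T, HasDerivAt P (z s) s := fun s hs => by
    have hnhds : Icc 0 T ∈ nhds s := Icc_mem_nhds hs.1 hs.2
    refine intervalIntegral.integral_hasDerivAt_right
      ((hz.mono (Icc_subset_Icc_right hs.2.le)).intervalIntegrable_of_Icc hs.1.le) ?_
      (hz.continuousAt hnhds)
    exact ⟨Icc 0 T, hnhds, hz.aestronglyMeasurable measurableSet_Icc⟩
  have hP0 : ∀ s ∈ Icc 0 T, 0 ≤ P s := fun s hs =>
    intervalIntegral.integral_nonneg hs.1 fun r hr => hz0 r ⟨hr.1, hr.2.trans hs.2⟩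
  have hPt : ∀ s ∈ Icc 0 t, P s ≤ A := fun s hs => by
    refine le_trans ?_ hA
    refine intervalIntegral.integral_mono_interval le_rfl hs.1 hs.2 ?_
      ((hz.mono (Icc_subset_Icc_right ht.2)).intervalIntegrable_of_Icc ht.1)
    refine (ae_restrict_iff' measurableSet_Ioc).2 (ae_of_all _ fun r hr => ?_)
    exact hz0 r ⟨hr.1.le, hr.2.trans ht.2⟩
  -- The integrating factor of the inequality. The definition of `HasWeakTimeDeriv` admits weights
  -- precisely so that it can be inserted directly.
  set θ : ℝ → ℝ := fun s => Real.exp (β * s - q * P s) with hθ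
  have hθc : ContinuousOn θ (Icc 0 T) :=
    ((continuousOn_const.mul continuousOn_id).sub (continuousOn_const.mul hPc)).rexp
  have hid := h θ (fun s => θ s * (β - q * z s)) hθc
    (hθc.mul (continuousOn_const.sub (continuousOn_const.mul hz)))
    (fun s hs => by
      have h1 := (((hasDerivAt_id s).const_mul β).sub ((hPd s hs).const_mul q)).exp
      simpa [hθ] using h1) t ht
  obtain ⟨hint, heq⟩ := hid
  have hIoc : Ioc 0 t ⊆ Ioc 0 T := Ioc_subset_Ioc_right ht.2
  have hsub : Icc 0 t ⊆ Icc 0 T := Icc_subset_Icc_right ht.2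
  -- As `0 ≤ q * P ≤ q * A`, the factor `θ` is `e^{βs}` up to the constant `e^{-qA}`; this is where
  -- `e^{qA}` in the conclusion comes from.
  have hθlow : ∀ s ∈ Icc 0 t, Real.exp (-(q * A)) * Real.exp (β * s) ≤ θ s := fun s hs => by
    rw [← Real.exp_add]
    refine Real.exp_le_exp.2 ?_
    have := mul_le_mul_of_nonneg_left (hPt s hs) hq
    linarith
  have hθup : ∀ s ∈ Icc 0 t, θ s ≤ Real.exp (β * s) := fun s hs => by
    refine Real.exp_le_exp.2 ?_
    have := mul_nonneg hq (hP0 s (hsub hs))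
    linarith
  have hexpc : Continuous fun s : ℝ => Real.exp (β * s) := by fun_prop
  have hYe : IntervalIntegrable (fun s => Real.exp (β * s) * Y s) volume 0 t := by
    refine IntervalIntegrable.continuousOn_mul ?_ hexpc.continuousOn
    exact (intervalIntegrable_iff_integrableOn_Ioc_of_le ht.1).2 (hY.mono_set hIoc)
  have hFe : IntervalIntegrable (fun s => Real.exp (β * s) * F s) volume 0 t := by
    refine IntervalIntegrable.continuousOn_mul ?_ hexpc.continuousOn
    exact (intervalIntegrable_iff_integrableOn_Ioc_of_le ht.1).2 (hF.mono_set hIoc)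
  have hmono : ∫ s in (0 : ℝ)..t, (θ s * (β - q * z s) * y s + θ s * g s)
      ≤ ∫ s in (0 : ℝ)..t, (Real.exp (β * s) * F s
        - Real.exp (-(q * A)) * (Real.exp (β * s) * Y s)) := by
    refine intervalIntegral.integral_mono_ae_restrict ht.1 hint (hFe.sub (hYe.const_mul _)) ?_
    have hae : ∀ᵐ s ∂(volume.restrict (Icc 0 t)),
        g s ≤ -(2 * Y s) + q * z s * y s + F s ∧ β * y s ≤ Y s := by
      rw [← Measure.restrict_congr_set Ioc_ae_eq_Icc]
      exact ae_restrict_of_ae_restrict_of_subset hIoc (hg.and hyY)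
    filter_upwards [hae, ae_restrict_mem measurableSet_Icc] with s hs hst
    have h1 := hθlow s hst
    have h2 := hθup s hst
    have h3 : 0 < θ s := Real.exp_pos _
    have hYs := hY0 s (hsub hst)
    have hFs := hF0 s (hsub hst)
    -- The derivative of `θ` cancels `q z y`. Of the two copies of `Y`, one pays for `β y` and the
    -- other is kept as dissipation.
    calc θ s * (β - q * z s) * y s + θ s * g s
        = θ s * (β * y s - q * z s * y s + g s) := by ring
      _ ≤ θ s * (F s - Y s) := by
          refine mul_le_mul_of_nonneg_left ?_ h3.le
          linarith [hs.1, hs.2]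
      _ = θ s * F s - θ s * Y s := by ring
      _ ≤ Real.exp (β * s) * F s - Real.exp (-(q * A)) * Real.exp (β * s) * Y s :=
          sub_le_sub (mul_le_mul_of_nonneg_right h2 hFs) (mul_le_mul_of_nonneg_right h1 hYs)
      _ = _ := by ring
  rw [intervalIntegral.integral_sub hFe (hYe.const_mul _), intervalIntegral.integral_const_mul]
    at hmono
  have hθ0 : θ 0 = 1 := by simp [hθ, hP]
  have htt := hθlow t ⟨ht.1, le_rfl⟩
  have hyt := mul_le_mul_of_nonneg_right htt (hy0 t ht)
  rw [hθ0, one_mul] at heq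
  set I := ∫ s in (0 : ℝ)..t, Real.exp (β * s) * Y s
  have hfin : Real.exp (-(q * A)) * (Real.exp (β * t) * y t + I) ≤ y 0 + B := by
    linarith
  have hpos := Real.exp_pos (q * A)
  calc Real.exp (β * t) * y t + I
      = Real.exp (q * A) * (Real.exp (-(q * A)) * (Real.exp (β * t) * y t + I)) := by
        rw [← mul_assoc, ← Real.exp_add]; simp
    _ ≤ _ := mul_le_mul_of_nonneg_left hfin hpos.le

/-! ### The system on a set of modes and its energy identities -/

/-- A solution, on `[0, T]`, of the equations projected to the modes in `S`. -/
structure IsModeSolution (ν κ Nsq T : ℝ) (S : Set Mode) (w b : ℝ → Mode → ℂ) : Prop where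
  zero_notMem : (0 : Mode) ∉ S
  supp_w : ∀ t ∈ Icc 0 T, ∀ k ∉ S, w t k = 0
  supp_b : ∀ t ∈ Icc 0 T, ∀ k ∉ S, b t k = 0
  herm_w : ∀ t ∈ Icc 0 T, Hermitian (w t)
  cont_w : ∀ k, ContinuousOn (fun t => w t k) (Icc 0 T)
  cont_b : ∀ k, ContinuousOn (fun t => b t k) (Icc 0 T)
  bdd_w : ∃ M, ∀ t ∈ Icc 0 T, FinEnergy 1 (w t) ∧ energy 1 (w t) ≤ M
  bdd_b : ∃ M, ∀ t ∈ Icc 0 T, FinEnergy 1 (b t) ∧ energy 1 (b t) ≤ M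
  sq_w : ∫⁻ t in Ioc 0 T, ∑' k, ENNReal.ofReal (eig k ^ 2 * ‖w t k‖ ^ 2) ≠ ⊤
  sq_b : ∫⁻ t in Ioc 0 T, ∑' k, ENNReal.ofReal (eig k ^ 2 * ‖b t k‖ ^ 2) ≠ ⊤
  deriv_w : ∀ t ∈ Ioo 0 T, ∀ k ∈ S, HasDerivAt (fun s => w s k) (rhsW ν (w t) (b t) k) t
  deriv_b : ∀ t ∈ Ioo 0 T, ∀ k ∈ S, HasDerivAt (fun s => b s k) (rhsB κ Nsq (w t) (b t) k) t

/-- Finiteness of the time integral of the energy of order two. -/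
lemma ae_finEnergy_two {T : ℝ} {u : ℝ → Mode → ℂ}
    (hc : ∀ k, ContinuousOn (fun t => u t k) (Icc 0 T))
    (h : ∫⁻ t in Ioc 0 T, ∑' k, ENNReal.ofReal (eig k ^ 2 * ‖u t k‖ ^ 2) ≠ ⊤) :
    (∀ᵐ t ∂(volume.restrict (Ioc 0 T)), FinEnergy 2 (u t)) ∧
      IntegrableOn (fun t => energy 2 (u t)) (Ioc 0 T) := by
  have hm : ∀ k, AEMeasurable (fun t => eig k ^ 2 * ‖u t k‖ ^ 2) (volume.restrict (Ioc 0 T)) :=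
    fun k => ((continuousOn_const.mul ((hc k).norm.pow 2)).mono Ioc_subset_Icc_self).aemeasurable
      measurableSet_Ioc
  have hae := ae_lt_top' (AEMeasurable.tsum fun k => (hm k).ennreal_ofReal) h
  have hfin : ∀ᵐ t ∂(volume.restrict (Ioc 0 T)), FinEnergy 2 (u t) := by
    filter_upwards [hae] with t ht
    have := ENNReal.summable_toReal ht.ne
    refine this.congr fun k => ?_
    rw [ENNReal.toReal_ofReal (by positivity)]
  refine ⟨hfin, (AEMeasurable.tsum hm).aestronglyMeasurable, ?_⟩
  rw [hasFiniteIntegral_iff_ofReal (ae_of_all _ fun t => energy_nonneg 2 (u t))]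
  refine lt_of_le_of_lt (lintegral_mono_ae ?_) h.lt_top
  filter_upwards [hfin] with t ht
  exact (ENNReal.ofReal_tsum_of_nonneg (fun k => by positivity) ht).le

namespace IsModeSolution

variable {ν κ Nsq T : ℝ} {S : Set Mode} {w b : ℝ → Mode → ℂ}

lemma w_zero (h : IsModeSolution ν κ Nsq T S w b) {t : ℝ} (ht : t ∈ Icc 0 T) : w t 0 = 0 :=
  h.supp_w t ht 0 h.zero_notMem

lemma b_zero (h : IsModeSolution ν κ Nsq T S w b) {t : ℝ} (ht : t ∈ Icc 0 T) : b t 0 = 0 :=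
  h.supp_b t ht 0 h.zero_notMem

lemma exists_bound (h : IsModeSolution ν κ Nsq T S w b) : ∃ M, 0 ≤ M ∧ ∀ t ∈ Icc 0 T,
    (FinEnergy 1 (w t) ∧ energy 1 (w t) ≤ M) ∧ (FinEnergy 1 (b t) ∧ energy 1 (b t) ≤ M) := by
  obtain ⟨M, hM⟩ := h.bdd_w
  obtain ⟨M', hM'⟩ := h.bdd_b
  exact ⟨max 0 (max M M'), le_max_left _ _, fun t ht =>
    ⟨⟨(hM t ht).1, (hM t ht).2.trans (by simp)⟩, ⟨(hM' t ht).1, (hM' t ht).2.trans (by simp)⟩⟩⟩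

lemma continuousOn_rhsW (h : IsModeSolution ν κ Nsq T S w b) (k : Mode) :
    ContinuousOn (fun t => rhsW ν (w t) (b t) k) (Icc 0 T) := by
  obtain ⟨M, -, hM⟩ := h.exists_bound
  exact ((continuousOn_adv (fun t ht => h.w_zero ht) (fun t ht => (hM t ht).1)
    (fun t ht => (hM t ht).1) h.cont_w h.cont_w k).neg.add
      (continuousOn_const.mul (h.cont_b k))).sub (continuousOn_const.mul (h.cont_w k))

lemma continuousOn_rhsB (h : IsModeSolution ν κ Nsq T S w b) (k : Mode) :
    ContinuousOn (fun t => rhsB κ Nsq (w t) (b t) k) (Icc 0 T) := by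
  obtain ⟨M, -, hM⟩ := h.exists_bound
  exact ((continuousOn_adv (fun t ht => h.w_zero ht) (fun t ht => (hM t ht).1)
    (fun t ht => (hM t ht).2) h.cont_w h.cont_b k).neg.sub
      (continuousOn_const.mul (continuousOn_const.mul ((h.cont_w k).neg.div_const _)))).sub
      (continuousOn_const.mul (h.cont_b k))

lemma ae_finEnergy (h : IsModeSolution ν κ Nsq T S w b) :
    ∀ᵐ t ∂(volume.restrict (Ioc 0 T)), t ∈ Icc 0 T ∧ FinEnergy 2 (w t) ∧ FinEnergy 2 (b t) := by
  filter_upwards [(ae_finEnergy_two h.cont_w h.sq_w).1, (ae_finEnergy_two h.cont_b h.sq_b).1,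
    ae_restrict_mem measurableSet_Ioc] with t h1 h2 h3
  exact ⟨Ioc_subset_Icc_self h3, h1, h2⟩

end IsModeSolution

/-- Curves of Fourier coefficients supported in `S` with a velocity in `L²(0, T; L²)` satisfy the
energy identity. -/
lemma hasWeakTimeDeriv_of_modes {T C₀ C₁ : ℝ} {S : Set Mode} {f r : ℝ → Mode → ℂ}
    (h0 : (0 : Mode) ∉ S) (hsupp : ∀ t ∈ Icc 0 T, ∀ k ∉ S, f t k = 0)
    (hfc : ∀ k, ContinuousOn (fun t => f t k) (Icc 0 T))
    (hrc : ∀ k, ContinuousOn (fun t => r t k) (Icc 0 T))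
    (hd : ∀ t ∈ Ioo 0 T, ∀ k ∈ S, HasDerivAt (fun s => f s k) (r t k) t)
    (hsq : ∫⁻ t in Ioc 0 T, ∑' k, ENNReal.ofReal (eig k ^ 2 * ‖f t k‖ ^ 2) ≠ ⊤)
    (hr : ∀ᵐ t ∂(volume.restrict (Ioc 0 T)),
      FinEnergy 0 (r t) ∧ energy 0 (r t) ≤ C₀ + C₁ * energy 2 (f t))
    {c : Mode → ℝ} (hc : ∀ k, 0 ≤ c k) (hce : ∀ k, k ≠ 0 → c k ≤ eig k)
    (hcs : ∀ t ∈ Icc 0 T, Summable fun k => c k * ‖f t k‖ ^ 2) :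
    HasWeakTimeDeriv T (fun t => ∑' k, c k * ‖f t k‖ ^ 2) (fun t => production c (f t) (r t)) := by
  classical
  intro θ θ' hθ hθ' hθd t ht
  -- Outside `S` the velocity is zero and not `r`. As `f` vanishes there, the production is
  -- unchanged, so projecting onto `S` preserves every energy identity.
  set f' : ℝ → Mode → ℂ := fun t k => if k ∈ S then r t k else 0 with hf'
  have hprod : ∀ s ∈ Icc 0 T, production c (f s) (f' s) = production c (f s) (r s) := by
    intro s hs
    refine tsum_congr fun k => ?_
    by_cases hk : k ∈ S
    · simp [hf', hk]
    · simp [hf', hk, hsupp s hs k hk]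
  have hle : ∀ s k, ‖f' s k‖ ^ 2 ≤ ‖r s k‖ ^ 2 := fun s k => by
    by_cases hk : k ∈ S
    · simp [hf', hk]
    · simp [hf', hk]
  have hcf' : ∀ k, ContinuousOn (fun t => f' t k) (Icc 0 T) := fun k => by
    by_cases hk : k ∈ S
    · simpa [hf', hk] using hrc k
    · simpa [hf', hk] using continuousOn_const
  obtain ⟨hfin, hint⟩ := ae_finEnergy_two hfc hsq
  have hsumm : ∀ᵐ t ∂(volume.restrict (Ioc 0 T)),
      Summable fun k => (eig k ^ 2 * ‖f t k‖ ^ 2 + ‖f' t k‖ ^ 2) := by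
    filter_upwards [hfin, hr] with s h1 h2
    exact Summable.add h1 (Summable.of_nonneg_of_le (fun _ => sq_nonneg _) (hle s) h2.1.norm_sq)
  have key := energy_identity (T := T) (f := f) (f' := f') (c := c) hfc hcf'
    (fun s hs k => by
      by_cases hk : k ∈ S
      · simpa [hf', hk] using hd s hs k hk
      · have : (fun s => f s k) =ᶠ[nhds s] fun _ => 0 := by
          filter_upwards [Ioo_mem_nhds hs.1 hs.2] with r hr
          exact hsupp r (Ioo_subset_Icc_self hr) k hk
        simpa [hf', hk] using (hasDerivAt_const s (0 : ℂ)).congr_of_eventuallyEq this)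
    (fun s hs => hsupp s hs 0 h0)
    (by
      refine Integrable.mono' ((integrable_const C₀).add (hint.const_mul (1 + C₁))) ?_ ?_
      · refine (AEMeasurable.tsum fun k => ?_).aestronglyMeasurable
        exact (((continuousOn_const.mul ((hfc k).norm.pow 2)).add ((hcf' k).norm.pow 2)).mono
          Ioc_subset_Icc_self).aemeasurable measurableSet_Ioc
      · filter_upwards [hfin, hr] with s h1 h2
        have hs2 : Summable fun k => ‖f' s k‖ ^ 2 :=
          Summable.of_nonneg_of_le (fun _ => sq_nonneg _) (hle s) h2.1.norm_sq
        have hle2 : ∑' k, ‖f' s k‖ ^ 2 ≤ energy 0 (r s) := by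
          simpa [energy] using hs2.tsum_le_tsum (hle s) h2.1.norm_sq
        rw [Real.norm_eq_abs, abs_of_nonneg (tsum_nonneg fun k => by positivity),
          Summable.tsum_add h1 hs2]
        have : ∑' k, eig k ^ 2 * ‖f s k‖ ^ 2 = energy 2 (f s) := rfl
        rw [this]
        simp only [Pi.add_apply]
        linarith [h2.2])
    hsumm hc hce hcs hθ hθ' hθd ht
  have hcongr : ∀ s ∈ Icc 0 t, θ' s * (∑' k, c k * ‖f s k‖ ^ 2) + θ s * production c (f s) (f' s)
      = θ' s * (∑' k, c k * ‖f s k‖ ^ 2) + θ s * production c (f s) (r s) := fun s hs => by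
    rw [hprod s ⟨hs.1, hs.2.trans ht.2⟩]
  refine ⟨key.1.congr fun s hs => ?_, key.2.trans ?_⟩
  · rw [uIoc_of_le ht.1] at hs
    exact hcongr s (Ioc_subset_Icc_self hs)
  · congr 1
    refine intervalIntegral.integral_congr fun s hs => ?_
    rw [uIcc_of_le ht.1] at hs
    exact hcongr s hs

end Thermohaline

end

/-! ### The chain of time estimates, from the basic energy to the gradients -/

noncomputable section

namespace Thermohaline

open scoped ComplexConjugate

namespace IsModeSolution

variable {ν κ Nsq T : ℝ} {S : Set Mode} {w b : ℝ → Mode → ℂ}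

/-- The weights needed are `eig⁻¹`, `1` and `eig`; all of them are at most `eig` on nonzero modes.
-/
lemma weakTimeDeriv_w (h : IsModeSolution ν κ Nsq T S w b)
    {c : Mode → ℝ} (hc : ∀ k, 0 ≤ c k) (hce : ∀ k, k ≠ 0 → c k ≤ eig k) :
    HasWeakTimeDeriv T (fun t => ∑' k, c k * ‖w t k‖ ^ 2)
      (fun t => production c (w t) (rhsW ν (w t) (b t))) := by
  obtain ⟨M, hM0, hM⟩ := h.exists_bound
  refine hasWeakTimeDeriv_of_modes (C₀ := 3 * (embConst * M * M) + 3 * M) (C₁ := 3 * ν ^ 2)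
    h.zero_notMem h.supp_w h.cont_w h.continuousOn_rhsW h.deriv_w h.sq_w ?_ hc hce ?_
  · filter_upwards [h.ae_finEnergy] with t ht
    obtain ⟨htI, h2, -⟩ := ht
    have hE := finEnergy_rhsW (ν := ν) (h.w_zero htI) h2 (hM t htI).2.1
    refine ⟨hE.1, hE.2.trans ?_⟩
    have h1 := (hM t htI).1.2
    have h3 := (hM t htI).2.2
    have h4 := energy_nonneg 1 (w t)
    have := embConst_nonneg
    gcongr
  · intro t ht
    refine Summable.of_nonneg_of_le (fun k => mul_nonneg (hc k) (sq_nonneg _)) (fun k => ?_)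
      (hM t ht).1.1
    by_cases hk : k = 0
    · simp [hk, h.w_zero ht]
    · rw [pow_one]; exact mul_le_mul_of_nonneg_right (hce k hk) (sq_nonneg _)

lemma weakTimeDeriv_b (h : IsModeSolution ν κ Nsq T S w b)
    {c : Mode → ℝ} (hc : ∀ k, 0 ≤ c k) (hce : ∀ k, k ≠ 0 → c k ≤ eig k) :
    HasWeakTimeDeriv T (fun t => ∑' k, c k * ‖b t k‖ ^ 2)
      (fun t => production c (b t) (rhsB κ Nsq (w t) (b t))) := by
  obtain ⟨M, hM0, hM⟩ := h.exists_bound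
  refine hasWeakTimeDeriv_of_modes (C₀ := 3 * (embConst * M * M) + 3 * Nsq ^ 2 * M)
    (C₁ := 3 * κ ^ 2)
    h.zero_notMem h.supp_b h.cont_b h.continuousOn_rhsB h.deriv_b h.sq_b ?_ hc hce ?_
  · filter_upwards [h.ae_finEnergy] with t ht
    obtain ⟨htI, -, h2⟩ := ht
    have hE := finEnergy_rhsB (κ := κ) (Nsq := Nsq) (h.w_zero htI) (h.b_zero htI)
      (hM t htI).1.1 h2
    refine ⟨hE.1, hE.2.trans ?_⟩
    have h1 := (hM t htI).1.2
    have h3 := (hM t htI).2.2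
    have h4 := energy_nonneg 1 (w t)
    have h5 := energy_nonneg 1 (b t)
    have := embConst_nonneg
    gcongr
  · intro t ht
    refine Summable.of_nonneg_of_le (fun k => mul_nonneg (hc k) (sq_nonneg _)) (fun k => ?_)
      (hM t ht).2.1
    by_cases hk : k = 0
    · simp [hk, h.b_zero ht]
    · rw [pow_one]; exact mul_le_mul_of_nonneg_right (hce k hk) (sq_nonneg _)

lemma weakTimeDeriv_energy_one_w (h : IsModeSolution ν κ Nsq T S w b) :
    HasWeakTimeDeriv T (fun t => energy 1 (w t))
      (fun t => production eig (w t) (rhsW ν (w t) (b t))) := by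
  simpa only [energy, pow_one] using h.weakTimeDeriv_w eig_nonneg fun k _ => le_rfl

lemma weakTimeDeriv_energy_one_b (h : IsModeSolution ν κ Nsq T S w b) :
    HasWeakTimeDeriv T (fun t => energy 1 (b t))
      (fun t => production eig (b t) (rhsB κ Nsq (w t) (b t))) := by
  simpa only [energy, pow_one] using h.weakTimeDeriv_b eig_nonneg fun k _ => le_rfl

lemma weakTimeDeriv_energy_zero_w (h : IsModeSolution ν κ Nsq T S w b) :
    HasWeakTimeDeriv T (fun t => energy 0 (w t))
      (fun t => production (fun _ => 1) (w t) (rhsW ν (w t) (b t))) := by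
  simpa only [energy, pow_zero] using
    h.weakTimeDeriv_w (c := fun _ => 1) (fun _ => zero_le_one) fun k hk => one_le_eig hk

lemma weakTimeDeriv_energy_zero_b (h : IsModeSolution ν κ Nsq T S w b) :
    HasWeakTimeDeriv T (fun t => energy 0 (b t))
      (fun t => production (fun _ => 1) (b t) (rhsB κ Nsq (w t) (b t))) := by
  simpa only [energy, pow_zero] using
    h.weakTimeDeriv_b (c := fun _ => 1) (fun _ => zero_le_one) fun k hk => one_le_eig hk

lemma weakTimeDeriv_energy_stream (h : IsModeSolution ν κ Nsq T S w b) :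
    HasWeakTimeDeriv T (fun t => energy 1 (stream (w t)))
      (fun t => production (fun k => (eig k)⁻¹) (w t) (rhsW ν (w t) (b t))) := by
  have e : ∀ t, energy 1 (stream (w t)) = ∑' k, (eig k)⁻¹ * ‖w t k‖ ^ 2 := fun t => by
    refine tsum_congr fun k => ?_
    by_cases hk : k = 0
    · simp [hk]
    · have := eig_pos hk
      rw [stream, norm_div, norm_neg, Complex.norm_real, Real.norm_eq_abs, abs_of_pos this]
      field_simp
  simp only [e]
  exact h.weakTimeDeriv_w (fun k => inv_nonneg.2 (eig_nonneg k)) fun k hk =>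
    (inv_le_one_of_one_le₀ (one_le_eig hk)).trans (one_le_eig hk)

/-- Decay of the basic energy. -/
lemma basic_bound (hν : 0 < ν) (hκ : 0 < κ) (hN : 0 < Nsq) (h : IsModeSolution ν κ Nsq T S w b)
    {R : ℝ} (hwR : energy 1 (w 0) ≤ R) (hbR : energy 1 (b 0) ≤ R) {t : ℝ} (ht : t ∈ Icc 0 T) :
    ∫ s in (0 : ℝ)..t, Real.exp (min ν κ / 2 * s) * energy 1 (b s) ≤ (Nsq + 1) * R / κ := by
  have hβ : 0 < min ν κ := lt_min hν hκ
  have h0 : (0 : ℝ) ∈ Icc 0 T := ⟨le_rfl, ht.1.trans ht.2⟩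
  obtain ⟨M, hM0, hM⟩ := h.exists_bound
  have hc0 := h.weakTimeDeriv_energy_zero_w.continuousOn
  have hc1 := h.weakTimeDeriv_energy_one_b.continuousOn
  -- There is no source and no growth coefficient. The rate `min ν κ / 2` is half of what this step
  -- allows; the later estimates, which spend half of the dissipation, need the smaller value.
  have hg := (h.weakTimeDeriv_energy_stream.add_const_mul h.weakTimeDeriv_energy_zero_b Nsq).gronwall
    (Y := fun s => ν * Nsq * energy 0 (w s) + κ * energy 1 (b s)) (z := fun _ => 0)
    (F := fun _ => 0) (β := min ν κ / 2) (q := 0) (A := 0) (B := 0) le_rfl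
    (by
      filter_upwards [h.ae_finEnergy] with s hs
      obtain ⟨hsI, hw2, hb2⟩ := hs
      rw [production_basic (h.w_zero hsI) (h.b_zero hsI) (h.herm_w s hsI) hw2 hb2]
      apply le_of_eq; ring)
    (by
      filter_upwards [h.ae_finEnergy] with s hs
      obtain ⟨hsI, hw2, hb2⟩ := hs
      have hw1 := (hM s hsI).1.1
      have e1 : energy 1 (stream (w s)) ≤ energy 0 (w s) := by
        rw [← energy_stream (h.w_zero hsI) 0]
        exact energy_mono (stream_zero _) (by norm_num)
          (finEnergy_stream_of_le (h.w_zero hsI) hw1 (by norm_num))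
      have e2 : energy 0 (b s) ≤ energy 1 (b s) :=
        energy_mono (h.b_zero hsI) (by norm_num) (hM s hsI).2.1
      have e3 := energy_nonneg 1 (stream (w s))
      have e4 := energy_nonneg 0 (b s)
      have m1 : min ν κ / 2 ≤ ν := by linarith [min_le_left ν κ]
      have m2 : min ν κ / 2 ≤ κ := by linarith [min_le_right ν κ]
      calc min ν κ / 2 * (Nsq * energy 1 (stream (w s)) + energy 0 (b s))
          = min ν κ / 2 * Nsq * energy 1 (stream (w s)) + min ν κ / 2 * energy 0 (b s) := by ring
        _ ≤ ν * Nsq * energy 0 (w s) + κ * energy 1 (b s) := by gcongr)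
    (((continuousOn_const.mul hc0).add (continuousOn_const.mul hc1)).integrableOn_Icc.mono_set
      Ioc_subset_Icc_self)
    integrableOn_zero continuousOn_const
    (fun s _ => add_nonneg (mul_nonneg hN.le (energy_nonneg _ _)) (energy_nonneg _ _))
    (fun s _ => add_nonneg (mul_nonneg (mul_nonneg hν.le hN.le) (energy_nonneg _ _))
      (mul_nonneg hκ.le (energy_nonneg _ _)))
    (fun _ _ => le_rfl) (fun _ _ => le_rfl) ht (by simp) (by simp)
  simp only [zero_mul, Real.exp_zero, one_mul, add_zero] at hg
  have hy0 : Nsq * energy 1 (stream (w 0)) + energy 0 (b 0) ≤ (Nsq + 1) * R := by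
    have e1 := energy_stream_le (h.w_zero h0) (hM 0 h0).1.1 (n := 1) (by norm_num)
    have e2 : energy 0 (b 0) ≤ energy 1 (b 0) :=
      energy_mono (h.b_zero h0) (by norm_num) (hM 0 h0).2.1
    have := mul_le_mul_of_nonneg_left (e1.trans hwR) hN.le
    linarith
  have hnn : 0 ≤ Real.exp (min ν κ / 2 * t) * (Nsq * energy 1 (stream (w t)) + energy 0 (b t)) :=
    mul_nonneg (Real.exp_pos _).le
      (add_nonneg (mul_nonneg hN.le (energy_nonneg _ _)) (energy_nonneg _ _))
  rw [le_div_iff₀ hκ, mul_comm, ← intervalIntegral.integral_const_mul]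
  refine le_trans ?_ ((by linarith : (∫ s in (0 : ℝ)..t, Real.exp (min ν κ / 2 * s) *
    (ν * Nsq * energy 0 (w s) + κ * energy 1 (b s)))
      ≤ Nsq * energy 1 (stream (w 0)) + energy 0 (b 0)).trans hy0)
  have hsub : Icc 0 t ⊆ Icc 0 T := Icc_subset_Icc_right ht.2
  have hexp : ContinuousOn (fun s : ℝ => Real.exp (min ν κ / 2 * s)) (Icc 0 t) := by fun_prop
  refine intervalIntegral.integral_mono_on ht.1 ?_ ?_ fun s hs => ?_
  · exact (continuousOn_const.mul (hexp.mul (hc1.mono hsub))).intervalIntegrable_of_Icc ht.1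
  · exact (hexp.mul ((continuousOn_const.mul (hc0.mono hsub)).add
      (continuousOn_const.mul (hc1.mono hsub)))).intervalIntegrable_of_Icc ht.1
  · have e1 := energy_nonneg 0 (w s)
    have e2 := Real.exp_pos (min ν κ / 2 * s)
    have : 0 ≤ Real.exp (min ν κ / 2 * s) * (ν * Nsq * energy 0 (w s)) := by positivity
    linarith

/-- Decay of the enstrophy. -/
lemma enstrophy_bound (hν : 0 < ν) (hκ : 0 < κ) (hN : 0 < Nsq)
    (h : IsModeSolution ν κ Nsq T S w b)
    {R : ℝ} (hwR : energy 1 (w 0) ≤ R) (hbR : energy 1 (b 0) ≤ R) {t : ℝ} (ht : t ∈ Icc 0 T) :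
    ∫ s in (0 : ℝ)..t, Real.exp (min ν κ / 2 * s) * energy 1 (w s)
      ≤ 2 / ν * (R + ν⁻¹ * ((Nsq + 1) * R / κ)) := by
  have h0 : (0 : ℝ) ∈ Icc 0 T := ⟨le_rfl, ht.1.trans ht.2⟩
  obtain ⟨M, hM0, hM⟩ := h.exists_bound
  have hc1 := h.weakTimeDeriv_energy_one_w.continuousOn
  have hcb := h.weakTimeDeriv_energy_zero_b.continuousOn
  have hcb1 := h.weakTimeDeriv_energy_one_b.continuousOn
  have hsub : Icc 0 t ⊆ Icc 0 T := Icc_subset_Icc_right ht.2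
  have hexp : ContinuousOn (fun s : ℝ => Real.exp (min ν κ / 2 * s)) (Icc 0 t) := by fun_prop
  -- The source is `ν⁻¹‖ρ‖²`, whose weighted integral is bounded by `basic_bound` through the
  -- Poincaré inequality.
  have hg := h.weakTimeDeriv_energy_zero_w.gronwall
    (Y := fun s => ν / 2 * energy 1 (w s)) (z := fun _ => 0)
    (F := fun s => ν⁻¹ * energy 0 (b s)) (β := min ν κ / 2) (q := 0) (A := 0)
    (B := ν⁻¹ * ((Nsq + 1) * R / κ)) le_rfl
    (by
      filter_upwards [h.ae_finEnergy] with s hs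
      obtain ⟨hsI, hw2, hb2⟩ := hs
      refine (production_enstrophy hν (h.w_zero hsI) (h.b_zero hsI) (h.herm_w s hsI)
        hw2 hb2).trans (le_of_eq ?_)
      ring)
    (by
      filter_upwards [h.ae_finEnergy] with s hs
      have e1 : energy 0 (w s) ≤ energy 1 (w s) :=
        energy_mono (h.w_zero hs.1) (by norm_num) (hM s hs.1).1.1
      have e3 := energy_nonneg 0 (w s)
      have m1 : min ν κ / 2 ≤ ν / 2 := by linarith [min_le_left ν κ]
      gcongr)
    ((continuousOn_const.mul hc1).integrableOn_Icc.mono_set Ioc_subset_Icc_self)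
    ((continuousOn_const.mul hcb).integrableOn_Icc.mono_set Ioc_subset_Icc_self)
    continuousOn_const (fun s _ => energy_nonneg _ _)
    (fun s _ => mul_nonneg (by positivity) (energy_nonneg _ _))
    (fun _ _ => le_rfl) (fun s _ => mul_nonneg (by positivity) (energy_nonneg _ _)) ht (by simp)
    (by
      have := h.basic_bound hν hκ hN hwR hbR ht
      refine le_trans ?_ (mul_le_mul_of_nonneg_left this (inv_nonneg.2 hν.le))
      rw [← intervalIntegral.integral_const_mul]
      refine intervalIntegral.integral_mono_on ht.1 ?_ ?_ fun s hs => ?_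
      · exact (hexp.mul (continuousOn_const.mul (hcb.mono hsub))).intervalIntegrable_of_Icc ht.1
      · exact (continuousOn_const.mul (hexp.mul (hcb1.mono hsub))).intervalIntegrable_of_Icc ht.1
      · have e2 : energy 0 (b s) ≤ energy 1 (b s) :=
          energy_mono (h.b_zero (hsub hs)) (by norm_num) (hM s (hsub hs)).2.1
        have e3 := energy_nonneg 0 (b s)
        rw [mul_left_comm]
        gcongr)
  simp only [zero_mul, Real.exp_zero, one_mul] at hg
  have hy0 : energy 0 (w 0) ≤ R :=
    (energy_mono (h.w_zero h0) (by norm_num) (hM 0 h0).1.1).trans hwR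
  have hnn : 0 ≤ Real.exp (min ν κ / 2 * t) * energy 0 (w t) :=
    mul_nonneg (Real.exp_pos _).le (energy_nonneg _ _)
  have hcomm : ∫ s in (0 : ℝ)..t, Real.exp (min ν κ / 2 * s) * (ν / 2 * energy 1 (w s))
      = ν / 2 * ∫ s in (0 : ℝ)..t, Real.exp (min ν κ / 2 * s) * energy 1 (w s) := by
    rw [← intervalIntegral.integral_const_mul]
    congr 1; ext s; ring
  rw [hcomm] at hg
  have hfin := le_trans (by linarith) (add_le_add_left hy0 (ν⁻¹ * ((Nsq + 1) * R / κ)))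
    (a := ν / 2 * ∫ s in (0 : ℝ)..t, Real.exp (min ν κ / 2 * s) * energy 1 (w s))
  calc _ = 2 / ν * (ν / 2 * ∫ s in (0 : ℝ)..t, Real.exp (min ν κ / 2 * s) * energy 1 (w s)) := by
        field_simp
    _ ≤ _ := mul_le_mul_of_nonneg_left hfin (by positivity)

end IsModeSolution

/-- The last step of the a priori estimates, common to both unknowns. -/
lemma gradient_bound {T κ β Z q A B y₀ : ℝ} {u : ℝ → Mode → ℂ} {g z F : ℝ → ℝ}
    (hβκ : β ≤ κ / 2) (hβ : 0 ≤ β) (hκ : 0 < κ) (hq : 0 ≤ q)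
    (h : HasWeakTimeDeriv T (fun t => energy 1 (u t)) g)
    (hg : ∀ᵐ s ∂(volume.restrict (Ioc 0 T)), FinEnergy 2 (u s) ∧ u s 0 = 0 ∧
      g s ≤ -(κ * energy 2 (u s)) + q * z s * energy 1 (u s) + F s)
    (hY : IntegrableOn (fun s => energy 2 (u s)) (Ioc 0 T))
    (hF : ContinuousOn F (Icc 0 T)) (hz : ContinuousOn z (Icc 0 T))
    (hz0 : ∀ s ∈ Icc 0 T, 0 ≤ z s) (hF0 : ∀ s ∈ Icc 0 T, 0 ≤ F s) {t : ℝ} (ht : t ∈ Icc 0 T)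
    (hA : ∫ s in (0 : ℝ)..t, Real.exp (β * s) * z s ≤ A)
    (hB : ∫ s in (0 : ℝ)..t, Real.exp (β * s) * F s ≤ B) (hy₀ : energy 1 (u 0) ≤ y₀)
    (hZ : max 1 (2 / κ) * (Real.exp (q * A) * (y₀ + B)) ≤ Z) :
    energy 1 (u t) ≤ Z * Real.exp (-β * t) ∧ ∫ s in (0 : ℝ)..t, energy 2 (u s) ≤ Z := by
  have hsub : Icc 0 t ⊆ Icc 0 T := Icc_subset_Icc_right ht.2
  have hIoc : Ioc 0 t ⊆ Ioc 0 T := Ioc_subset_Ioc_right ht.2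
  have hexp : ContinuousOn (fun s : ℝ => Real.exp (β * s)) (Icc 0 t) := by fun_prop
  have hexp1 : ∀ s ∈ Icc 0 t, 1 ≤ Real.exp (β * s) := fun s hs =>
    Real.one_le_exp (mul_nonneg hβ hs.1)
  have hg' := h.gronwall (Y := fun s => κ / 2 * energy 2 (u s)) (z := z) (F := F) (β := β) (q := q)
    (A := A) (B := B) hq
    (by
      filter_upwards [hg] with s hs
      refine hs.2.2.trans (le_of_eq ?_); ring)
    (by
      filter_upwards [hg] with s hs
      have e1 : energy 1 (u s) ≤ energy 2 (u s) := energy_mono hs.2.1 (by norm_num) hs.1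
      have e3 := energy_nonneg 1 (u s)
      gcongr)
    (hY.const_mul _) (hF.integrableOn_Icc.mono_set Ioc_subset_Icc_self) hz
    (fun s _ => energy_nonneg _ _) (fun s _ => mul_nonneg (by positivity) (energy_nonneg _ _))
    hz0 hF0 ht
    (by
      refine le_trans ?_ hA
      refine intervalIntegral.integral_mono_on ht.1 ((hz.mono hsub).intervalIntegrable_of_Icc ht.1)
        ((hexp.mul (hz.mono hsub)).intervalIntegrable_of_Icc ht.1) fun s hs => ?_
      exact le_mul_of_one_le_left (hz0 s (hsub hs)) (hexp1 s hs)) hB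
  have hY' : IntervalIntegrable (fun s => energy 2 (u s)) volume 0 t :=
    (intervalIntegrable_iff_integrableOn_Ioc_of_le ht.1).2 (hY.mono_set hIoc)
  have hB0 : 0 ≤ B := le_trans (intervalIntegral.integral_nonneg ht.1 fun s hs =>
    mul_nonneg (Real.exp_pos _).le (hF0 s (hsub hs))) hB
  set C := Real.exp (q * A) * (y₀ + B) with hC
  have hC0 : 0 ≤ C := mul_nonneg (Real.exp_pos _).le
    (add_nonneg ((energy_nonneg 1 (u 0)).trans hy₀) hB0)
  have hCle : Real.exp (q * A) * (energy 1 (u 0) + B) ≤ C := by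
    rw [hC]; gcongr
  have hI : κ / 2 * ∫ s in (0 : ℝ)..t, energy 2 (u s)
      ≤ ∫ s in (0 : ℝ)..t, Real.exp (β * s) * (κ / 2 * energy 2 (u s)) := by
    rw [← intervalIntegral.integral_const_mul]
    refine intervalIntegral.integral_mono_on ht.1 (hY'.const_mul _)
      ((hY'.const_mul _).continuousOn_mul (by rwa [uIcc_of_le ht.1])) fun s hs => ?_
    exact le_mul_of_one_le_left (mul_nonneg (by positivity) (energy_nonneg _ _)) (hexp1 s hs)
  have hI0 : 0 ≤ ∫ s in (0 : ℝ)..t, energy 2 (u s) :=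
    intervalIntegral.integral_nonneg ht.1 fun s _ => energy_nonneg _ _
  have hE0 : 0 ≤ Real.exp (β * t) * energy 1 (u t) :=
    mul_nonneg (Real.exp_pos _).le (energy_nonneg _ _)
  have hκI : 0 ≤ κ / 2 * ∫ s in (0 : ℝ)..t, energy 2 (u s) := by positivity
  -- In `hZ`, the entry `1` of the maximum serves the pointwise bound and the entry `2 / κ` the
  -- bound of the integrated dissipation.
  have hCZ : C ≤ Z := le_trans (le_mul_of_one_le_left hC0 (le_max_left _ _)) hZ
  constructor
  · have h1 : Real.exp (β * t) * energy 1 (u t) ≤ Z := by linarith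
    calc energy 1 (u t) = Real.exp (β * t) * energy 1 (u t) * Real.exp (-β * t) := by
          rw [mul_right_comm, ← Real.exp_add]; simp
      _ ≤ Z * Real.exp (-β * t) := mul_le_mul_of_nonneg_right h1 (Real.exp_pos _).le
  · have h1 : κ / 2 * ∫ s in (0 : ℝ)..t, energy 2 (u s) ≤ C := by linarith
    calc ∫ s in (0 : ℝ)..t, energy 2 (u s)
        = 2 / κ * (κ / 2 * ∫ s in (0 : ℝ)..t, energy 2 (u s)) := by field_simp
      _ ≤ 2 / κ * C := mul_le_mul_of_nonneg_left h1 (by positivity)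
      _ ≤ Z := le_trans (mul_le_mul_of_nonneg_right (le_max_right _ _) hC0) hZ

/-- The a priori estimate: exponential decay of `‖∇ω‖²` and `‖∇ρ‖²`, with constants depending on
the size of the initial values only. -/
theorem exists_apriori_bound {ν κ Nsq : ℝ} (hν : 0 < ν) (hκ : 0 < κ) (hN : 0 < Nsq) (R : ℝ) :
    ∃ Z β : ℝ, 0 < β ∧ ∀ (T : ℝ) (S : Set Mode) (w b : ℝ → Mode → ℂ),
      IsModeSolution ν κ Nsq T S w b → energy 1 (w 0) ≤ R → energy 1 (b 0) ≤ R →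
      ∀ t ∈ Icc 0 T,
        energy 1 (w t) ≤ Z * Real.exp (-β * t) ∧ energy 1 (b t) ≤ Z * Real.exp (-β * t) ∧
        ∫ s in (0 : ℝ)..t, energy 2 (w s) ≤ Z ∧ ∫ s in (0 : ℝ)..t, energy 2 (b s) ≤ Z := by
  -- `A₁` and `A₂` are the bounds of the weighted integrals of `energy 1 b` and `energy 1 w` from
  -- `basic_bound` and `enstrophy_bound`.
  set A₁ := (Nsq + 1) * R / κ with hA₁
  set A₂ := 2 / ν * (R + ν⁻¹ * A₁) with hA₂
  set Zw := max 1 (2 / ν) * (Real.exp (2 / ν * embConst * A₂) * (R + 2 / ν * A₁)) with hZw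
  set Zb := max 1 (2 / κ) * (Real.exp (2 / κ * embConst * A₂) * (R + 2 / κ * (Nsq ^ 2 * A₂)))
    with hZb
  have hβ : 0 < min ν κ := lt_min hν hκ
  refine ⟨max Zw Zb, min ν κ / 2, by positivity, fun T S w b h hwR hbR t ht => ?_⟩
  have hcw := h.weakTimeDeriv_energy_one_w.continuousOn
  have hcb := h.weakTimeDeriv_energy_one_b.continuousOn
  have hbb := h.basic_bound hν hκ hN hwR hbR ht
  have hen := h.enstrophy_bound hν hκ hN hwR hbR ht
  have hE := embConst_nonneg
  -- The coefficient `z` is here the unknown itself. The quadratic inequality is nevertheless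
  -- harmless, because `A₂` already bounds the integral of `z`.
  have r1 := gradient_bound (κ := ν) (β := min ν κ / 2) (q := 2 / ν * embConst) (A := A₂)
    (B := 2 / ν * A₁) (y₀ := R) (Z := max Zw Zb) (z := fun s => energy 1 (w s))
    (F := fun s => 2 / ν * energy 1 (b s)) (by linarith [min_le_left ν κ]) (by positivity) hν
    (by positivity) h.weakTimeDeriv_energy_one_w
    (by
      filter_upwards [h.ae_finEnergy] with s hs
      refine ⟨hs.2.1, h.w_zero hs.1, ?_⟩
      refine (production_grad_w hν (h.w_zero hs.1) (h.b_zero hs.1) hs.2.1 hs.2.2).trans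
        (le_of_eq ?_)
      ring)
    (ae_finEnergy_two h.cont_w h.sq_w).2 (continuousOn_const.mul hcb) hcw
    (fun s _ => energy_nonneg _ _) (fun s _ => mul_nonneg (by positivity) (energy_nonneg _ _))
    ht hen
    (by
      refine le_trans (le_of_eq ?_) (mul_le_mul_of_nonneg_left hbb (show 0 ≤ 2 / ν by positivity))
      rw [← intervalIntegral.integral_const_mul]
      congr 1; ext s; ring)
    hwR (le_max_left _ _)
  have r2 := gradient_bound (κ := κ) (β := min ν κ / 2) (q := 2 / κ * embConst) (A := A₂)
    (B := 2 / κ * (Nsq ^ 2 * A₂)) (y₀ := R) (Z := max Zw Zb) (z := fun s => energy 1 (w s))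
    (F := fun s => 2 / κ * (Nsq ^ 2 * energy 1 (w s))) (by linarith [min_le_right ν κ])
    (by positivity) hκ (by positivity) h.weakTimeDeriv_energy_one_b
    (by
      filter_upwards [h.ae_finEnergy] with s hs
      refine ⟨hs.2.2, h.b_zero hs.1, ?_⟩
      refine (production_grad_b hκ (h.w_zero hs.1) (h.b_zero hs.1) hs.2.1 hs.2.2).trans
        (le_of_eq ?_)
      ring)
    (ae_finEnergy_two h.cont_b h.sq_b).2
    (continuousOn_const.mul (continuousOn_const.mul hcw)) hcw
    (fun s _ => energy_nonneg _ _)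
    (fun s _ => mul_nonneg (by positivity) (mul_nonneg (by positivity) (energy_nonneg _ _)))
    ht hen
    (by
      refine le_trans (le_of_eq ?_) (mul_le_mul_of_nonneg_left (mul_le_mul_of_nonneg_left hen
        (show 0 ≤ Nsq ^ 2 by positivity)) (show 0 ≤ 2 / κ by positivity))
      rw [← intervalIntegral.integral_const_mul, ← intervalIntegral.integral_const_mul]
      congr 1; ext s; ring)
    hbR (le_max_right _ _)
  exact ⟨r1.1, r2.1, r1.2, r2.2⟩

end Thermohaline

end

noncomputable section

namespace Thermohaline

open scoped ComplexConjugate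

/-! ### Galerkin approximations -/

lemma Hermitian.adv {u v : Mode → ℂ} (hu : Hermitian u) (hv : Hermitian v) :
    Hermitian (adv u v) := fun k => by
  simp only [Thermohaline.adv, map_neg]
  rw [Complex.conj_tsum, ← (Equiv.neg Mode).tsum_eq]
  congr 1
  refine tsum_congr fun l => ?_
  have h1 : cross (-l) (-k) = cross l k := by simp [cross]
  have h2 : -k - -l = -(k - l) := by abel
  simp only [Equiv.neg_apply, h1, h2, hu l, hv (k - l), map_mul, Complex.conj_ofReal]

lemma conj_dx (k : Mode) : conj (dx k) = dx (-k) := by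
  have h2 : conj (2 : ℂ) = 2 := map_ofNat _ 2
  simp [dx, h2]

lemma Hermitian.rhsW {w b : Mode → ℂ} (ν : ℝ) (hw : Hermitian w) (hb : Hermitian b) :
    Hermitian (rhsW ν w b) := fun k => by
  simp only [Thermohaline.rhsW, map_add, map_sub, map_neg, map_mul, Complex.conj_ofReal, conj_dx,
    hw k, hb k, hw.adv hw.stream k, eig_neg]

lemma Hermitian.rhsB {w b : Mode → ℂ} (κ Nsq : ℝ) (hw : Hermitian w) (hb : Hermitian b) :
    Hermitian (rhsB κ Nsq w b) := fun k => by
  simp only [Thermohaline.rhsB, map_sub, map_neg, map_mul, Complex.conj_ofReal, conj_dx,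
    hw.stream k, hb k, hb.adv hw.stream k, eig_neg]

/-! ### The finite-dimensional phase space and its real subspace -/

section FiniteSupport

variable {S : Finset Mode}

lemma finEnergy_of_supp {u : Mode → ℂ} (hu : ∀ k ∉ S, u k = 0) (n : ℕ) : FinEnergy n u :=
  (hasSum_sum_of_ne_finset_zero (s := S) fun k hk => by simp [hu k hk]).summable

lemma energy_eq_sum {u : Mode → ℂ} (hu : ∀ k ∉ S, u k = 0) (n : ℕ) :
    energy n u = ∑ k ∈ S, eig k ^ n * ‖u k‖ ^ 2 :=
  tsum_eq_sum fun k hk => by simp [hu k hk]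

lemma production_eq_sum {u r : Mode → ℂ} (hu : ∀ k ∉ S, u k = 0) (c : Mode → ℝ) :
    production c u r = ∑ k ∈ S, 2 * c k * (conj (u k) * r k).re :=
  tsum_eq_sum fun k hk => by simp [hu k hk]

lemma adv_eq_sum {u : Mode → ℂ} (hu : ∀ k ∉ S, u k = 0) (v : Mode → ℂ) (k : Mode) :
    adv u v k = -∑ l ∈ S, (cross l k : ℂ) * u l * v (k - l) := by
  rw [adv, tsum_eq_sum fun l hl => by simp [hu l hl]]

open Classical in
/-- Extension of coefficients by zero. -/
def extend (S : Finset Mode) (x : S → ℂ) (k : Mode) : ℂ := if h : k ∈ S then x ⟨k, h⟩ else 0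

lemma extend_of_notMem (x : S → ℂ) : ∀ k ∉ S, extend S x k = 0 := fun k hk => by
  simp [extend, hk]

lemma extend_coe (x : S → ℂ) (k : S) : extend S x k = x k := by simp [extend]

lemma extend_restrict {u : Mode → ℂ} (hu : ∀ k ∉ S, u k = 0) :
    extend S (fun k => u k) = u := by
  ext k
  by_cases hk : k ∈ S
  · simp [extend, hk]
  · simp [extend, hk, hu k hk]

/-- The phase space of the Galerkin approximation. -/
abbrev Phase (S : Finset Mode) : Type := (S → ℂ) × (S → ℂ)

lemma contDiff_extend_fst (k : Mode) : ContDiff ℝ 1 fun x : Phase S => extend S x.1 k := by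
  by_cases hk : k ∈ S
  · simp only [extend, hk, dif_pos]; fun_prop
  · simp only [extend, hk, dif_neg, not_false_eq_true]; fun_prop

lemma contDiff_extend_snd (k : Mode) : ContDiff ℝ 1 fun x : Phase S => extend S x.2 k := by
  by_cases hk : k ∈ S
  · simp only [extend, hk, dif_pos]; fun_prop
  · simp only [extend, hk, dif_neg, not_false_eq_true]; fun_prop

/-- The Galerkin vector field. -/
def galerkinField (ν κ Nsq : ℝ) (S : Finset Mode) (x : Phase S) : Phase S :=
  (fun k => rhsW ν (extend S x.1) (extend S x.2) k,
    fun k => rhsB κ Nsq (extend S x.1) (extend S x.2) k)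

lemma contDiff_stream_extend (k : Mode) :
    ContDiff ℝ 1 fun x : Phase S => stream (extend S x.1) k := by
  simp only [stream, div_eq_mul_inv]
  exact (contDiff_extend_fst k).neg.mul contDiff_const

lemma contDiff_galerkinField (ν κ Nsq : ℝ) : ContDiff ℝ 1 (galerkinField ν κ Nsq S) := by
  refine ContDiff.prodMk (contDiff_pi.2 fun k => ?_) (contDiff_pi.2 fun k => ?_)
  · simp only [rhsW, adv_eq_sum (extend_of_notMem _)]
    refine ContDiff.sub (ContDiff.add (ContDiff.neg (ContDiff.neg (ContDiff.sum fun l _ => ?_)))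
      (contDiff_const.mul (contDiff_extend_snd _))) (contDiff_const.mul (contDiff_extend_fst _))
    exact (contDiff_const.mul (contDiff_extend_fst l)).mul (contDiff_stream_extend _)
  · simp only [rhsB, adv_eq_sum (extend_of_notMem _)]
    refine ContDiff.sub (ContDiff.sub (ContDiff.neg (ContDiff.neg (ContDiff.sum fun l _ => ?_)))
      (contDiff_const.mul (contDiff_const.mul (contDiff_stream_extend _))))
      (contDiff_const.mul (contDiff_extend_snd _))
    exact (contDiff_const.mul (contDiff_extend_snd l)).mul (contDiff_stream_extend _)

/-- Projection of coefficients onto those of real functions. -/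
def symmetrize (S : Finset Mode) : (S → ℂ) →ₗ[ℝ] (S → ℂ) where
  toFun x k := (1 / 2 : ℝ) • (x k + conj (extend S x (-k)))
  map_add' x y := by
    ext k
    by_cases hk : -(k : Mode) ∈ S
    · simp [extend, hk]; ring
    · simp [extend, hk]
  map_smul' c x := by
    ext k
    by_cases hk : -(k : Mode) ∈ S
    · simp [extend, hk]; ring
    · simp [extend, hk]; ring

lemma hermitian_symmetrize (hS : ∀ k ∈ S, -k ∈ S) (x : S → ℂ) :
    Hermitian (extend S (symmetrize S x)) := fun k => by
  by_cases hk : k ∈ S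
  · have hk' := hS k hk
    simp only [extend, hk, hk', dif_pos, symmetrize, LinearMap.coe_mk, AddHom.coe_mk, neg_neg]
    rw [Complex.real_smul, Complex.real_smul, map_mul, Complex.conj_ofReal, map_add,
      Complex.conj_conj, add_comm]
  · have hk' : -k ∉ S := fun h => hk (by simpa using hS _ h)
    simp [extend, hk, hk']

/-- The real-linear projection of the phase space onto pairs of real functions. -/
def symmetrizePhase (S : Finset Mode) : Phase S →L[ℝ] Phase S :=
  LinearMap.toContinuousLinearMap ((symmetrize S).prodMap (symmetrize S))

lemma symmetrizePhase_apply (x : Phase S) :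
    symmetrizePhase S x = (symmetrize S x.1, symmetrize S x.2) := rfl

lemma symmetrize_restrict (hS : ∀ k ∈ S, -k ∈ S) {r : Mode → ℂ} (hr : Hermitian r) :
    symmetrize S (fun k => r k) = fun k : S => r k := by
  ext k
  have hk : -(k : Mode) ∈ S := hS k k.2
  simp only [symmetrize, LinearMap.coe_mk, AddHom.coe_mk, extend, hk, dif_pos, hr (k : Mode),
    Complex.conj_conj]
  rw [← two_smul ℝ (r k), smul_smul]; norm_num

/-- The field maps coefficients of real functions to such coefficients. This keeps the Galerkin
curve Hermitian without an appeal to uniqueness for the differential equation. -/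
lemma symmetrize_galerkinField (hS : ∀ k ∈ S, -k ∈ S) {ν κ Nsq : ℝ} {x : Phase S}
    (h1 : Hermitian (extend S x.1)) (h2 : Hermitian (extend S x.2)) :
    symmetrizePhase S (galerkinField ν κ Nsq S x) = galerkinField ν κ Nsq S x :=
  Prod.ext (symmetrize_restrict hS (h1.rhsW ν h2)) (symmetrize_restrict hS (h1.rhsB κ Nsq h2))

end FiniteSupport

/-- Global solvability of autonomous equations with bounded Lipschitz vector fields. -/
lemma exists_solution_of_lipschitz_bounded {X : Type*} [NormedAddCommGroup X] [NormedSpace ℝ X]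
    [CompleteSpace X] {g : X → X} {K : NNReal} (hg : LipschitzWith K g) {C : ℝ}
    (hC : ∀ x, ‖g x‖ ≤ C) (x₀ : X) {T : ℝ} (hT : 0 ≤ T) :
    ∃ α : ℝ → X, α 0 = x₀ ∧ ∀ t ∈ Icc 0 T, HasDerivWithinAt α (g (α t)) (Icc 0 T) t := by
  have hC0 : 0 ≤ C := (norm_nonneg _).trans (hC x₀)
  -- At speed at most `C` a curve stays within radius `C * T` during `[0, T]`, so a single
  -- application of Picard–Lindelöf covers the whole interval.
  have hPL : IsPicardLindelof (fun _ => g) (tmin := 0) (tmax := T) ⟨0, le_rfl, hT⟩ x₀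
      (⟨C * T, by positivity⟩) 0 ⟨C, hC0⟩ K :=
    { lipschitzOnWith := fun _ _ => hg.lipschitzOnWith
      continuousOn := fun _ _ => continuousOn_const
      norm_le := fun _ _ x _ => hC x
      mul_max_le := by
        simp only [sub_zero, sub_self, max_eq_left hT, NNReal.coe_zero]
        exact le_rfl }
  exact hPL.exists_eq_forall_mem_Icc_hasDerivWithinAt₀

/-- Solvability of the Galerkin system, from the dissipation of the basic energy. -/
theorem exists_galerkin {ν κ Nsq : ℝ} (hν : 0 < ν) (hκ : 0 < κ) (hN : 0 < Nsq)
    {S : Finset Mode} (h0 : (0 : Mode) ∉ S) (hS : ∀ k ∈ S, -k ∈ S) {w₀ b₀ : Mode → ℂ}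
    (hw₀ : Hermitian w₀) (hb₀ : Hermitian b₀) (hws : ∀ k ∉ S, w₀ k = 0)
    (hbs : ∀ k ∉ S, b₀ k = 0) {T : ℝ} (hT : 0 ≤ T) :
    ∃ w b : ℝ → Mode → ℂ, IsModeSolution ν κ Nsq T S w b ∧ w 0 = w₀ ∧ b 0 = b₀ ∧
      ∀ t ∈ Icc 0 T, Hermitian (b t) := by
  set e₀ := Nsq * energy 1 (stream w₀) + energy 0 b₀ with he₀
  have he₀0 : 0 ≤ e₀ := add_nonneg (mul_nonneg hN.le (energy_nonneg _ _)) (energy_nonneg _ _)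
  -- If the basic energy is at most `e₀`, then `‖w k‖² ≤ e₀ / Nsq * eig k` and `‖b k‖² ≤ e₀`; both
  -- are below the square of this radius, and the `1` makes it positive.
  set r := Real.sqrt (e₀ / Nsq * (∑ k ∈ S, eig k) + e₀) + 1 with hr
  have hr0 : 0 < r := by positivity
  -- The cutoff makes the quadratic field bounded and globally Lipschitz; `hχ` shows afterwards that
  -- it equals `1` along the curve.
  let χ : ContDiffBump (0 : Phase S) := ⟨r, r + 1, hr0, by linarith⟩
  set V := galerkinField ν κ Nsq S with hV
  set H : Phase S → Phase S := fun x => χ x • V x with hH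
  have hHc : ContDiff ℝ 1 H := χ.contDiff.smul (contDiff_galerkinField ν κ Nsq)
  have hHs : HasCompactSupport H := χ.hasCompactSupport.smul_right
  obtain ⟨K, hK⟩ := hHc.lipschitzWith_of_hasCompactSupport hHs (by norm_num)
  obtain ⟨C, hC⟩ := hHs.exists_bound_of_continuous hHc.continuous
  set P := symmetrizePhase S with hP
  obtain ⟨α, hα0, hα⟩ := exists_solution_of_lipschitz_bounded (g := fun x => H (P x))
    (hK.comp P.lipschitz) (fun x => hC (P x)) ((fun k => w₀ k, fun k => b₀ k) : Phase S) hT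
  set y : ℝ → Phase S := fun t => P (α t) with hy
  set w : ℝ → Mode → ℂ := fun t => extend S (y t).1 with hw
  set b : ℝ → Mode → ℂ := fun t => extend S (y t).2 with hb
  have hwh : ∀ t, Hermitian (w t) := fun t => hermitian_symmetrize hS _
  have hbh : ∀ t, Hermitian (b t) := fun t => hermitian_symmetrize hS _
  have hwsupp : ∀ t, ∀ k ∉ S, w t k = 0 := fun t => extend_of_notMem _
  have hbsupp : ∀ t, ∀ k ∉ S, b t k = 0 := fun t => extend_of_notMem _
  -- `α` solves `α' = H (P α)`. Applying the linear `P` gives `y' = P (H y) = H y`, since `y` is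
  -- Hermitian and the field preserves that.
  have hyd : ∀ t ∈ Icc 0 T, HasDerivWithinAt y (χ (y t) • V (y t)) (Icc 0 T) t := fun t ht => by
    have h1 := P.hasFDerivAt.comp_hasDerivWithinAt t (hα t ht)
    have h2 : P (H (P (α t))) = χ (y t) • V (y t) := by
      simp only [hH, map_smul]
      rw [hP, symmetrize_galerkinField hS (hwh t) (hbh t)]
    rw [← h2]; exact h1
  have hy0 : y 0 = ((fun k => w₀ k, fun k => b₀ k) : Phase S) := by
    simp only [hy, hα0, hP, symmetrizePhase_apply]
    exact Prod.ext (symmetrize_restrict hS hw₀) (symmetrize_restrict hS hb₀)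
  have hw0 : w 0 = w₀ := by simp only [hw, hy0]; exact extend_restrict hws
  have hb0 : b 0 = b₀ := by simp only [hb, hy0]; exact extend_restrict hbs
  have hyc : ContinuousOn y (Icc 0 T) := fun t ht => (hyd t ht).continuousWithinAt
  have hwc : ∀ k, ContinuousOn (fun t => w t k) (Icc 0 T) := fun k =>
    (contDiff_extend_fst k).continuous.comp_continuousOn hyc
  have hbc : ∀ k, ContinuousOn (fun t => b t k) (Icc 0 T) := fun k =>
    (contDiff_extend_snd k).continuous.comp_continuousOn hyc
  have hwd : ∀ t ∈ Ioo 0 T, ∀ k ∈ S,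
      HasDerivAt (fun s => w s k) ((χ (y t) : ℂ) * rhsW ν (w t) (b t) k) t := fun t ht k hk => by
    have h1 := (hyd t (Ioo_subset_Icc_self ht)).hasDerivAt (Icc_mem_nhds ht.1 ht.2)
    have h2 := ((ContinuousLinearMap.proj (R := ℝ) (φ := fun _ : S => ℂ) ⟨k, hk⟩).comp
      (ContinuousLinearMap.fst ℝ (S → ℂ) (S → ℂ))).hasFDerivAt.comp_hasDerivAt t h1
    have e : (fun s => w s k) = fun s => (y s).1 ⟨k, hk⟩ := by
      ext s; simp [hw, extend, hk]
    rw [e, ← Complex.real_smul]; exact h2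
  have hbd : ∀ t ∈ Ioo 0 T, ∀ k ∈ S,
      HasDerivAt (fun s => b s k) ((χ (y t) : ℂ) * rhsB κ Nsq (w t) (b t) k) t :=
        fun t ht k hk => by
    have h1 := (hyd t (Ioo_subset_Icc_self ht)).hasDerivAt (Icc_mem_nhds ht.1 ht.2)
    have h2 := ((ContinuousLinearMap.proj (R := ℝ) (φ := fun _ : S => ℂ) ⟨k, hk⟩).comp
      (ContinuousLinearMap.snd ℝ (S → ℂ) (S → ℂ))).hasFDerivAt.comp_hasDerivAt t h1
    have e : (fun s => b s k) = fun s => (y s).2 ⟨k, hk⟩ := by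
      ext s; simp [hb, extend, hk]
    rw [e, ← Complex.real_smul]; exact h2
  have hw00 : ∀ t, w t 0 = 0 := fun t => hwsupp t 0 h0
  have hb00 : ∀ t, b t 0 = 0 := fun t => hbsupp t 0 h0
  set E : ℝ → ℝ := fun t => Nsq * (∑ k ∈ S, (eig k)⁻¹ * ‖w t k‖ ^ 2) + ∑ k ∈ S, 1 * ‖b t k‖ ^ 2
    with hE
  have hEc : ContinuousOn E (Icc 0 T) :=
    (continuousOn_const.mul (continuousOn_finsetSum _ fun k _ =>
      continuousOn_const.mul ((hwc k).norm.pow 2))).add (continuousOn_finsetSum _ fun k _ =>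
      continuousOn_const.mul ((hbc k).norm.pow 2))
  -- The cutoff only multiplies the dissipation by `χ ≥ 0`, so the energy decreases before it is
  -- known that the cutoff is inactive; the argument is not circular.
  have hEd : ∀ t ∈ Ioo 0 T, HasDerivAt E (χ (y t) *
      (-(2 * ν * Nsq * energy 0 (w t)) - 2 * κ * energy 1 (b t))) t := fun t ht => by
    rw [← production_basic (hw00 t) (hb00 t) (hwh t) (finEnergy_of_supp (hwsupp t) 2)
      (finEnergy_of_supp (hbsupp t) 2), production_eq_sum (hwsupp t), production_eq_sum (hbsupp t)]
    have h1 := ((HasDerivAt.fun_sum fun k hk =>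
      (hasDerivAt_norm_sq (hwd t ht k hk)).const_mul (eig k)⁻¹).const_mul Nsq).add
      (HasDerivAt.fun_sum fun k hk => (hasDerivAt_norm_sq (hbd t ht k hk)).const_mul 1)
    refine HasDerivAt.congr_deriv h1 ?_
    have er : ∀ (p q : ℂ) (c : ℝ), (p * ((c : ℂ) * q)).re = c * (p * q).re := fun p q c => by
      rw [mul_left_comm, Complex.re_ofReal_mul]
    simp only [er, mul_add, Finset.mul_sum]
    congr 1
    · refine Finset.sum_congr rfl fun k _ => ?_
      ring
    · refine Finset.sum_congr rfl fun k _ => ?_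
      ring
  have hEanti : AntitoneOn E (Icc 0 T) := by
    refine antitoneOn_of_deriv_nonpos (convex_Icc 0 T) hEc ?_ ?_
    · rw [interior_Icc]
      exact fun t ht => (hEd t ht).differentiableAt.differentiableWithinAt
    · rw [interior_Icc]
      intro t ht
      rw [(hEd t ht).deriv]
      refine mul_nonpos_of_nonneg_of_nonpos χ.nonneg ?_
      have := energy_nonneg 0 (w t)
      have := energy_nonneg 1 (b t)
      have : 0 ≤ 2 * ν * Nsq * energy 0 (w t) := by positivity
      have : 0 ≤ 2 * κ * energy 1 (b t) := by positivity
      linarith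
  have hE0 : E 0 = e₀ := by
    simp only [hE, he₀, hw0, hb0]
    rw [energy_eq_sum (S := S) (fun k hk => by simp [stream, hws k hk]), energy_eq_sum hbs]
    congr 2
    · refine Finset.sum_congr rfl fun k hk => ?_
      have := eig_pos (k := k) fun h => h0 (h ▸ hk)
      rw [stream, norm_div, norm_neg, Complex.norm_real, Real.norm_eq_abs, abs_of_pos this]
      field_simp
  have hEle : ∀ t ∈ Icc 0 T, E t ≤ e₀ := fun t ht => by
    rw [← hE0]; exact hEanti ⟨le_rfl, hT⟩ ht ht.1
  have heS : 0 ≤ ∑ k ∈ S, eig k := Finset.sum_nonneg fun k _ => eig_nonneg k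
  have hχ : ∀ t ∈ Icc 0 T, χ (y t) = 1 := fun t ht => by
    refine χ.one_of_mem_closedBall (mem_closedBall_zero_iff.2 ?_)
    have hEt := hEle t ht
    have hp1 : ∀ k ∈ S, 0 ≤ (eig k)⁻¹ * ‖w t k‖ ^ 2 := fun k _ =>
      mul_nonneg (inv_nonneg.2 (eig_nonneg k)) (sq_nonneg _)
    have hp2 : ∀ k ∈ S, 0 ≤ 1 * ‖b t k‖ ^ 2 := fun k _ => by positivity
    have hsw := Finset.sum_nonneg hp1
    have hsb := Finset.sum_nonneg hp2
    have hrr : Real.sqrt (e₀ / Nsq * (∑ k ∈ S, eig k) + e₀) ≤ r := by rw [hr]; linarith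
    rw [Prod.norm_def]
    refine max_le ((pi_norm_le_iff_of_nonneg hr0.le).2 fun k => ?_)
      ((pi_norm_le_iff_of_nonneg hr0.le).2 fun k => ?_)
    · refine le_trans (Real.le_sqrt_of_sq_le ?_) hrr
      have e : ‖(y t).1 k‖ = ‖w t k‖ := by rw [hw]; simp only [extend_coe]
      have hk := eig_pos (k := k) fun h => h0 (h ▸ k.2)
      have h1 := Finset.single_le_sum hp1 k.2
      have h2 : Nsq * ((eig k)⁻¹ * ‖w t k‖ ^ 2) ≤ e₀ := by
        have := mul_le_mul_of_nonneg_left h1 hN.le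
        simp only [hE] at hEt
        linarith
      have h3 := Finset.single_le_sum (fun k _ => eig_nonneg k) k.2
      rw [e]
      calc ‖w t k‖ ^ 2 = (Nsq * ((eig k)⁻¹ * ‖w t k‖ ^ 2)) / Nsq * eig k := by field_simp
        _ ≤ e₀ / Nsq * ∑ k ∈ S, eig k := by gcongr
        _ ≤ _ := by linarith
    · refine le_trans (Real.le_sqrt_of_sq_le ?_) hrr
      have e : ‖(y t).2 k‖ = ‖b t k‖ := by rw [hb]; simp only [extend_coe]
      have h1 := Finset.single_le_sum hp2 k.2
      have h2 := mul_nonneg hN.le hsw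
      simp only [hE] at hEt
      have h3 : 0 ≤ e₀ / Nsq * ∑ k ∈ S, eig k := by positivity
      rw [e]
      linarith
  have hbound : ∀ (u : ℝ → Mode → ℂ) (n : ℕ), (∀ t, ∀ k ∉ S, u t k = 0) →
      (∀ k, ContinuousOn (fun t => u t k) (Icc 0 T)) →
      ∃ M, ∀ t ∈ Icc 0 T, FinEnergy n (u t) ∧ energy n (u t) ≤ M := fun u n hs hc => by
    have hcont : ContinuousOn (fun t => ∑ k ∈ S, eig k ^ n * ‖u t k‖ ^ 2) (Icc 0 T) :=
      continuousOn_finsetSum _ fun k _ => continuousOn_const.mul ((hc k).norm.pow 2)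
    obtain ⟨M, hM⟩ := isCompact_Icc.exists_bound_of_continuousOn hcont
    refine ⟨M, fun t ht => ⟨finEnergy_of_supp (hs t) n, ?_⟩⟩
    rw [energy_eq_sum (hs t)]
    exact (le_abs_self _).trans (hM t ht)
  have hsq : ∀ (u : ℝ → Mode → ℂ), (∀ t, ∀ k ∉ S, u t k = 0) →
      (∀ k, ContinuousOn (fun t => u t k) (Icc 0 T)) →
      ∫⁻ t in Ioc 0 T, ∑' k, ENNReal.ofReal (eig k ^ 2 * ‖u t k‖ ^ 2) ≠ ⊤ := fun u hs hc => by
    obtain ⟨M, hM⟩ := hbound u 2 hs hc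
    refine ne_top_of_le_ne_top (b := ∫⁻ _ in Ioc 0 T, ENNReal.ofReal M) (by simp [ENNReal.mul_ne_top])
      (setLIntegral_mono measurable_const fun t ht => ?_)
    have h1 := hM t (Ioc_subset_Icc_self ht)
    rw [← ENNReal.ofReal_tsum_of_nonneg (fun k => by positivity) h1.1]
    exact ENNReal.ofReal_le_ofReal h1.2
  refine ⟨w, b, ⟨h0, fun t _ => hwsupp t, fun t _ => hbsupp t, fun t _ => hwh t, hwc, hbc,
    hbound w 1 hwsupp hwc, hbound b 1 hbsupp hbc, hsq w hwsupp hwc, hsq b hbsupp hbc,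
    fun t ht k hk => ?_, fun t ht k hk => ?_⟩, hw0, hb0, fun t _ => hbh t⟩
  · simpa [hχ t (Ioo_subset_Icc_self ht)] using hwd t ht k hk
  · simpa [hχ t (Ioo_subset_Icc_self ht)] using hbd t ht k hk

end Thermohaline

end

noncomputable section

namespace Thermohaline

open scoped ComplexConjugate Topology
open Filter

/-! ### Passage to the limit -/

/-- Bounded equi-Lipschitz sequences of curves with countably many components have pointwise
convergent subsequences. -/
lemma exists_subseq_tendsto_of_lipschitz {ι E : Type*} [Countable ι] [NormedAddCommGroup E]
    [ProperSpace E] {f : ℕ → ℝ → ι → E} {B L : ι → ℝ}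
    (hB : ∀ n t i, ‖f n t i‖ ≤ B i) (hL : ∀ n t s i, ‖f n t i - f n s i‖ ≤ L i * |t - s|) :
    ∃ (φ : ℕ → ℕ) (F : ℝ → ι → E), StrictMono φ ∧
      ∀ t i, Tendsto (fun n => f (φ n) t i) atTop (𝓝 (F t i)) := by
  -- Rational times and indices form a countable set, so the product of balls is sequentially
  -- compact: this is the diagonal argument.
  have hK : IsCompact (univ.pi fun p : ℚ × ι => Metric.closedBall (0 : E) (B p.2)) :=
    isCompact_univ_pi fun p => isCompact_closedBall _ _
  obtain ⟨a, -, φ, hφ, ha⟩ := hK.tendsto_subseq (x := fun n (p : ℚ × ι) => f n p.1 p.2)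
    fun n p _ => mem_closedBall_zero_iff.2 (hB n _ _)
  have hq : ∀ (q : ℚ) i, CauchySeq fun n => f (φ n) q i := fun q i =>
    (tendsto_pi_nhds.1 ha (q, i)).cauchySeq
  -- The common Lipschitz constant of component `i` carries the Cauchy property from a nearby
  -- rational time to `t`.
  have hc : ∀ t i, ∃ x, Tendsto (fun n => f (φ n) t i) atTop (𝓝 x) := fun t i => by
    refine cauchySeq_tendsto_of_complete (Metric.cauchySeq_iff.2 fun ε hε => ?_)
    have hL0 : 0 ≤ |L i| := abs_nonneg _
    obtain ⟨q, hq1, hq2⟩ := exists_rat_btwn (show t < t + ε / (3 * (|L i| + 1)) by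
      have : 0 < ε / (3 * (|L i| + 1)) := by positivity
      linarith)
    have hLq : ∀ n, ‖f n t i - f n q i‖ < ε / 3 := fun n => by
      refine (hL n t q i).trans_lt ?_
      have h1 : |t - q| < ε / (3 * (|L i| + 1)) := by
        rw [abs_sub_comm, abs_of_pos (by linarith)]; linarith
      calc L i * |t - q| ≤ (|L i| + 1) * |t - q| := by
            gcongr; linarith [le_abs_self (L i)]
        _ < (|L i| + 1) * (ε / (3 * (|L i| + 1))) := by gcongr
        _ = ε / 3 := by field_simp
    obtain ⟨N, hN⟩ := Metric.cauchySeq_iff.1 (hq q i) (ε / 3) (by positivity)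
    refine ⟨N, fun m hm n hn => ?_⟩
    have h1 := hLq (φ m)
    have h2 := hLq (φ n)
    have h3 := hN m hm n hn
    rw [← dist_eq_norm] at h1 h2
    rw [dist_comm] at h2
    calc dist (f (φ m) t i) (f (φ n) t i)
        ≤ dist (f (φ m) t i) (f (φ m) q i) + dist (f (φ m) q i) (f (φ n) q i)
          + dist (f (φ n) q i) (f (φ n) t i) := dist_triangle4 _ _ _ _
      _ < ε := by linarith
  choose F hF using hc
  exact ⟨φ, F, hφ, hF⟩

/-- The square of modes used in the Galerkin approximation of level `N`. -/
def modeBox (N : ℕ) : Finset Mode :=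
  (Fintype.piFinset fun _ : Fin 2 => Finset.Icc (-(N : ℤ)) N).erase 0

lemma zero_notMem_modeBox (N : ℕ) : (0 : Mode) ∉ modeBox N := by simp [modeBox]

lemma neg_mem_modeBox {N : ℕ} : ∀ k ∈ modeBox N, -k ∈ modeBox N := fun k hk => by
  simp only [modeBox, Finset.mem_erase, Fintype.mem_piFinset, Finset.mem_Icc] at hk ⊢
  refine ⟨by simpa using hk.1, fun i => ?_⟩
  have := hk.2 i
  simp only [Pi.neg_apply]
  omega

lemma eventually_mem_modeBox {k : Mode} (hk : k ≠ 0) : ∀ᶠ N in atTop, k ∈ modeBox N := by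
  filter_upwards [eventually_ge_atTop ((k 0).natAbs + (k 1).natAbs)] with N hN
  simp only [modeBox, Finset.mem_erase, Fintype.mem_piFinset, Finset.mem_Icc]
  refine ⟨hk, fun i => ?_⟩
  fin_cases i <;> simp <;> omega

open Classical in
/-- Truncation of coefficients to a finite set of modes. -/
def truncate (S : Finset Mode) (u : Mode → ℂ) (k : Mode) : ℂ := if k ∈ S then u k else 0

lemma truncate_of_notMem {S : Finset Mode} {u : Mode → ℂ} : ∀ k ∉ S, truncate S u k = 0 :=
  fun k hk => by simp [truncate, hk]

lemma truncate_of_mem {S : Finset Mode} {u : Mode → ℂ} {k : Mode} (hk : k ∈ S) :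
    truncate S u k = u k := by simp [truncate, hk]

lemma hermitian_truncate {S : Finset Mode} (hS : ∀ k ∈ S, -k ∈ S) {u : Mode → ℂ}
    (hu : Hermitian u) : Hermitian (truncate S u) := fun k => by
  by_cases hk : k ∈ S
  · simp [truncate, hk, hS k hk, hu k]
  · have hk' : -k ∉ S := fun h => hk (by simpa using hS _ h)
    simp [truncate, hk, hk']

lemma energy_truncate_le {S : Finset Mode} {u : Mode → ℂ} {n : ℕ} (hu : FinEnergy n u) :
    energy n (truncate S u) ≤ energy n u := by
  refine (finEnergy_of_supp (S := S) truncate_of_notMem n).tsum_le_tsum (fun k => ?_) hu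
  by_cases hk : k ∈ S
  · simp [truncate, hk]
  · have := eig_nonneg k
    rw [truncate, if_neg hk, norm_zero, zero_pow two_ne_zero, mul_zero]
    positivity

/-- Bounds of finite sums pass to the energy. -/
lemma finEnergy_of_sum_le {n : ℕ} {u : Mode → ℂ} {Z : ℝ}
    (h : ∀ F : Finset Mode, ∑ k ∈ F, eig k ^ n * ‖u k‖ ^ 2 ≤ Z) :
    FinEnergy n u ∧ energy n u ≤ Z := by
  have hs : FinEnergy n u := summable_of_sum_le
    (fun k => mul_nonneg (pow_nonneg (eig_nonneg k) n) (sq_nonneg _)) h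
  exact ⟨hs, hs.tsum_le_of_sum_le h⟩

lemma FinEnergy.sum_le {n : ℕ} {u : Mode → ℂ} (h : FinEnergy n u) (F : Finset Mode) :
    ∑ k ∈ F, eig k ^ n * ‖u k‖ ^ 2 ≤ energy n u :=
  h.sum_le_tsum F fun k _ => mul_nonneg (pow_nonneg (eig_nonneg k) n) (sq_nonneg _)

lemma norm_le_sqrt_of_energy {u : Mode → ℂ} (hu0 : u 0 = 0) (hu : FinEnergy 1 u) {Z : ℝ}
    (hZ : energy 1 u ≤ Z) (k : Mode) : ‖u k‖ ≤ Real.sqrt Z := by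
  refine Real.le_sqrt_of_sq_le ?_
  have h0 := (hu.mono hu0 zero_le_one).le_energy k
  have h1 := energy_mono hu0 zero_le_one hu
  simp only [pow_zero, one_mul] at h0
  linarith

/-- Bounds of the velocities. -/
def rateBound (ν κ Nsq Z : ℝ) (k : Mode) : ℝ :=
  advBound Z k + (1 + Nsq) * ‖dx k‖ * Real.sqrt Z + (ν + κ) * eig k * Real.sqrt Z

section Rates

variable {ν κ Nsq Z : ℝ} {w b : Mode → ℂ}

lemma norm_rhsW_le (hν : 0 ≤ ν) (hκ : 0 ≤ κ) (hN : 0 ≤ Nsq) (hw0 : w 0 = 0) (hb0 : b 0 = 0)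
    (hw : FinEnergy 1 w ∧ energy 1 w ≤ Z) (hb : FinEnergy 1 b ∧ energy 1 b ≤ Z) (k : Mode) :
    ‖rhsW ν w b k‖ ≤ rateBound ν κ Nsq Z k := by
  have h1 := norm_adv_stream_le hw0 hw.1 hw.1 hw.2 hw.2 k
  have h2 := norm_le_sqrt_of_energy hw0 hw.1 hw.2 k
  have h3 := norm_le_sqrt_of_energy hb0 hb.1 hb.2 k
  have he := eig_nonneg k
  calc ‖rhsW ν w b k‖ ≤ ‖adv w (stream w) k‖ + ‖dx k‖ * ‖b k‖ + ν * eig k * ‖w k‖ := by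
        rw [rhsW]
        refine (norm_sub_le _ _).trans (add_le_add ((norm_add_le _ _).trans ?_) ?_)
        · rw [norm_neg, norm_mul]
        · rw [norm_mul, Complex.norm_real, Real.norm_eq_abs, abs_of_nonneg (by positivity)]
    _ ≤ advBound Z k + (1 + Nsq) * ‖dx k‖ * Real.sqrt Z + (ν + κ) * eig k * Real.sqrt Z := by
        gcongr
        · nlinarith [norm_nonneg (dx k)]
        · linarith

lemma norm_rhsB_le (hν : 0 ≤ ν) (hκ : 0 ≤ κ) (hN : 0 ≤ Nsq) (hw0 : w 0 = 0) (hb0 : b 0 = 0)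
    (hw : FinEnergy 1 w ∧ energy 1 w ≤ Z) (hb : FinEnergy 1 b ∧ energy 1 b ≤ Z) (k : Mode) :
    ‖rhsB κ Nsq w b k‖ ≤ rateBound ν κ Nsq Z k := by
  have h1 := norm_adv_stream_le hw0 hw.1 hb.1 hw.2 hb.2 k
  have h2 := norm_le_sqrt_of_energy (stream_zero w)
    (finEnergy_stream_of_le hw0 hw.1 (n := 1) (by norm_num))
    ((energy_stream_le hw0 hw.1 (n := 1) (by norm_num)).trans hw.2) k
  have h3 := norm_le_sqrt_of_energy hb0 hb.1 hb.2 k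
  have he := eig_nonneg k
  calc ‖rhsB κ Nsq w b k‖
      ≤ ‖adv b (stream w) k‖ + Nsq * ‖dx k‖ * ‖stream w k‖ + κ * eig k * ‖b k‖ := by
        rw [rhsB]
        refine (norm_sub_le _ _).trans (add_le_add ((norm_sub_le _ _).trans ?_) ?_)
        · rw [norm_neg, norm_mul, norm_mul, Complex.norm_real, Real.norm_eq_abs,
            abs_of_nonneg hN, mul_assoc]
        · rw [norm_mul, Complex.norm_real, Real.norm_eq_abs, abs_of_nonneg (by positivity)]
    _ ≤ advBound Z k + (1 + Nsq) * ‖dx k‖ * Real.sqrt Z + (ν + κ) * eig k * Real.sqrt Z := by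
        gcongr <;> linarith

/-- Continuity of the Jacobian under weak convergence. -/
lemma tendsto_adv {W U : ℕ → Mode → ℂ} {u : Mode → ℂ}
    (hW : ∀ᶠ n in atTop, W n 0 = 0 ∧ (FinEnergy 1 (W n) ∧ energy 1 (W n) ≤ Z) ∧
      (FinEnergy 1 (U n) ∧ energy 1 (U n) ≤ Z))
    (hWw : ∀ k, Tendsto (fun n => W n k) atTop (𝓝 (w k)))
    (hUu : ∀ k, Tendsto (fun n => U n k) atTop (𝓝 (u k))) (k : Mode) :
    Tendsto (fun n => adv (U n) (stream (W n)) k) atTop (𝓝 (adv u (stream w) k)) := by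
  unfold adv
  refine (tendsto_tsum_of_dominated_convergence (summable_adv_majorant Z k) (fun l => ?_) ?_).neg
  · exact (tendsto_const_nhds.mul (hUu l)).mul ((hWw (k - l)).neg.div_const _)
  · filter_upwards [hW] with n hn l
    exact norm_adv_stream_term_le hn.1 hn.2.1.1 hn.2.2.1 hn.2.1.2 hn.2.2.2 k l

lemma tendsto_rhsW {W U : ℕ → Mode → ℂ}
    (hW : ∀ᶠ n in atTop, W n 0 = 0 ∧ FinEnergy 1 (W n) ∧ energy 1 (W n) ≤ Z)
    (hWw : ∀ k, Tendsto (fun n => W n k) atTop (𝓝 (w k)))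
    (hUb : ∀ k, Tendsto (fun n => U n k) atTop (𝓝 (b k))) (k : Mode) :
    Tendsto (fun n => rhsW ν (W n) (U n) k) atTop (𝓝 (rhsW ν w b k)) :=
  ((tendsto_adv (hW.mono fun _ h => ⟨h.1, h.2, h.2⟩) hWw hWw k).neg.add
    (tendsto_const_nhds.mul (hUb k))).sub (tendsto_const_nhds.mul (hWw k))

lemma tendsto_rhsB {W U : ℕ → Mode → ℂ}
    (hW : ∀ᶠ n in atTop, W n 0 = 0 ∧ (FinEnergy 1 (W n) ∧ energy 1 (W n) ≤ Z) ∧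
      (FinEnergy 1 (U n) ∧ energy 1 (U n) ≤ Z))
    (hWw : ∀ k, Tendsto (fun n => W n k) atTop (𝓝 (w k)))
    (hUb : ∀ k, Tendsto (fun n => U n k) atTop (𝓝 (b k))) (k : Mode) :
    Tendsto (fun n => rhsB κ Nsq (W n) (U n) k) atTop (𝓝 (rhsB κ Nsq w b k)) :=
  ((tendsto_adv hW hWw hUb k).neg.sub
    (tendsto_const_nhds.mul (tendsto_const_nhds.mul ((hWw k).neg.div_const _)))).sub
    (tendsto_const_nhds.mul (hUb k))

end Rates

end Thermohaline

end

/-! ### Equi-Lipschitz coefficients and the limit of the Galerkin solutions -/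

noncomputable section

namespace Thermohaline

open scoped ComplexConjugate Topology
open Filter

namespace IsModeSolution

variable {ν κ Nsq T : ℝ} {S : Set Mode} {w b : ℝ → Mode → ℂ}

lemma integral_rhsW (h : IsModeSolution ν κ Nsq T S w b) {k : Mode} (hk : k ∈ S) {s t : ℝ}
    (hs : 0 ≤ s) (hst : s ≤ t) (ht : t ≤ T) :
    ∫ r in s..t, rhsW ν (w r) (b r) k = w t k - w s k := by
  have hsub : Icc s t ⊆ Icc 0 T := Icc_subset_Icc hs ht
  exact intervalIntegral.integral_eq_sub_of_hasDerivAt_of_le hst ((h.cont_w k).mono hsub)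
    (fun r hr => h.deriv_w r ⟨hs.trans_lt hr.1, hr.2.trans_le ht⟩ k hk)
    (((h.continuousOn_rhsW k).mono hsub).intervalIntegrable_of_Icc hst)

lemma integral_rhsB (h : IsModeSolution ν κ Nsq T S w b) {k : Mode} (hk : k ∈ S) {s t : ℝ}
    (hs : 0 ≤ s) (hst : s ≤ t) (ht : t ≤ T) :
    ∫ r in s..t, rhsB κ Nsq (w r) (b r) k = b t k - b s k := by
  have hsub : Icc s t ⊆ Icc 0 T := Icc_subset_Icc hs ht
  exact intervalIntegral.integral_eq_sub_of_hasDerivAt_of_le hst ((h.cont_b k).mono hsub)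
    (fun r hr => h.deriv_b r ⟨hs.trans_lt hr.1, hr.2.trans_le ht⟩ k hk)
    (((h.continuousOn_rhsB k).mono hsub).intervalIntegrable_of_Icc hst)

lemma lipschitz_aux {u r : ℝ → ℂ} {L : ℝ}
    (hint : ∀ s t, 0 ≤ s → s ≤ t → t ≤ T → ∫ x in s..t, r x = u t - u s)
    (hr : ∀ t ∈ Icc 0 T, ‖r t‖ ≤ L) {s t : ℝ} (hs : s ∈ Icc 0 T) (ht : t ∈ Icc 0 T) :
    ‖u t - u s‖ ≤ L * |t - s| := by
  wlog hst : s ≤ t generalizing s t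
  · rw [norm_sub_rev, abs_sub_comm]
    exact this ht hs (le_of_not_ge hst)
  rw [← hint s t hs.1 hst ht.2]
  refine intervalIntegral.norm_integral_le_of_norm_le_const fun x hx => ?_
  rw [uIoc_of_le hst] at hx
  exact hr x ⟨hs.1.trans hx.1.le, hx.2.trans ht.2⟩

/-- The constant depends on `k` and the energy bound but not on `S`, so it is common to all Galerkin
levels; outside `S` the coefficients vanish. -/
lemma lipschitz (hν : 0 ≤ ν) (hκ : 0 ≤ κ) (hN : 0 ≤ Nsq) (h : IsModeSolution ν κ Nsq T S w b)
    {Z : ℝ} (hwZ : ∀ t ∈ Icc 0 T, energy 1 (w t) ≤ Z) (hbZ : ∀ t ∈ Icc 0 T, energy 1 (b t) ≤ Z)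
    (k : Mode) {s t : ℝ} (hs : s ∈ Icc 0 T) (ht : t ∈ Icc 0 T) :
    ‖w t k - w s k‖ ≤ rateBound ν κ Nsq Z k * |t - s| ∧
      ‖b t k - b s k‖ ≤ rateBound ν κ Nsq Z k * |t - s| := by
  obtain ⟨M, -, hM⟩ := h.exists_bound
  have h1 : ∀ r ∈ Icc 0 T, ‖rhsW ν (w r) (b r) k‖ ≤ rateBound ν κ Nsq Z k := fun r hr =>
    norm_rhsW_le hν hκ hN (h.w_zero hr) (h.b_zero hr) ⟨(hM r hr).1.1, hwZ r hr⟩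
      ⟨(hM r hr).2.1, hbZ r hr⟩ k
  have h2 : ∀ r ∈ Icc 0 T, ‖rhsB κ Nsq (w r) (b r) k‖ ≤ rateBound ν κ Nsq Z k := fun r hr =>
    norm_rhsB_le hν hκ hN (h.w_zero hr) (h.b_zero hr) ⟨(hM r hr).1.1, hwZ r hr⟩
      ⟨(hM r hr).2.1, hbZ r hr⟩ k
  by_cases hk : k ∈ S
  · exact ⟨lipschitz_aux (u := fun t => w t k) (fun _ _ => h.integral_rhsW hk) h1 hs ht,
      lipschitz_aux (u := fun t => b t k) (fun _ _ => h.integral_rhsB hk) h2 hs ht⟩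
  · have h0 : 0 ≤ rateBound ν κ Nsq Z k * |t - s| :=
      mul_nonneg ((norm_nonneg _).trans (h1 s hs)) (abs_nonneg _)
    simp only [h.supp_w _ hs k hk, h.supp_w _ ht k hk, h.supp_b _ hs k hk, h.supp_b _ ht k hk,
      sub_self, norm_zero, h0, and_self]

end IsModeSolution

/-- Lower semicontinuity of the time integral of the energy of order two. -/
lemma lintegral_energy_two_le {T Z : ℝ} (hT : 0 ≤ T) {U : ℕ → ℝ → Mode → ℂ} {u : ℝ → Mode → ℂ}
    {D : ℝ}
    (hUu : ∀ t ∈ Icc 0 T, ∀ k, Tendsto (fun n => U n t k) atTop (𝓝 (u t k)))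
    (hD : ∀ᶠ n in atTop, ∀ t ∈ Icc 0 T, ∀ k, ‖U n t k‖ ≤ D)
    (hc : ∀ᶠ n in atTop, ∀ k, ContinuousOn (fun t => U n t k) (Icc 0 T))
    (huc : ∀ k, ContinuousOn (fun t => u t k) (Icc 0 T))
    (hZ : ∀ᶠ n in atTop, ∀ F : Finset Mode,
      ∫ t in (0 : ℝ)..T, ∑ k ∈ F, eig k ^ 2 * ‖U n t k‖ ^ 2 ≤ Z) :
    ∫⁻ t in Ioc 0 T, ∑' k, ENNReal.ofReal (eig k ^ 2 * ‖u t k‖ ^ 2) ≤ ENNReal.ofReal Z := by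
  have hfc : ∀ k, ContinuousOn (fun t => eig k ^ 2 * ‖u t k‖ ^ 2) (Icc 0 T) := fun k =>
    continuousOn_const.mul ((huc k).norm.pow 2)
  -- A finite sum of modes passes to the limit by dominated convergence. Exhausting all modes
  -- afterwards gives the semicontinuity.
  have hint : ∀ F : Finset Mode, ∫ t in (0 : ℝ)..T, ∑ k ∈ F, eig k ^ 2 * ‖u t k‖ ^ 2 ≤ Z := by
    intro F
    refine le_of_tendsto (x := atTop) (f := fun n =>
      ∫ t in (0 : ℝ)..T, ∑ k ∈ F, eig k ^ 2 * ‖U n t k‖ ^ 2) ?_ (hZ.mono fun n h => h F)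
    refine intervalIntegral.tendsto_integral_filter_of_dominated_convergence
      (fun _ => ∑ k ∈ F, eig k ^ 2 * D ^ 2) ?_ ?_ intervalIntegrable_const ?_
    · filter_upwards [hc] with n hn
      rw [uIoc_of_le hT]
      refine ContinuousOn.aestronglyMeasurable ?_ measurableSet_Ioc
      exact (continuousOn_finsetSum _ fun k _ => continuousOn_const.mul
        ((hn k).norm.pow 2)).mono Ioc_subset_Icc_self
    · filter_upwards [hD] with n hn
      refine ae_of_all _ fun t ht => ?_
      rw [uIoc_of_le hT] at ht
      rw [Real.norm_eq_abs, abs_of_nonneg (Finset.sum_nonneg fun k _ => by positivity)]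
      refine Finset.sum_le_sum fun k _ => ?_
      have := hn t (Ioc_subset_Icc_self ht) k
      gcongr
    · refine ae_of_all _ fun t ht => ?_
      rw [uIoc_of_le hT] at ht
      exact tendsto_finsetSum _ fun k _ =>
        tendsto_const_nhds.mul ((hUu t (Ioc_subset_Icc_self ht) k).norm.pow 2)
  rw [lintegral_tsum fun k => ((hfc k).mono Ioc_subset_Icc_self).aemeasurable
    measurableSet_Ioc |>.ennreal_ofReal]
  refine ENNReal.summable.tsum_le_of_sum_le fun F => ?_
  have hi : ∀ k, IntegrableOn (fun t => eig k ^ 2 * ‖u t k‖ ^ 2) (Ioc 0 T) := fun k =>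
    (hfc k).integrableOn_Icc.mono_set Ioc_subset_Icc_self
  calc ∑ k ∈ F, ∫⁻ t in Ioc 0 T, ENNReal.ofReal (eig k ^ 2 * ‖u t k‖ ^ 2)
      = ∑ k ∈ F, ENNReal.ofReal (∫ t in Ioc 0 T, eig k ^ 2 * ‖u t k‖ ^ 2) :=
        Finset.sum_congr rfl fun k _ =>
          (ofReal_integral_eq_lintegral_ofReal (hi k) (ae_of_all _ fun t => by positivity)).symm
    _ = ENNReal.ofReal (∑ k ∈ F, ∫ t in Ioc 0 T, eig k ^ 2 * ‖u t k‖ ^ 2) :=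
        (ENNReal.ofReal_sum_of_nonneg fun k _ => integral_nonneg fun t => by positivity).symm
    _ ≤ ENNReal.ofReal Z := by
        refine ENNReal.ofReal_le_ofReal ?_
        rw [← integral_finsetSum _ fun k _ => hi k, ← intervalIntegral.integral_of_le hT]
        exact hint F

/-- Convergence of time integrals of continuous functions that are bounded. -/
lemma tendsto_integral_of_bounded {T L : ℝ} (hT : 0 ≤ T) {G : ℕ → ℝ → ℂ} {g : ℝ → ℂ}
    (hc : ∀ᶠ n in atTop, ContinuousOn (G n) (Icc 0 T))
    (hL : ∀ᶠ n in atTop, ∀ t ∈ Icc 0 T, ‖G n t‖ ≤ L)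
    (hg : ∀ t ∈ Icc 0 T, Tendsto (fun n => G n t) atTop (𝓝 (g t))) :
    Tendsto (fun n => ∫ t in (0 : ℝ)..T, G n t) atTop (𝓝 (∫ t in (0 : ℝ)..T, g t)) := by
  refine intervalIntegral.tendsto_integral_filter_of_dominated_convergence (fun _ => L) ?_ ?_
    intervalIntegrable_const ?_
  · filter_upwards [hc] with n hn
    rw [uIoc_of_le hT]
    exact (hn.mono Ioc_subset_Icc_self).aestronglyMeasurable measurableSet_Ioc
  · filter_upwards [hL] with n hn
    refine ae_of_all _ fun t ht => ?_
    rw [uIoc_of_le hT] at ht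
    exact hn t (Ioc_subset_Icc_self ht)
  · refine ae_of_all _ fun t ht => ?_
    rw [uIoc_of_le hT] at ht
    exact hg t (Ioc_subset_Icc_self ht)

lemma hasDerivAt_of_integral_eq {T : ℝ} {u r : ℝ → ℂ} (hr : ContinuousOn r (Icc 0 T))
    (h : ∀ t ∈ Icc 0 T, u t - u 0 = ∫ s in (0 : ℝ)..t, r s) {t : ℝ} (ht : t ∈ Ioo 0 T) :
    HasDerivAt u (r t) t := by
  have hnhds : Icc 0 T ∈ 𝓝 t := Icc_mem_nhds ht.1 ht.2
  have h1 : HasDerivAt (fun t => ∫ s in (0 : ℝ)..t, r s) (r t) t :=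
    intervalIntegral.integral_hasDerivAt_right
      ((hr.mono (Icc_subset_Icc_right ht.2.le)).intervalIntegrable_of_Icc ht.1.le)
      ⟨Icc 0 T, hnhds, hr.aestronglyMeasurable measurableSet_Icc⟩ (hr.continuousAt hnhds)
  refine (h1.const_add (u 0)).congr_of_eventuallyEq ?_
  filter_upwards [hnhds] with s hs
  rw [← h s hs]; ring

/-- Existence of global solutions in Fourier space. -/
theorem exists_modeSolution {ν κ Nsq : ℝ} (hν : 0 < ν) (hκ : 0 < κ) (hN : 0 < Nsq)
    {w₀ b₀ : Mode → ℂ} (hw₀ : Hermitian w₀) (hb₀ : Hermitian b₀) (hw₀0 : w₀ 0 = 0)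
    (hb₀0 : b₀ 0 = 0) (hw₀1 : FinEnergy 1 w₀) (hb₀1 : FinEnergy 1 b₀) :
    ∃ w b : ℝ → Mode → ℂ, w 0 = w₀ ∧ b 0 = b₀ ∧ (∀ t, 0 ≤ t → Hermitian (b t)) ∧
      ∀ T, 0 ≤ T → IsModeSolution ν κ Nsq T {0}ᶜ w b := by
  obtain ⟨Z, β, hβ, hap⟩ := exists_apriori_bound hν hκ hN (max (energy 1 w₀) (energy 1 b₀))
  -- Level `N` uses the modes of size at most `N` on the time interval `[0, N]`, so one sequence
  -- exhausts all modes and all times.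
  have hgal := fun N : ℕ => exists_galerkin hν hκ hN (zero_notMem_modeBox N) neg_mem_modeBox
    (hermitian_truncate (neg_mem_modeBox (N := N)) hw₀)
    (hermitian_truncate (neg_mem_modeBox (N := N)) hb₀)
    truncate_of_notMem truncate_of_notMem (T := N) (Nat.cast_nonneg N)
  choose W B hsol hW0 hB0 hBh using hgal
  have hap' := fun N : ℕ => hap N (modeBox N) (W N) (B N) (hsol N)
    (by rw [hW0]; exact (energy_truncate_le hw₀1).trans (le_max_left _ _))
    (by rw [hB0]; exact (energy_truncate_le hb₀1).trans (le_max_right _ _))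
  have hZ0 : 0 ≤ Z := by
    have h := (hap' 0 0 (by simp)).1
    simp only [mul_zero, Real.exp_zero, mul_one] at h
    exact (energy_nonneg _ _).trans h
  have hexp : ∀ t, 0 ≤ t → Z * Real.exp (-β * t) ≤ Z := fun t ht =>
    mul_le_of_le_one_right hZ0 (Real.exp_le_one_iff.2 (by nlinarith))
  have hWZ : ∀ N : ℕ, ∀ t ∈ Icc (0 : ℝ) N, FinEnergy 1 (W N t) ∧ energy 1 (W N t) ≤ Z :=
    fun N t ht => ⟨finEnergy_of_supp (S := modeBox N) ((hsol N).supp_w t ht) 1,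
      (hap' N t ht).1.trans (hexp t ht.1)⟩
  have hBZ : ∀ N : ℕ, ∀ t ∈ Icc (0 : ℝ) N, FinEnergy 1 (B N t) ∧ energy 1 (B N t) ≤ Z :=
    fun N t ht => ⟨finEnergy_of_supp (S := modeBox N) ((hsol N).supp_b t ht) 1,
      (hap' N t ht).2.1.trans (hexp t ht.1)⟩
  have hWn : ∀ N : ℕ, ∀ t ∈ Icc (0 : ℝ) N, ∀ k, ‖W N t k‖ ≤ Real.sqrt Z := fun N t ht =>
    norm_le_sqrt_of_energy ((hsol N).w_zero ht) (hWZ N t ht).1 (hWZ N t ht).2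
  have hBn : ∀ N : ℕ, ∀ t ∈ Icc (0 : ℝ) N, ∀ k, ‖B N t k‖ ≤ Real.sqrt Z := fun N t ht =>
    norm_le_sqrt_of_energy ((hsol N).b_zero ht) (hBZ N t ht).1 (hBZ N t ht).2
  -- Clamping time to `[0, N]` extends the curves to the whole line with the same bounds and
  -- Lipschitz constants, as the compactness lemma requires.
  set cl : ℕ → ℝ → ℝ := fun N t => max 0 (min t N) with hcl
  have hclm : ∀ (N : ℕ) (t : ℝ), cl N t ∈ Icc (0 : ℝ) N := fun N t =>
    ⟨le_max_left _ _, max_le (Nat.cast_nonneg N) (min_le_right _ _)⟩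
  have hcll : ∀ (N : ℕ) (t s : ℝ), |cl N t - cl N s| ≤ |t - s| := fun N t s => by
    have h := ((LipschitzWith.id (α := ℝ)).min_const (N : ℝ)).const_max 0
    simpa [Real.dist_eq] using h.dist_le_mul t s
  have hcle : ∀ (N : ℕ) (t : ℝ), 0 ≤ t → t ≤ N → cl N t = t := fun N t h0 h1 => by
    simp [hcl, min_eq_left h1, max_eq_right h0]
  have hrate : ∀ k, 0 ≤ rateBound ν κ Nsq Z k := fun k =>
    (norm_nonneg _).trans (norm_rhsW_le hν.le hκ.le hN.le ((hsol 0).w_zero (by simp))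
      ((hsol 0).b_zero (by simp)) (hWZ 0 0 (by simp)) (hBZ 0 0 (by simp)) k)
  obtain ⟨φ, F, hφ, hF⟩ := exists_subseq_tendsto_of_lipschitz
    (f := fun N t k => ((W N (cl N t) k, B N (cl N t) k) : ℂ × ℂ))
    (B := fun _ => Real.sqrt Z) (L := rateBound ν κ Nsq Z)
    (fun N t k => max_le (hWn N _ (hclm N t) k) (hBn N _ (hclm N t) k))
    (fun N t s k => by
      have h := (hsol N).lipschitz hν.le hκ.le hN.le (fun t ht => (hWZ N t ht).2)
        (fun t ht => (hBZ N t ht).2) k (hclm N s) (hclm N t)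
      have h2 := mul_le_mul_of_nonneg_left (hcll N t s) (hrate k)
      exact max_le (h.1.trans h2) (h.2.trans h2))
  have hφt : ∀ t : ℝ, ∀ᶠ n in atTop, t ≤ (φ n : ℝ) := fun t =>
    (tendsto_natCast_atTop_atTop.comp hφ.tendsto_atTop).eventually_ge_atTop t
  set w : ℝ → Mode → ℂ := fun t k => (F t k).1 with hw
  set b : ℝ → Mode → ℂ := fun t k => (F t k).2 with hb
  have hWw : ∀ t, 0 ≤ t → ∀ k, Tendsto (fun n => W (φ n) t k) atTop (𝓝 (w t k)) :=
    fun t ht k => by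
    refine ((continuous_fst.tendsto _).comp (hF t k)).congr' ?_
    filter_upwards [hφt t] with n hn
    simp [hcle (φ n) t ht hn]
  have hBb : ∀ t, 0 ≤ t → ∀ k, Tendsto (fun n => B (φ n) t k) atTop (𝓝 (b t k)) :=
    fun t ht k => by
    refine ((continuous_snd.tendsto _).comp (hF t k)).congr' ?_
    filter_upwards [hφt t] with n hn
    simp [hcle (φ n) t ht hn]
  have hφS : ∀ k : Mode, k ≠ 0 → ∀ᶠ n in atTop, k ∈ modeBox (φ n) := fun k hk =>
    hφ.tendsto_atTop.eventually (eventually_mem_modeBox hk)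
  have hw00 : ∀ t, 0 ≤ t → w t 0 = 0 := fun t ht => by
    refine tendsto_nhds_unique (hWw t ht 0) (tendsto_const_nhds.congr' ?_)
    filter_upwards [hφt t] with n hn
    exact ((hsol (φ n)).w_zero ⟨ht, hn⟩).symm
  have hb00 : ∀ t, 0 ≤ t → b t 0 = 0 := fun t ht => by
    refine tendsto_nhds_unique (hBb t ht 0) (tendsto_const_nhds.congr' ?_)
    filter_upwards [hφt t] with n hn
    exact ((hsol (φ n)).b_zero ⟨ht, hn⟩).symm
  have hwinit : w 0 = w₀ := by
    ext k
    by_cases hk : k = 0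
    · rw [hk, hw00 0 le_rfl, hw₀0]
    refine tendsto_nhds_unique (hWw 0 le_rfl k) (tendsto_const_nhds.congr' ?_)
    filter_upwards [hφS k hk] with n hn
    rw [hW0, truncate_of_mem hn]
  have hbinit : b 0 = b₀ := by
    ext k
    by_cases hk : k = 0
    · rw [hk, hb00 0 le_rfl, hb₀0]
    refine tendsto_nhds_unique (hBb 0 le_rfl k) (tendsto_const_nhds.congr' ?_)
    filter_upwards [hφS k hk] with n hn
    rw [hB0, truncate_of_mem hn]
  have hwh : ∀ t, 0 ≤ t → Hermitian (w t) := fun t ht k => by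
    refine tendsto_nhds_unique (hWw t ht (-k))
      (((Complex.continuous_conj.tendsto _).comp (hWw t ht k)).congr' ?_)
    filter_upwards [hφt t] with n hn
    exact ((hsol (φ n)).herm_w t ⟨ht, hn⟩ k).symm
  have hbh : ∀ t, 0 ≤ t → Hermitian (b t) := fun t ht k => by
    refine tendsto_nhds_unique (hBb t ht (-k))
      (((Complex.continuous_conj.tendsto _).comp (hBb t ht k)).congr' ?_)
    filter_upwards [hφt t] with n hn
    exact (hBh (φ n) t ⟨ht, hn⟩ k).symm
  -- Modewise convergence passes through finite sums, and these bound the full energy.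
  have hwE : ∀ t, 0 ≤ t → FinEnergy 1 (w t) ∧ energy 1 (w t) ≤ Z := fun t ht => by
    refine finEnergy_of_sum_le fun G => ?_
    refine le_of_tendsto (tendsto_finsetSum G fun k _ =>
      (tendsto_const_nhds (x := eig k ^ 1)).mul ((hWw t ht k).norm.pow 2)) ?_
    filter_upwards [hφt t] with n hn
    exact ((hWZ (φ n) t ⟨ht, hn⟩).1.sum_le G).trans (hWZ (φ n) t ⟨ht, hn⟩).2
  have hbE : ∀ t, 0 ≤ t → FinEnergy 1 (b t) ∧ energy 1 (b t) ≤ Z := fun t ht => by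
    refine finEnergy_of_sum_le fun G => ?_
    refine le_of_tendsto (tendsto_finsetSum G fun k _ =>
      (tendsto_const_nhds (x := eig k ^ 1)).mul ((hBb t ht k).norm.pow 2)) ?_
    filter_upwards [hφt t] with n hn
    exact ((hBZ (φ n) t ⟨ht, hn⟩).1.sum_le G).trans (hBZ (φ n) t ⟨ht, hn⟩).2
  have hLip : ∀ k t s, ‖F t k - F s k‖ ≤ rateBound ν κ Nsq Z k * |t - s| := fun k t s => by
    refine le_of_tendsto ((hF t k).sub (hF s k)).norm (Eventually.of_forall fun n => ?_)
    have h := (hsol (φ n)).lipschitz hν.le hκ.le hN.le (fun t ht => (hWZ (φ n) t ht).2)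
      (fun t ht => (hBZ (φ n) t ht).2) k (hclm (φ n) s) (hclm (φ n) t)
    have h2 := mul_le_mul_of_nonneg_left (hcll (φ n) t s) (hrate k)
    exact max_le (h.1.trans h2) (h.2.trans h2)
  have hFc : ∀ k, Continuous fun t => F t k := fun k => by
    refine (LipschitzWith.of_dist_le_mul (K := ⟨rateBound ν κ Nsq Z k, hrate k⟩)
      fun t s => ?_).continuous
    rw [dist_eq_norm, Real.dist_eq]
    exact hLip k t s
  have hwc : ∀ k, Continuous fun t => w t k := fun k => continuous_fst.comp (hFc k)
  have hbc : ∀ k, Continuous fun t => b t k := fun k => continuous_snd.comp (hFc k)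
  have hWev : ∀ t : ℝ, 0 ≤ t → ∀ᶠ n in atTop, W (φ n) t 0 = 0 ∧
      (FinEnergy 1 (W (φ n) t) ∧ energy 1 (W (φ n) t) ≤ Z) ∧
      (FinEnergy 1 (B (φ n) t) ∧ energy 1 (B (φ n) t) ≤ Z) := fun t ht => by
    filter_upwards [hφt t] with n hn
    exact ⟨(hsol (φ n)).w_zero ⟨ht, hn⟩, hWZ (φ n) t ⟨ht, hn⟩, hBZ (φ n) t ⟨ht, hn⟩⟩
  -- For fixed `k` the integrated equation holds as soon as the box contains `k`, and `rateBound`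
  -- dominates the integrands.
  have hwI : ∀ k, k ≠ 0 → ∀ t, 0 ≤ t →
      w t k - w 0 k = ∫ s in (0 : ℝ)..t, rhsW ν (w s) (b s) k := fun k hk t ht => by
    have hlim := tendsto_integral_of_bounded (T := t) (L := rateBound ν κ Nsq Z k) ht
      (G := fun n s => rhsW ν (W (φ n) s) (B (φ n) s) k) (g := fun s => rhsW ν (w s) (b s) k)
      ((hφt t).mono fun n hn => ((hsol (φ n)).continuousOn_rhsW k).mono (Icc_subset_Icc_right hn))
      ((hφt t).mono fun n hn s hs => norm_rhsW_le hν.le hκ.le hN.le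
        ((hsol (φ n)).w_zero ⟨hs.1, hs.2.trans hn⟩) ((hsol (φ n)).b_zero ⟨hs.1, hs.2.trans hn⟩)
        (hWZ (φ n) s ⟨hs.1, hs.2.trans hn⟩) (hBZ (φ n) s ⟨hs.1, hs.2.trans hn⟩) k)
      (fun s hs => tendsto_rhsW ((hWev s hs.1).mono fun n h => ⟨h.1, h.2.1⟩)
        (hWw s hs.1) (hBb s hs.1) k)
    refine tendsto_nhds_unique ((hWw t ht k).sub (hWw 0 le_rfl k)) (hlim.congr' ?_)
    filter_upwards [hφt t, hφS k hk] with n hn hkn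
    exact (hsol (φ n)).integral_rhsW hkn le_rfl ht hn
  have hbI : ∀ k, k ≠ 0 → ∀ t, 0 ≤ t →
      b t k - b 0 k = ∫ s in (0 : ℝ)..t, rhsB κ Nsq (w s) (b s) k := fun k hk t ht => by
    have hlim := tendsto_integral_of_bounded (T := t) (L := rateBound ν κ Nsq Z k) ht
      (G := fun n s => rhsB κ Nsq (W (φ n) s) (B (φ n) s) k)
      (g := fun s => rhsB κ Nsq (w s) (b s) k)
      ((hφt t).mono fun n hn => ((hsol (φ n)).continuousOn_rhsB k).mono (Icc_subset_Icc_right hn))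
      ((hφt t).mono fun n hn s hs => norm_rhsB_le hν.le hκ.le hN.le
        ((hsol (φ n)).w_zero ⟨hs.1, hs.2.trans hn⟩) ((hsol (φ n)).b_zero ⟨hs.1, hs.2.trans hn⟩)
        (hWZ (φ n) s ⟨hs.1, hs.2.trans hn⟩) (hBZ (φ n) s ⟨hs.1, hs.2.trans hn⟩) k)
      (fun s hs => tendsto_rhsB (hWev s hs.1) (hWw s hs.1) (hBb s hs.1) k)
    refine tendsto_nhds_unique ((hBb t ht k).sub (hBb 0 le_rfl k)) (hlim.congr' ?_)
    filter_upwards [hφt t, hφS k hk] with n hn hkn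
    exact (hsol (φ n)).integral_rhsB hkn le_rfl ht hn
  have hsum : ∀ (T : ℝ) (n : ℕ) (u : ℝ → Mode → ℂ), 0 ≤ T → (∀ t ∈ Icc 0 T, ∀ k ∉ modeBox n, u t k = 0) →
      (∀ k, ContinuousOn (fun t => u t k) (Icc 0 T)) → ∫ s in (0 : ℝ)..T, energy 2 (u s) ≤ Z →
      ∀ G : Finset Mode, ∫ t in (0 : ℝ)..T, ∑ k ∈ G, eig k ^ 2 * ‖u t k‖ ^ 2 ≤ Z := by
    intro T n u hT hs hc hI G
    refine le_trans ?_ hI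
    have hcG : ∀ G : Finset Mode,
        ContinuousOn (fun t => ∑ k ∈ G, eig k ^ 2 * ‖u t k‖ ^ 2) (Icc 0 T) := fun G =>
      continuousOn_finsetSum _ fun k _ => continuousOn_const.mul ((hc k).norm.pow 2)
    refine intervalIntegral.integral_mono_on hT ((hcG G).intervalIntegrable_of_Icc hT)
      (ContinuousOn.intervalIntegrable_of_Icc hT
        ((hcG (modeBox n)).congr fun t ht => energy_eq_sum (hs t ht) 2)) fun t ht => ?_
    exact (finEnergy_of_supp (hs t ht) 2).sum_le G
  refine ⟨w, b, hwinit, hbinit, hbh, fun T hT => ?_⟩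
  have hsubn : ∀ n : ℕ, T ≤ n → Icc 0 T ⊆ Icc (0 : ℝ) n := fun n hn => Icc_subset_Icc_right hn
  have hwcO : ∀ k, ContinuousOn (fun t => w t k) (Icc 0 T) := fun k => (hwc k).continuousOn
  have hbcO : ∀ k, ContinuousOn (fun t => b t k) (Icc 0 T) := fun k => (hbc k).continuousOn
  refine ⟨by simp, fun t ht k hk => ?_, fun t ht k hk => ?_, fun t ht => hwh t ht.1, hwcO, hbcO,
    ⟨Z, fun t ht => hwE t ht.1⟩, ⟨Z, fun t ht => hbE t ht.1⟩, ?_, ?_, fun t ht k hk => ?_,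
    fun t ht k hk => ?_⟩
  · have : k = 0 := by simpa using hk
    rw [this, hw00 t ht.1]
  · have : k = 0 := by simpa using hk
    rw [this, hb00 t ht.1]
  · refine ne_top_of_le_ne_top ENNReal.ofReal_ne_top (lintegral_energy_two_le (Z := Z) (D := Real.sqrt Z)
      (U := fun n => W (φ n)) hT (fun t ht => hWw t ht.1) ?_ ?_ hwcO ?_)
    · exact (hφt T).mono fun n hn t ht => hWn (φ n) t (hsubn _ hn ht)
    · exact (hφt T).mono fun n hn k => ((hsol (φ n)).cont_w k).mono (hsubn _ hn)
    · exact (hφt T).mono fun n hn => hsum T (φ n) (W (φ n)) hT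
        (fun t ht => (hsol (φ n)).supp_w t (hsubn _ hn ht))
        (fun k => ((hsol (φ n)).cont_w k).mono (hsubn _ hn)) (hap' (φ n) T ⟨hT, hn⟩).2.2.1
  · refine ne_top_of_le_ne_top ENNReal.ofReal_ne_top (lintegral_energy_two_le (Z := Z) (D := Real.sqrt Z)
      (U := fun n => B (φ n)) hT (fun t ht => hBb t ht.1) ?_ ?_ hbcO ?_)
    · exact (hφt T).mono fun n hn t ht => hBn (φ n) t (hsubn _ hn ht)
    · exact (hφt T).mono fun n hn k => ((hsol (φ n)).cont_b k).mono (hsubn _ hn)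
    · exact (hφt T).mono fun n hn => hsum T (φ n) (B (φ n)) hT
        (fun t ht => (hsol (φ n)).supp_b t (hsubn _ hn ht))
        (fun k => ((hsol (φ n)).cont_b k).mono (hsubn _ hn)) (hap' (φ n) T ⟨hT, hn⟩).2.2.2
  · have hk' : k ≠ 0 := by simpa using hk
    refine hasDerivAt_of_integral_eq (u := fun t => w t k) (T := T) ?_ (fun t ht => hwI k hk' t ht.1) ht
    exact ((continuousOn_adv (fun t ht => hw00 t ht.1) (fun t ht => hwE t ht.1)
      (fun t ht => hwE t ht.1) hwcO hwcO k).neg.add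
      (continuousOn_const.mul (hbcO k))).sub (continuousOn_const.mul (hwcO k))
  · have hk' : k ≠ 0 := by simpa using hk
    refine hasDerivAt_of_integral_eq (u := fun t => b t k) (T := T) ?_ (fun t ht => hbI k hk' t ht.1) ht
    exact ((continuousOn_adv (fun t ht => hw00 t ht.1) (fun t ht => hwE t ht.1)
      (fun t ht => hbE t ht.1) hwcO hbcO k).neg.sub
      (continuousOn_const.mul (continuousOn_const.mul ((hwcO k).neg.div_const _)))).sub
      (continuousOn_const.mul (hbcO k))

end Thermohaline

end

noncomputable section

namespace Thermohaline

open scoped ComplexConjugate Topology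
open Filter UnitAddTorus

/-! ### Test functions -/

/-- The projection of the plane onto the torus. -/
def toTorus (x : Fin 2 → ℝ) : Torus := fun i => (x i : UnitAddCircle)

/-- Smoothness of a test function is a statement on the plane; the quotient map carries continuity
down to the torus. -/
lemma isOpenQuotientMap_toTorus : IsOpenQuotientMap toTorus :=
  IsOpenQuotientMap.piMap (f := fun (_ : Fin 2) (x : ℝ) => (x : UnitAddCircle))
    fun _ => QuotientAddGroup.isOpenQuotientMap_mk

lemma exists_toTorus (p : Torus) : ∃ x, toTorus x = p := isOpenQuotientMap_toTorus.surjective p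

lemma toTorus_add_single (x : Fin 2 → ℝ) (i : Fin 2) (h : ℝ) :
    toTorus x + Pi.single i (h : UnitAddCircle) = toTorus (x + Pi.single i h) := by
  ext j
  by_cases hj : j = i
  · subst hj; simp [toTorus]
  · simp [toTorus, hj]

lemma isTest_iff {φ : Torus → ℝ} : IsTest φ ↔ ContDiff ℝ ∞ (φ ∘ toTorus) := Iff.rfl

lemma IsTest.continuous {φ : Torus → ℝ} (hφ : IsTest φ) : Continuous φ :=
  isOpenQuotientMap_toTorus.continuous_comp_iff.1 (isTest_iff.1 hφ).continuous

lemma IsTest.add {φ χ : Torus → ℝ} (hφ : IsTest φ) (hχ : IsTest χ) :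
    IsTest fun p => φ p + χ p := ContDiff.add (isTest_iff.1 hφ) (isTest_iff.1 hχ)

lemma IsTest.mul {φ χ : Torus → ℝ} (hφ : IsTest φ) (hχ : IsTest χ) :
    IsTest fun p => φ p * χ p := ContDiff.mul (isTest_iff.1 hφ) (isTest_iff.1 hχ)

lemma IsTest.hasDerivAt_toTorus {φ : Torus → ℝ} (hφ : IsTest φ) (i : Fin 2) (x : Fin 2 → ℝ)
    (h : ℝ) :
    HasDerivAt (fun s : ℝ => φ (toTorus x + Pi.single i (s : UnitAddCircle)))
      (fderiv ℝ (φ ∘ toTorus) (x + Pi.single i h) (Pi.single i 1)) h := by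
  simp only [toTorus_add_single]
  have h1 : HasFDerivAt (φ ∘ toTorus) (fderiv ℝ (φ ∘ toTorus) (x + Pi.single i h))
      (x + Pi.single i h) := ((isTest_iff.1 hφ).differentiable (by simp) _).hasFDerivAt
  have h2 : HasDerivAt (fun s : ℝ => x + Pi.single i s) (Pi.single i (1 : ℝ)) h := by
    refine HasDerivAt.const_add _ ?_
    rw [hasDerivAt_pi]
    intro j
    by_cases hj : j = i
    · subst hj; simpa using hasDerivAt_id' h
    · simpa [hj] using hasDerivAt_const h (0 : ℝ)
  exact h1.comp_hasDerivAt h h2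

lemma IsTest.pderiv_toTorus {φ : Torus → ℝ} (hφ : IsTest φ) (i : Fin 2) (x : Fin 2 → ℝ) :
    pderiv i φ (toTorus x) = fderiv ℝ (φ ∘ toTorus) x (Pi.single i 1) := by
  have := (hφ.hasDerivAt_toTorus i x 0).deriv
  simpa [pderiv] using this

lemma IsTest.hasDerivAt {φ : Torus → ℝ} (hφ : IsTest φ) (i : Fin 2) (p : Torus) (h : ℝ) :
    HasDerivAt (fun s : ℝ => φ (p + Pi.single i (s : UnitAddCircle)))
      (pderiv i φ (p + Pi.single i (h : UnitAddCircle))) h := by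
  obtain ⟨x, rfl⟩ := exists_toTorus p
  rw [toTorus_add_single, hφ.pderiv_toTorus]
  exact hφ.hasDerivAt_toTorus i x h

lemma IsTest.pderiv {φ : Torus → ℝ} (hφ : IsTest φ) (i : Fin 2) : IsTest (pderiv i φ) := by
  rw [isTest_iff]
  have : Thermohaline.pderiv i φ ∘ toTorus
      = fun x => fderiv ℝ (φ ∘ toTorus) x (Pi.single i 1) := by
    ext x; exact hφ.pderiv_toTorus i x
  rw [this]
  exact ((isTest_iff.1 hφ).fderiv_right (m := ∞) (by simp)).clm_apply contDiff_const

lemma IsTest.iterate_pderiv {φ : Torus → ℝ} (hφ : IsTest φ) (i : Fin 2) (n : ℕ) :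
    IsTest ((Thermohaline.pderiv i)^[n] φ) := by
  induction n with
  | zero => exact hφ
  | succ n ih => rw [Function.iterate_succ_apply']; exact ih.pderiv i

lemma IsTest.testLaplacian {φ : Torus → ℝ} (hφ : IsTest φ) : IsTest (testLaplacian φ) :=
  ((hφ.pderiv 0).pderiv 0).add ((hφ.pderiv 1).pderiv 1)

lemma IsTest.pderiv_mul {φ χ : Torus → ℝ} (hφ : IsTest φ) (hχ : IsTest χ) (i : Fin 2)
    (p : Torus) : Thermohaline.pderiv i (fun p => φ p * χ p) p
      = Thermohaline.pderiv i φ p * χ p + φ p * Thermohaline.pderiv i χ p := by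
  have h := ((hφ.hasDerivAt i p 0).mul (hχ.hasDerivAt i p 0)).deriv
  simpa [Thermohaline.pderiv, Pi.mul_def] using h

lemma integrable_of_continuous {E : Type*} [NormedAddCommGroup E] {f : Torus → E}
    (hf : Continuous f) : Integrable f area := by
  exact hf.integrable_of_hasCompactSupport (HasCompactSupport.of_compactSpace f)

/-- The integral of a derivative over the torus vanishes. -/
lemma IsTest.integral_pderiv {φ : Torus → ℝ} (hφ : IsTest φ) (i : Fin 2) :
    ∫ p, Thermohaline.pderiv i φ p ∂area = 0 := by
  have hc := (hφ.pderiv i).continuous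
  obtain ⟨C, hC⟩ := isCompact_univ.exists_bound_of_continuousOn hc.continuousOn
  have hm : ∀ {χ : Torus → ℝ}, Continuous χ → ∀ s : ℝ,
      Integrable (fun p : Torus => χ (p + Pi.single i (s : UnitAddCircle))) area := by
    intro χ hχ s
    apply integrable_of_continuous
    exact hχ.comp (continuous_id.add continuous_const)
  let F : ℝ → Torus → ℝ := fun s p => φ (p + Pi.single i (s : UnitAddCircle))
  let F' : ℝ → Torus → ℝ :=
    fun s p => Thermohaline.pderiv i φ (p + Pi.single i (s : UnitAddCircle))
  have h1 : ∀ s, Integrable (F s) area := hm hφ.continuous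
  have h1' : ∀ s, Integrable (F' s) area := hm hc
  have h3 : ∀ᵐ p ∂area, ∀ s ∈ (univ : Set ℝ), ‖F' s p‖ ≤ C :=
    ae_of_all _ fun p s _ => hC _ (mem_univ _)
  have h4 : ∀ᵐ p ∂area, ∀ s ∈ (univ : Set ℝ), HasDerivAt (fun x => F x p) (F' s p) s :=
    ae_of_all _ fun p s _ => hφ.hasDerivAt i p s
  have h := hasDerivAt_integral_of_dominated_loc_of_deriv_le (μ := area) (𝕜 := ℝ) (x₀ := (0 : ℝ))
    (s := univ) (bound := fun _ => C) (F := F) (F' := F') univ_mem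
    (Eventually.of_forall fun s => (h1 s).aestronglyMeasurable) (h1 0)
    (h1' 0).aestronglyMeasurable h3 (integrable_const _) h4
  have h2 := h.2
  -- Translation invariance makes the integral of the translates constant, while its derivative is
  -- the integral of the partial derivative.
  have e1 : (fun s => ∫ p, F s p ∂area) = fun _ => ∫ p, φ p ∂area := by
    ext s
    exact integral_add_right_eq_self (μ := area) φ (Pi.single i (s : UnitAddCircle))
  have e2 : ∫ p, F' 0 p ∂area = ∫ p, Thermohaline.pderiv i φ p ∂area :=
    integral_add_right_eq_self (μ := area) (Thermohaline.pderiv i φ) _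
  rw [e1, e2] at h2
  exact h2.unique (hasDerivAt_const 0 _)

/-! ### Fourier coefficients -/

/-- The Fourier coefficients of a function on the torus. -/
def coef (f : Torus → ℝ) (k : Mode) : ℂ := ∫ p, mFourier (-k) p * (f p : ℂ) ∂area

/-- The symbol of the partial derivative in direction `i`. -/
def dsym (i : Fin 2) (k : Mode) : ℂ := 2 * Real.pi * Complex.I * (k i : ℂ)

/-- Real trigonometric monomials. -/
def trig (z : ℂ) (k : Mode) (p : Torus) : ℝ := (z * mFourier k p).re

lemma mFourier_toTorus (k : Mode) (x : Fin 2 → ℝ) :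
    mFourier k (toTorus x) = Complex.exp (dsym 0 k * x 0 + dsym 1 k * x 1) := by
  rw [Complex.exp_add]
  simp [mFourier, toTorus, dsym, Fin.prod_univ_two]

lemma norm_mFourier (k : Mode) (p : Torus) : ‖mFourier k p‖ = 1 := by
  simp only [mFourier, ContinuousMap.coe_mk, norm_prod, fourier_apply, Circle.norm_coe,
    Finset.prod_const_one]

lemma isTest_trig (z : ℂ) (k : Mode) : IsTest (trig z k) := by
  rw [isTest_iff]
  have : trig z k ∘ toTorus
      = fun x => Complex.reCLM (z * Complex.exp (dsym 0 k * x 0 + dsym 1 k * x 1)) := by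
    ext x; simp [trig, mFourier_toTorus]
  rw [this]
  refine Complex.reCLM.contDiff.comp (contDiff_const.mul (ContDiff.cexp (ContDiff.add ?_ ?_)))
  · exact contDiff_const.mul (Complex.ofRealCLM.contDiff.comp (contDiff_apply ℝ ℝ 0))
  · exact contDiff_const.mul (Complex.ofRealCLM.contDiff.comp (contDiff_apply ℝ ℝ 1))

lemma mFourier_toTorus_add_single (k : Mode) (x : Fin 2 → ℝ) (i : Fin 2) (s : ℝ) :
    mFourier k (toTorus x + Pi.single i (s : UnitAddCircle))
      = mFourier k (toTorus x) * Complex.exp (dsym i k * s) := by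
  rw [toTorus_add_single, mFourier_toTorus, mFourier_toTorus, ← Complex.exp_add]
  congr 1
  fin_cases i <;> simp <;> ring

lemma pderiv_trig (z : ℂ) (k : Mode) (i : Fin 2) :
    pderiv i (trig z k) = trig (dsym i k * z) k := by
  ext p
  obtain ⟨x, rfl⟩ := exists_toTorus p
  unfold pderiv trig
  simp only [mFourier_toTorus_add_single]
  have h1 : HasDerivAt (fun s : ℝ => dsym i k * (s : ℂ)) (dsym i k) 0 := by
    simpa using (Complex.ofRealCLM.hasDerivAt (x := (0 : ℝ))).const_mul (dsym i k)
  have h2 := Complex.reCLM.hasFDerivAt.comp_hasDerivAt (0 : ℝ)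
    (((h1.cexp).const_mul (mFourier k (toTorus x))).const_mul z)
  have h3 := h2.deriv
  simp only [Complex.ofReal_zero, mul_zero, Complex.exp_zero, one_mul, Complex.reCLM_apply] at h3
  refine h3.trans ?_
  congr 1
  ring

lemma iterate_pderiv_trig (z : ℂ) (k : Mode) (i : Fin 2) (n : ℕ) :
    (pderiv i)^[n] (trig z k) = trig (dsym i k ^ n * z) k := by
  induction n with
  | zero => simp
  | succ n ih => rw [Function.iterate_succ_apply', ih, pderiv_trig, pow_succ', mul_assoc]

lemma dsym_sq_add (k : Mode) : dsym 0 k ^ 2 + dsym 1 k ^ 2 = -(eig k : ℂ) := by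
  simp only [dsym, eig]
  push_cast
  have := Complex.I_sq
  linear_combination (4 * (Real.pi : ℂ) ^ 2 * ((k 0 : ℂ) ^ 2 + (k 1 : ℂ) ^ 2)) * this

lemma testLaplacian_trig (z : ℂ) (k : Mode) :
    testLaplacian (trig z k) = trig (-(eig k : ℂ) * z) k := by
  ext p
  simp only [testLaplacian, pderiv_trig, trig]
  rw [← Complex.add_re]
  congr 1
  linear_combination (z * mFourier k p) * dsym_sq_add k

lemma integrable_mFourier_mul (k : Mode) {f : Torus → ℝ} (hf : Integrable f area) :
    Integrable (fun p => mFourier k p * (f p : ℂ)) area :=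
  Integrable.bdd_mul (c := 1) hf.ofReal (mFourier k).continuous.aestronglyMeasurable
    (ae_of_all _ fun p => (norm_mFourier k p).le)

lemma integral_mul_trig {f : Torus → ℝ} (hf : Integrable f area) (z : ℂ) (k : Mode) :
    ∫ p, f p * trig z (-k) p ∂area = (z * coef f k).re := by
  rw [coef, ← integral_const_mul]
  have h := integral_re (𝕜 := ℂ) ((integrable_mFourier_mul (-k) hf).const_mul z)
  simp only [RCLike.re_to_complex] at h
  rw [← h]
  refine integral_congr_ae (ae_of_all _ fun p => ?_)
  simp only [trig]
  rw [mul_comm (f p), ← Complex.re_mul_ofReal, mul_assoc]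

/-- Test functions are real, so testing with `trig z (-k)` reveals only `Re (z * coef f k)`; the
choices `1` and `-I` recover both parts of the coefficient. -/
lemma coef_eq_of_re {x y : ℂ} (h : ∀ z : ℂ, (z * x).re = (z * y).re) : x = y := by
  have h1 := h 1
  have h2 := h (-Complex.I)
  apply Complex.ext
  · simpa using h1
  · simpa using h2

lemma coef_zero (f : Torus → ℝ) : coef f 0 = (∫ p, f p ∂area : ℝ) := by
  simp [coef, mFourier_zero, integral_complex_ofReal]

lemma coef_congr_ae {f g : Torus → ℝ} (h : f =ᵐ[area] g) : coef f = coef g := by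
  ext k
  refine integral_congr_ae ?_
  filter_upwards [h] with p hp
  simp [hp]

lemma hermitian_coef (f : Torus → ℝ) : Hermitian (coef f) := fun k => by
  rw [coef, coef, ← integral_conj]
  refine integral_congr_ae (ae_of_all _ fun p => ?_)
  simp [mFourier_neg]

lemma coef_add {f g : Torus → ℝ} (hf : Integrable f area) (hg : Integrable g area) (k : Mode) :
    coef (fun p => f p + g p) k = coef f k + coef g k := by
  rw [coef, coef, coef, ← integral_add (integrable_mFourier_mul _ hf)
    (integrable_mFourier_mul _ hg)]
  refine integral_congr_ae (ae_of_all _ fun p => ?_)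
  simp only [Complex.ofReal_add]; ring

lemma coef_sub {f g : Torus → ℝ} (hf : Integrable f area) (hg : Integrable g area) (k : Mode) :
    coef (fun p => f p - g p) k = coef f k - coef g k := by
  rw [coef, coef, coef, ← integral_sub (integrable_mFourier_mul _ hf)
    (integrable_mFourier_mul _ hg)]
  refine integral_congr_ae (ae_of_all _ fun p => ?_)
  simp only [Complex.ofReal_sub]; ring

lemma norm_coef_le (f : Torus → ℝ) (k : Mode) :
    ‖coef f k‖ ≤ ∫ p, ‖f p‖ ∂area := by
  refine (norm_integral_le_integral_norm _).trans (le_of_eq ?_)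
  refine integral_congr_ae (ae_of_all _ fun p => ?_)
  simp [norm_mFourier]

/-- Integration by parts against a real trigonometric monomial: the integral of the derivative of
the product vanishes. -/
lemma IsTest.coef_pderiv {φ : Torus → ℝ} (hφ : IsTest φ) (i : Fin 2) (k : Mode) :
    coef (Thermohaline.pderiv i φ) k = dsym i k * coef φ k := by
  refine coef_eq_of_re fun z => ?_
  have ht := isTest_trig z (-k)
  have hi : ∀ {χ : Torus → ℝ}, IsTest χ → Integrable χ area := fun h =>
    integrable_of_continuous h.continuous
  have h := (hφ.mul ht).integral_pderiv i
  have hneg : dsym i (-k) = -dsym i k := by simp [dsym]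
  simp only [hφ.pderiv_mul ht i, pderiv_trig, hneg] at h
  rw [integral_add (hi ((hφ.pderiv i).mul ht)) (hi (hφ.mul (isTest_trig _ _))),
    integral_mul_trig (hi (hφ.pderiv i)), integral_mul_trig (hi hφ)] at h
  have h2 : (-dsym i k * z * coef φ k).re = -(z * (dsym i k * coef φ k)).re := by
    rw [← Complex.neg_re]; congr 1; ring
  rw [h2] at h
  linarith

lemma IsTest.coef_iterate_pderiv {φ : Torus → ℝ} (hφ : IsTest φ) (i : Fin 2) (n : ℕ) (k : Mode) :
    coef ((Thermohaline.pderiv i)^[n] φ) k = dsym i k ^ n * coef φ k := by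
  induction n with
  | zero => simp
  | succ n ih =>
    rw [Function.iterate_succ_apply', (hφ.iterate_pderiv i n).coef_pderiv, ih, pow_succ', mul_assoc]

lemma IsTest.integrable {φ : Torus → ℝ} (hφ : IsTest φ) : Integrable φ area :=
  integrable_of_continuous hφ.continuous

lemma IsTest.coef_testLaplacian {φ : Torus → ℝ} (hφ : IsTest φ) (k : Mode) :
    coef (Thermohaline.testLaplacian φ) k = -(eig k : ℂ) * coef φ k := by
  have h := coef_add ((hφ.pderiv 0).pderiv 0).integrable ((hφ.pderiv 1).pderiv 1).integrable k
  rw [(hφ.pderiv 0).coef_pderiv, (hφ.pderiv 1).coef_pderiv, hφ.coef_pderiv, hφ.coef_pderiv] at h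
  refine h.trans ?_
  linear_combination coef φ k * dsym_sq_add k

/-- The Fourier series of a test function converges absolutely. -/
lemma IsTest.summable_norm_coef {φ : Torus → ℝ} (hφ : IsTest φ) :
    Summable fun k => ‖coef φ k‖ := by
  -- Two Laplacians give the decay `eig⁻²` of the coefficients, which is summable.
  set χ := Thermohaline.testLaplacian (Thermohaline.testLaplacian φ) with hχ
  refine Summable.of_norm_bounded_eventually
    (summable_inv_eig_sq.mul_left (∫ p, ‖χ p‖ ∂area)) ?_
  filter_upwards [(Set.finite_singleton (0 : Mode)).compl_mem_cofinite] with k hk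
  have hk0 : k ≠ 0 := by simpa using hk
  have he := eig_pos hk0
  have h1 := norm_coef_le χ k
  rw [hφ.testLaplacian.coef_testLaplacian, hφ.coef_testLaplacian, norm_mul, norm_mul, norm_neg,
    Complex.norm_real, Real.norm_eq_abs, abs_of_pos he] at h1
  rw [norm_norm, ← div_eq_mul_inv, le_div_iff₀ (by positivity)]
  linarith

lemma IsTest.summable_eig_mul_norm_coef {φ : Torus → ℝ} (hφ : IsTest φ) :
    Summable fun k => eig k * ‖coef φ k‖ := by
  refine hφ.testLaplacian.summable_norm_coef.congr fun k => ?_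
  rw [hφ.coef_testLaplacian, norm_mul, norm_neg, Complex.norm_real, Real.norm_eq_abs,
    abs_of_nonneg (eig_nonneg k)]

/-- Pairing of an integrable function with a test function. -/
lemma IsTest.hasSum_pairing {φ f : Torus → ℝ} (hφ : IsTest φ) (hf : Integrable f area) :
    HasSum (fun k => coef φ k * coef f (-k)) ((∫ p, f p * φ p ∂area : ℝ) : ℂ) := by
  let Φ : C(Torus, ℂ) := ⟨fun p => (φ p : ℂ), Complex.continuous_ofReal.comp hφ.continuous⟩
  have hΦ : ∀ k, mFourierCoeff Φ k = coef φ k := fun k => rfl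
  have hs : Summable (mFourierCoeff Φ) := by
    refine Summable.of_norm ?_
    simpa only [hΦ] using hφ.summable_norm_coef
  have hpt := hasSum_mFourier_series_apply_of_summable hs
  have h := hasSum_integral_of_summable_integral_norm (μ := area)
    (F := fun k p => coef φ k * (mFourier k p * (f p : ℂ)))
    (fun k => (integrable_mFourier_mul k hf).const_mul _)
    (by
      simp only [norm_mul, norm_mFourier, one_mul, integral_const_mul]
      exact hφ.summable_norm_coef.mul_right _)
  have h1 : ∀ k, ∫ p, coef φ k * (mFourier k p * (f p : ℂ)) ∂area = coef φ k * coef f (-k) :=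
    fun k => by
      rw [integral_const_mul]
      simp only [coef, neg_neg]
  have h2 : ∫ p, ∑' k, coef φ k * (mFourier k p * (f p : ℂ)) ∂area
      = ((∫ p, f p * φ p ∂area : ℝ) : ℂ) := by
    rw [← integral_complex_ofReal]
    refine integral_congr_ae (ae_of_all _ fun p => ?_)
    have h3 : HasSum (fun k => coef φ k * (mFourier k p * (f p : ℂ))) ((φ p : ℂ) * f p) := by
      simpa only [hΦ, smul_eq_mul, mul_assoc] using! (hpt p).mul_right (f p : ℂ)
    simp only [h3.tsum_eq]
    push_cast; ring
  simpa only [h1, h2] using h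

end Thermohaline

end

noncomputable section

namespace Thermohaline

open scoped ComplexConjugate Topology
open Filter UnitAddTorus

/-! ### Square-integrable functions and their Fourier coefficients -/

lemma integrable_L2 (u : L2) : Integrable u area :=
  (Lp.memLp u).integrable (by norm_num)

lemma integrable_L2_mul (u v : L2) : Integrable (fun p => u p * v p) area :=
  (Lp.memLp u).integrable_mul (Lp.memLp v)

/-- A real function regarded as a complex one. -/
def cplx (u : L2) : Lp ℂ 2 area := Complex.ofRealCLM.compLp u

lemma coeFn_cplx (u : L2) : cplx u =ᵐ[area] fun p => (u p : ℂ) :=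
  Complex.ofRealCLM.coeFn_compLp u

lemma repr_cplx (u : L2) (k : Mode) : mFourierBasis.repr (cplx u) k = coef u k := by
  rw [mFourierBasis_repr]
  refine integral_congr_ae ?_
  filter_upwards [coeFn_cplx u] with p hp
  simp [hp]

lemma hasSum_conj_coef_mul (u : L2) (g : Lp ℂ 2 area) :
    HasSum (fun k => conj (coef u k) * mFourierBasis.repr g k) (∫ p, (u p : ℂ) * g p ∂area) := by
  have h := hasSum_prod_mFourierCoeff (cplx u) g
  have h1 : ∀ k, mFourierCoeff (cplx u) k = coef u k := fun k => by
    rw [← mFourierBasis_repr, repr_cplx]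
  have h2 : ∫ p, conj (cplx u p) * g p ∂area = ∫ p, (u p : ℂ) * g p ∂area := by
    refine integral_congr_ae ?_
    filter_upwards [coeFn_cplx u] with p hp
    simp [hp]
  simp only [h1, ← mFourierBasis_repr] at h
  rw [← h2]
  exact h

/-- Parseval's identity. -/
lemma hasSum_norm_coef_sq (u : L2) : HasSum (fun k => ‖coef u k‖ ^ 2) (‖u‖ ^ 2) := by
  have h := hasSum_conj_coef_mul u (cplx u)
  have h1 : ∫ p, (u p : ℂ) * cplx u p ∂area = ((‖u‖ ^ 2 : ℝ) : ℂ) := by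
    rw [← real_inner_self_eq_norm_sq, L2.inner_def, ← integral_complex_ofReal]
    refine integral_congr_ae ?_
    filter_upwards [coeFn_cplx u] with p hp
    simp [hp, sq]
  rw [h1] at h
  simp only [repr_cplx, ← Complex.normSq_eq_conj_mul_self, Complex.normSq_eq_norm_sq] at h
  exact_mod_cast h

lemma norm_sq_eq_tsum (u : L2) : ‖u‖ ^ 2 = ∑' k, ‖coef u k‖ ^ 2 :=
  (hasSum_norm_coef_sq u).tsum_eq.symm

lemma coef_L2_add (u v : L2) (k : Mode) : coef (u + v : L2) k = coef u k + coef v k := by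
  rw [coef_congr_ae (Lp.coeFn_add u v), ← coef_add (integrable_L2 u) (integrable_L2 v)]
  rfl

lemma coef_L2_sub (u v : L2) (k : Mode) : coef (u - v : L2) k = coef u k - coef v k := by
  rw [coef_congr_ae (Lp.coeFn_sub u v), ← coef_sub (integrable_L2 u) (integrable_L2 v)]
  rfl

lemma coef_injective {u v : L2} (h : coef u = coef v) : u = v := by
  rw [← sub_eq_zero, ← norm_eq_zero, ← sq_eq_zero_iff, norm_sq_eq_tsum]
  refine (tsum_congr fun k => ?_).trans tsum_zero
  rw [coef_L2_sub, h, sub_self, norm_zero, zero_pow two_ne_zero]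

lemma norm_coef_sub_le (u v : L2) (k : Mode) : ‖coef u k - coef v k‖ ≤ ‖u - v‖ := by
  rw [← coef_L2_sub]
  have h := (hasSum_norm_coef_sq (u - v)).summable.le_tsum k fun j _ => sq_nonneg _
  rw [← norm_sq_eq_tsum] at h
  exact (sq_le_sq₀ (norm_nonneg _) (norm_nonneg _)).1 h

/-- The Riesz–Fischer theorem. -/
lemma exists_coef_eq {c : Mode → ℂ} (hc : Hermitian c) (h2 : FinEnergy 0 c) :
    ∃ u : L2, coef u = c := by
  have hm : Memℓp c 2 := by
    refine memℓp_gen ?_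
    simpa using h2.norm_sq
  let f : Lp ℂ 2 area := mFourierBasis.repr.symm ⟨c, hm⟩
  have hf : ∀ k, ∫ p, mFourier (-k) p * f p ∂area = c k := fun k => by
    have h := mFourierBasis_repr f k
    rw [LinearIsometryEquiv.apply_symm_apply] at h
    exact h.symm
  have hfi : Integrable f area := (Lp.memLp f).integrable (by norm_num)
  have hb : ∀ (k : Mode) {g : Torus → ℂ}, Integrable g area →
      Integrable (fun p => mFourier k p * g p) area := fun k g hg =>
    Integrable.bdd_mul (c := 1) hg (mFourier k).continuous.aestronglyMeasurable
      (ae_of_all _ fun p => (norm_mFourier k p).le)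
  have hci : Integrable (fun p => conj (f p)) area :=
    (Complex.conjCLE : ℂ →L[ℝ] ℂ).integrable_comp hfi
  -- For Hermitian `c` the conjugate of `f` has the same coefficients as `f`, hence so has its real
  -- part.
  refine ⟨Complex.reCLM.compLp f, funext fun k => ?_⟩
  have h1 : coef (Complex.reCLM.compLp f : L2) k
      = ∫ p, (1 / 2 : ℂ) * (mFourier (-k) p * f p + mFourier (-k) p * conj (f p)) ∂area := by
    refine integral_congr_ae ?_
    filter_upwards [Complex.reCLM.coeFn_compLp f] with p hp
    rw [hp, Complex.reCLM_apply, Complex.re_eq_add_conj]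
    ring
  have h3 : ∫ p, mFourier (-k) p * conj (f p) ∂area = c k := by
    have h4 : conj (c (-k)) = c k := by rw [hc k, Complex.conj_conj]
    rw [← h4, ← hf (-k), ← integral_conj]
    refine integral_congr_ae (ae_of_all _ fun p => ?_)
    simp [mFourier_neg]
  rw [h1, integral_const_mul, integral_add (hb _ hfi) (hb _ hci), hf, h3]
  ring

/-- The Fourier coefficients of a product. -/
lemma hasSum_coef_mul (u v : L2) (k : Mode) :
    HasSum (fun l => coef u l * coef v (k - l)) (coef (fun p => u p * v p) k) := by
  have hm : MemLp (fun p => mFourier (-k) p * (v p : ℂ)) 2 area := by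
    refine MemLp.of_le (Lp.memLp v) (AEStronglyMeasurable.mul
      (mFourier (-k)).continuous.aestronglyMeasurable
      (Complex.continuous_ofReal.comp_aestronglyMeasurable (Lp.aestronglyMeasurable v)))
      (ae_of_all _ fun p => ?_)
    simp [norm_mFourier]
  -- A coefficient of the product is the inner product of `u` with the modulated function `e_{-k}
  -- v`, whose coefficients are those of `v` shifted by `k`; the sign of the index is then reversed.
  have h := hasSum_conj_coef_mul u (hm.toLp _)
  have h1 : ∀ l, mFourierBasis.repr (hm.toLp _) l = coef v (k + l) := fun l => by
    rw [mFourierBasis_repr]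
    refine integral_congr_ae ?_
    filter_upwards [hm.coeFn_toLp] with p hp
    rw [hp, neg_add_rev, mFourier_add, smul_eq_mul, mul_assoc]
  have h2 : ∫ p, (u p : ℂ) * hm.toLp _ p ∂area = coef (fun p => u p * v p) k := by
    refine integral_congr_ae ?_
    filter_upwards [hm.coeFn_toLp] with p hp
    rw [hp]; push_cast; ring
  rw [h2] at h
  simp only [h1, ← hermitian_coef _ _] at h
  rw [← (Equiv.neg Mode).hasSum_iff] at h
  simpa [Function.comp_def, ← sub_eq_add_neg] using h

/-! ### Weak derivatives -/

/-- The symbol of `∂ₓ^a ∂_z^b`. -/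
def msym (a b : ℕ) (k : Mode) : ℂ := dsym 0 k ^ a * dsym 1 k ^ b

lemma dsym_neg (i : Fin 2) (k : Mode) : dsym i (-k) = -dsym i k := by simp [dsym]

lemma msym_neg (a b : ℕ) (k : Mode) : msym a b (-k) = (-1) ^ (a + b) * msym a b k := by
  rw [msym, msym, dsym_neg, dsym_neg, neg_pow, neg_pow (dsym 1 k), pow_add]
  ring

lemma conj_dsym (i : Fin 2) (k : Mode) : conj (dsym i k) = -dsym i k := by
  simp [dsym, Complex.conj_ofNat]

lemma conj_msym (a b : ℕ) (k : Mode) : conj (msym a b k) = msym a b (-k) := by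
  simp only [msym, map_mul, map_pow, conj_dsym, dsym_neg]

lemma eig_eq_norm_dsym (k : Mode) : eig k = ‖dsym 0 k‖ ^ 2 + ‖dsym 1 k‖ ^ 2 := by
  have h : ∀ i, ‖dsym i k‖ = 2 * Real.pi * |(k i : ℝ)| := fun i => by
    simp [dsym, abs_of_pos Real.pi_pos]
  rw [h, h, mul_pow _ |_|, mul_pow _ |_|, sq_abs, sq_abs, eig]
  ring

lemma norm_msym_sq (a b : ℕ) (k : Mode) :
    ‖msym a b k‖ ^ 2 = (‖dsym 0 k‖ ^ 2) ^ a * (‖dsym 1 k‖ ^ 2) ^ b := by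
  rw [msym, norm_mul, norm_pow, norm_pow]; ring

lemma norm_msym_sq_le (a b : ℕ) (k : Mode) : ‖msym a b k‖ ^ 2 ≤ eig k ^ (a + b) := by
  rw [norm_msym_sq, pow_add, eig_eq_norm_dsym]
  have h0 := sq_nonneg ‖dsym 0 k‖
  have h1 := sq_nonneg ‖dsym 1 k‖
  gcongr <;> linarith

/-- Trigonometric monomials are test functions, which gives one direction. For the other, a test
function has an absolutely convergent Fourier series, so the pairing can be computed mode by mode.
-/
lemma isWeakDeriv_iff {a b : ℕ} {u g : L2} :
    IsWeakDeriv a b u g ↔ ∀ k, coef g k = msym a b k * coef u k := by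
  have hsq : ((-1 : ℂ) ^ (a + b)) * (-1) ^ (a + b) = 1 := by
    rw [← mul_pow]; simp
  constructor
  · intro h k
    refine coef_eq_of_re fun z => ?_
    have h1 := h (trig z (-k)) (isTest_trig z (-k))
    rw [iterate_pderiv_trig, iterate_pderiv_trig, integral_mul_trig (integrable_L2 u),
      integral_mul_trig (integrable_L2 g), ← mul_assoc (dsym 0 (-k) ^ a)] at h1
    change (msym a b (-k) * z * coef u k).re = _ at h1
    have h2 : ((-1 : ℝ) ^ (a + b)) * ((-1 : ℝ) ^ (a + b) * (z * coef g k).re)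
        = (z * coef g k).re := by
      rw [← mul_assoc, ← mul_pow]; simp
    rw [← h2, ← h1, msym_neg]
    have h3 : (((-1 : ℝ) ^ (a + b) : ℝ) : ℂ) = (-1) ^ (a + b) := by push_cast; ring
    rw [← Complex.re_ofReal_mul, h3]
    congr 1
    linear_combination (msym a b k * z * coef u k) * hsq
  · intro h φ hφ
    have h1 := ((hφ.iterate_pderiv 1 b).iterate_pderiv 0 a).hasSum_pairing (integrable_L2 u)
    have h2 := (hφ.hasSum_pairing (integrable_L2 g)).mul_left ((-1 : ℂ) ^ (a + b))
    have h3 : (fun k => coef ((pderiv 0)^[a] ((pderiv 1)^[b] φ)) k * coef u (-k))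
        = fun k => (-1 : ℂ) ^ (a + b) * (coef φ k * coef g (-k)) := by
      ext k
      rw [(hφ.iterate_pderiv 1 b).coef_iterate_pderiv, hφ.coef_iterate_pderiv, h, msym_neg]
      rw [← mul_assoc (dsym 0 k ^ a)]
      change msym a b k * _ * _ = _
      linear_combination -(msym a b k * coef φ k * coef u (-k)) * hsq
    rw [h3] at h1
    have h4 := h1.unique h2
    exact_mod_cast h4

lemma coef_weakD {a b : ℕ} {u : L2} (h : ∃ g : L2, IsWeakDeriv a b u g) (k : Mode) :
    coef (weakD a b u) k = msym a b k * coef u k := by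
  rw [weakD, dif_pos h]
  exact isWeakDeriv_iff.1 h.choose_spec k

/-- Parseval's identity one way, the Riesz–Fischer theorem the other; the candidate coefficients are
Hermitian because the symbol is. -/
lemma exists_isWeakDeriv_iff {a b : ℕ} {u : L2} :
    (∃ g : L2, IsWeakDeriv a b u g) ↔ Summable fun k => ‖msym a b k‖ ^ 2 * ‖coef u k‖ ^ 2 := by
  constructor
  · intro h
    refine (hasSum_norm_coef_sq (weakD a b u)).summable.congr fun k => ?_
    rw [coef_weakD h, norm_mul, mul_pow]
  · intro h
    obtain ⟨g, hg⟩ := exists_coef_eq (c := fun k => msym a b k * coef u k)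
      (fun k => by simp only [map_mul, conj_msym, hermitian_coef (u : Torus → ℝ) k])
      (by simpa [FinEnergy, mul_pow] using h)
    exact ⟨g, isWeakDeriv_iff.2 fun k => congrFun hg k⟩

lemma norm_weakD_sq {a b : ℕ} {u : L2} (h : ∃ g : L2, IsWeakDeriv a b u g) :
    ‖weakD a b u‖ ^ 2 = ∑' k, ‖msym a b k‖ ^ 2 * ‖coef u k‖ ^ 2 := by
  rw [norm_sq_eq_tsum]
  simp only [coef_weakD h, norm_mul, mul_pow]

/-! ### Sobolev spaces -/

/-- The binomial theorem for the sum of the two squared symbols. It expresses `energy n` through the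
derivatives of order exactly `n`. -/
lemma eig_pow_eq (n : ℕ) (k : Mode) :
    eig k ^ n = ∑ m ∈ Finset.HasAntidiagonal.antidiagonal n, (n.choose m.1 : ℝ) * ‖msym m.1 m.2 k‖ ^ 2 := by
  rw [eig_eq_norm_dsym, (Commute.all _ _).add_pow']
  simp only [norm_msym_sq, nsmul_eq_mul]

/-- Derivatives of top order control `energy n` by the binomial formula. Conversely, zero mean and
the Poincaré inequality recover all lower orders from `energy n`. -/
lemma memHper0_iff {n : ℕ} {u : L2} :
    MemHper0 n u ↔ coef u 0 = 0 ∧ FinEnergy n (coef u) := by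
  have h0 : ∫ p, u p ∂area = 0 ↔ coef u 0 = 0 := by rw [coef_zero]; norm_cast
  rw [MemHper0, h0]
  refine and_congr_right fun hu => ⟨fun h => ?_, fun h a b hab => ?_⟩
  · have h1 : Summable fun k => ∑ m ∈ Finset.HasAntidiagonal.antidiagonal n,
        (n.choose m.1 : ℝ) * (‖msym m.1 m.2 k‖ ^ 2 * ‖coef u k‖ ^ 2) := by
      refine summable_sum fun m hm => Summable.mul_left _ ?_
      exact exists_isWeakDeriv_iff.1 (h m.1 m.2 (Finset.HasAntidiagonal.mem_antidiagonal.1 hm).le)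
    refine h1.congr fun k => ?_
    rw [eig_pow_eq, Finset.sum_mul]
    exact Finset.sum_congr rfl fun m _ => by ring
  · rw [exists_isWeakDeriv_iff]
    refine Summable.of_nonneg_of_le (fun k => by positivity) (fun k => ?_) (h.mono hu hab)
    exact mul_le_mul_of_nonneg_right (norm_msym_sq_le a b k) (sq_nonneg _)

lemma MemHper0.coef_zero {n : ℕ} {u : L2} (h : MemHper0 n u) : coef u 0 = 0 :=
  (memHper0_iff.1 h).1

lemma MemHper0.finEnergy {n : ℕ} {u : L2} (h : MemHper0 n u) : FinEnergy n (coef u) :=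
  (memHper0_iff.1 h).2

lemma MemHper0.mono {m n : ℕ} {u : L2} (h : MemHper0 n u) (hmn : m ≤ n) : MemHper0 m u :=
  ⟨h.1, fun a b hab => h.2 a b (hab.trans hmn)⟩

lemma MemHper0.norm_weakD_sq_le {n : ℕ} {u : L2} (h : MemHper0 n u) {a b : ℕ} (hab : a + b ≤ n) :
    ‖weakD a b u‖ ^ 2 ≤ energy n (coef u) := by
  have hw := h.2 a b hab
  rw [norm_weakD_sq hw]
  refine (exists_isWeakDeriv_iff.1 hw).tsum_le_tsum (fun k => ?_) h.finEnergy
  exact (mul_le_mul_of_nonneg_right (norm_msym_sq_le a b k) (sq_nonneg _)).trans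
    (eig_pow_mul_le h.coef_zero hab k)

lemma sobolevNorm_sq (n : ℕ) (u : L2) :
    sobolevNorm n u ^ 2 = ∑ ab ∈ (Finset.range (n + 1) ×ˢ Finset.range (n + 1)).filter
      (fun ab => ab.1 + ab.2 ≤ n), ‖weakD ab.1 ab.2 u‖ ^ 2 :=
  Real.sq_sqrt (Finset.sum_nonneg fun _ _ => sq_nonneg _)

lemma MemHper0.sobolevNorm_sq_le {n : ℕ} {u : L2} (h : MemHper0 n u) :
    sobolevNorm n u ^ 2 ≤ (n + 1) ^ 2 * energy n (coef u) := by
  rw [sobolevNorm_sq]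
  refine (Finset.sum_le_card_nsmul _ _ (energy n (coef u)) fun ab hab => ?_).trans ?_
  · exact h.norm_weakD_sq_le (Finset.mem_filter.1 hab).2
  · rw [nsmul_eq_mul]
    refine mul_le_mul_of_nonneg_right ?_ (energy_nonneg _ _)
    have := Finset.card_filter_le (Finset.range (n + 1) ×ˢ Finset.range (n + 1))
      (fun ab => ab.1 + ab.2 ≤ n)
    rw [Finset.card_product, Finset.card_range, ← sq] at this
    exact_mod_cast this

lemma MemHper0.energy_le {n : ℕ} {u : L2} (h : MemHper0 n u) :
    energy n (coef u) ≤ 2 ^ n * sobolevNorm n u ^ 2 := by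
  have hs : ∀ m ∈ Finset.HasAntidiagonal.antidiagonal n, Summable fun k =>
      (n.choose m.1 : ℝ) * (‖msym m.1 m.2 k‖ ^ 2 * ‖coef u k‖ ^ 2) := fun m hm =>
    (exists_isWeakDeriv_iff.1 (h.2 m.1 m.2 (Finset.HasAntidiagonal.mem_antidiagonal.1 hm).le)).mul_left _
  have h1 : energy n (coef u) = ∑ m ∈ Finset.HasAntidiagonal.antidiagonal n,
      (n.choose m.1 : ℝ) * ‖weakD m.1 m.2 u‖ ^ 2 := by
    calc energy n (coef u) = ∑' k, ∑ m ∈ Finset.HasAntidiagonal.antidiagonal n,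
          (n.choose m.1 : ℝ) * (‖msym m.1 m.2 k‖ ^ 2 * ‖coef u k‖ ^ 2) := by
          refine tsum_congr fun k => ?_
          rw [eig_pow_eq, Finset.sum_mul]
          exact Finset.sum_congr rfl fun m _ => by ring
      _ = _ := by
          rw [Summable.tsum_finsetSum hs]
          refine Finset.sum_congr rfl fun m hm => ?_
          rw [tsum_mul_left, norm_weakD_sq (h.2 m.1 m.2 (Finset.HasAntidiagonal.mem_antidiagonal.1 hm).le)]
  rw [h1, sobolevNorm_sq, Finset.mul_sum]
  calc _ ≤ ∑ m ∈ Finset.HasAntidiagonal.antidiagonal n, (2 : ℝ) ^ n * ‖weakD m.1 m.2 u‖ ^ 2 := by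
        refine Finset.sum_le_sum fun m _ => mul_le_mul_of_nonneg_right ?_ (sq_nonneg _)
        exact_mod_cast Nat.choose_le_two_pow n m.1
    _ ≤ _ := by
        refine Finset.sum_le_sum_of_subset_of_nonneg (fun m hm => ?_) fun _ _ _ => by positivity
        have := Finset.HasAntidiagonal.mem_antidiagonal.1 hm
        simp only [Finset.mem_filter, Finset.mem_product, Finset.mem_range]
        omega

lemma MemHper0.gradNorm_eq {u : L2} (h : MemHper0 1 u) :
    gradNorm u = Real.sqrt (energy 1 (coef u)) := by
  have h1 := h.2 1 0 le_rfl
  have h2 := h.2 0 1 le_rfl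
  rw [gradNorm, norm_weakD_sq h1, norm_weakD_sq h2, ← Summable.tsum_add
    (exists_isWeakDeriv_iff.1 h1) (exists_isWeakDeriv_iff.1 h2)]
  congr 1
  refine tsum_congr fun k => ?_
  rw [norm_msym_sq, norm_msym_sq, eig_eq_norm_dsym]
  ring

lemma MemHper0.coef_lap {u : L2} (h : MemHper0 2 u) (k : Mode) :
    coef (lap u) k = -(eig k : ℂ) * coef u k := by
  rw [lap, coef_L2_add, coef_weakD (h.2 2 0 le_rfl), coef_weakD (h.2 0 2 le_rfl), ← dsym_sq_add,
    msym, msym]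
  ring

lemma MemHper0.stream_coef_lap {u : L2} (h : MemHper0 2 u) : stream (coef (lap u)) = coef u := by
  ext k
  by_cases hk : k = 0
  · rw [hk, stream_zero, h.coef_zero]
  · have : (eig k : ℂ) ≠ 0 := by exact_mod_cast eig_ne_zero hk
    rw [stream, h.coef_lap]
    field_simp

lemma MemHper0.coef_lap_zero {u : L2} (h : MemHper0 2 u) : coef (lap u) 0 = 0 := by
  rw [h.coef_lap]; simp

lemma MemHper0.lap {n : ℕ} {u : L2} (h : MemHper0 (n + 2) u) : MemHper0 n (lap u) := by
  have h2 := h.mono (m := 2) (by omega)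
  rw [memHper0_iff]
  refine ⟨h2.coef_lap_zero, ?_⟩
  rw [← finEnergy_stream h2.coef_lap_zero, h2.stream_coef_lap]
  exact h.finEnergy

lemma integrable_jacobian (u v : L2) : Integrable (jacobian u v) area :=
  (integrable_L2_mul _ _).sub (integrable_L2_mul _ _)

/-- Subtracting the two convolutions leaves the symbol `(2πi)² (l₀(k₁ - l₁) - l₁(k₀ - l₀))`, in
which the terms quadratic in `l` cancel; the sign in `adv` is `i²`. -/
lemma coef_jacobian {u v : L2} (hu : MemHper0 1 u) (hv : MemHper0 1 v) (k : Mode) :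
    coef (jacobian u v) k = adv (coef u) (coef v) k := by
  have h := (hasSum_coef_mul (weakD 1 0 u) (weakD 0 1 v) k).sub
    (hasSum_coef_mul (weakD 0 1 u) (weakD 1 0 v) k)
  rw [← coef_sub (integrable_L2_mul _ _) (integrable_L2_mul _ _)] at h
  change HasSum _ (coef (jacobian u v) k) at h
  rw [← h.tsum_eq, adv, ← tsum_neg]
  refine tsum_congr fun l => ?_
  rw [coef_weakD (hu.2 1 0 le_rfl), coef_weakD (hu.2 0 1 le_rfl), coef_weakD (hv.2 1 0 le_rfl),
    coef_weakD (hv.2 0 1 le_rfl)]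
  simp only [msym, dsym, cross, Pi.sub_apply, pow_one, pow_zero, one_mul, mul_one]
  push_cast
  linear_combination (4 * Real.pi ^ 2 * ((l 0 : ℂ) * (k 1) - (l 1 : ℂ) * (k 0)) *
    coef u l * coef v (k - l)) * Complex.I_sq

end Thermohaline

end

noncomputable section

namespace Thermohaline

open scoped ComplexConjugate Topology
open Filter UnitAddTorus

/-! ### Solutions in terms of Fourier coefficients -/

lemma continuous_coef (k : Mode) : Continuous fun u : L2 => coef u k :=
  (LipschitzWith.of_dist_le_mul (K := 1) fun u v => by
    rw [dist_eq_norm, dist_eq_norm, NNReal.coe_one, one_mul]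
    exact norm_coef_sub_le u v k).continuous

lemma lintegral_energy_two_ne_top {T : ℝ} {u : ℝ → Mode → ℂ} {g : ℝ → ℝ}
    (hg : IntegrableOn g (Ioc 0 T))
    (h : ∀ᵐ t ∂(volume.restrict (Ioc 0 T)), FinEnergy 2 (u t) ∧ energy 2 (u t) ≤ g t) :
    ∫⁻ t in Ioc 0 T, ∑' k, ENNReal.ofReal (eig k ^ 2 * ‖u t k‖ ^ 2) ≠ ⊤ := by
  refine ne_top_of_le_ne_top hg.lintegral_lt_top.ne (lintegral_mono_ae ?_)
  filter_upwards [h] with t ht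
  rw [← ENNReal.ofReal_tsum_of_nonneg
    (fun k => mul_nonneg (pow_nonneg (eig_nonneg k) 2) (sq_nonneg _)) ht.1]
  exact ENNReal.ofReal_le_ofReal ht.2

lemma sobolevNorm_nonneg (n : ℕ) (u : L2) : 0 ≤ sobolevNorm n u := Real.sqrt_nonneg _

section Pairings

variable {ν κ Nsq : ℝ} {ψ ρ : L2}

/-- Monomials suffice to pass from the weak formulation to the modes; the converse passage needs all
test functions and uses `vorticity_pairing`. -/
lemma vorticity_pairing_trig (hψ : MemHper0 3 ψ) (hρ : MemHper0 1 ρ) (z : ℂ) (k : Mode) :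
    -(∫ p, jacobian (lap ψ) ψ p * trig z (-k) p ∂area)
        + ∫ p, weakD 1 0 ρ p * trig z (-k) p ∂area
        + ν * ∫ p, lap ψ p * testLaplacian (trig z (-k)) p ∂area
      = (z * rhsW ν (coef (lap ψ)) (coef ρ) k).re := by
  have h2 := hψ.mono (m := 2) (by norm_num)
  rw [testLaplacian_trig, integral_mul_trig (integrable_jacobian _ _),
    integral_mul_trig (integrable_L2 _), integral_mul_trig (integrable_L2 _),
    coef_jacobian (MemHper0.lap hψ) (hψ.mono (by norm_num)), coef_weakD (hρ.2 1 0 le_rfl), rhsW,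
    h2.stream_coef_lap, ← Complex.neg_re, ← Complex.re_ofReal_mul, ← Complex.add_re,
    ← Complex.add_re]
  congr 1
  have : msym 1 0 k = dx k := by simp [msym, dsym, dx]
  rw [this, eig_neg]
  push_cast
  ring

lemma density_pairing_trig (hψ : MemHper0 3 ψ) (hρ : MemHper0 1 ρ) (z : ℂ) (k : Mode) :
    -(∫ p, jacobian ρ ψ p * trig z (-k) p ∂area)
        - Nsq * ∫ p, weakD 1 0 ψ p * trig z (-k) p ∂area
        + κ * ∫ p, ρ p * testLaplacian (trig z (-k)) p ∂area
      = (z * rhsB κ Nsq (coef (lap ψ)) (coef ρ) k).re := by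
  have h2 := hψ.mono (m := 2) (by norm_num)
  have h1 := hψ.mono (m := 1) (by norm_num)
  rw [testLaplacian_trig, integral_mul_trig (integrable_jacobian _ _),
    integral_mul_trig (integrable_L2 _), integral_mul_trig (integrable_L2 _),
    coef_jacobian hρ h1, coef_weakD (h1.2 1 0 le_rfl), rhsB,
    h2.stream_coef_lap, ← Complex.neg_re, ← Complex.re_ofReal_mul, ← Complex.re_ofReal_mul,
    ← Complex.sub_re, ← Complex.add_re]
  congr 1
  have : msym 1 0 k = dx k := by simp [msym, dsym, dx]
  rw [this, eig_neg]
  push_cast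
  ring

lemma vorticity_pairing {φ : Torus → ℝ} (hφ : IsTest φ) (hψ : MemHper0 3 ψ) (hρ : MemHper0 1 ρ) :
    HasSum (fun k => coef φ k * rhsW ν (coef (lap ψ)) (coef ρ) (-k))
      ((-(∫ p, jacobian (lap ψ) ψ p * φ p ∂area) + ∫ p, weakD 1 0 ρ p * φ p ∂area
        + ν * ∫ p, lap ψ p * testLaplacian φ p ∂area : ℝ) : ℂ) := by
  have h2 := hψ.mono (m := 2) (by norm_num)
  have h := ((hφ.hasSum_pairing (integrable_jacobian (lap ψ) ψ)).neg.add
    (hφ.hasSum_pairing (integrable_L2 (weakD 1 0 ρ)))).add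
    ((hφ.testLaplacian.hasSum_pairing (integrable_L2 (lap ψ))).mul_left (ν : ℂ))
  push_cast
  refine h.congr_fun fun k => ?_
  have : msym 1 0 (-k) = dx (-k) := by simp [msym, dsym, dx]
  rw [coef_jacobian (MemHper0.lap hψ) (hψ.mono (by norm_num)), coef_weakD (hρ.2 1 0 le_rfl), rhsW,
    h2.stream_coef_lap, hφ.coef_testLaplacian, this, eig_neg]
  push_cast
  ring

lemma density_pairing {φ : Torus → ℝ} (hφ : IsTest φ) (hψ : MemHper0 3 ψ) (hρ : MemHper0 1 ρ) :
    HasSum (fun k => coef φ k * rhsB κ Nsq (coef (lap ψ)) (coef ρ) (-k))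
      ((-(∫ p, jacobian ρ ψ p * φ p ∂area) - Nsq * ∫ p, weakD 1 0 ψ p * φ p ∂area
        + κ * ∫ p, ρ p * testLaplacian φ p ∂area : ℝ) : ℂ) := by
  have h2 := hψ.mono (m := 2) (by norm_num)
  have h1 := hψ.mono (m := 1) (by norm_num)
  have h := ((hφ.hasSum_pairing (integrable_jacobian ρ ψ)).neg.sub
    ((hφ.hasSum_pairing (integrable_L2 (weakD 1 0 ψ))).mul_left (Nsq : ℂ))).add
    ((hφ.testLaplacian.hasSum_pairing (integrable_L2 ρ)).mul_left (κ : ℂ))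
  push_cast
  refine h.congr_fun fun k => ?_
  have : msym 1 0 (-k) = dx (-k) := by simp [msym, dsym, dx]
  rw [coef_jacobian hρ h1, coef_weakD (h1.2 1 0 le_rfl), rhsB,
    h2.stream_coef_lap, hφ.coef_testLaplacian, this, eig_neg]
  push_cast
  ring

end Pairings

lemma integral_re_mul {t : ℝ} (z : ℂ) {r : ℝ → ℂ} (hr : IntervalIntegrable r volume 0 t) :
    ∫ s in (0 : ℝ)..t, (z * r s).re = (z * ∫ s in (0 : ℝ)..t, r s).re := by
  rw [← intervalIntegral.integral_const_mul]
  exact Complex.reCLM.intervalIntegral_comp_comm (hr.const_mul z)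

variable {ν Pr Nsq : ℝ} {ψ₀ ρ₀ : L2} {ψ ρ : ℝ → L2}

lemma energy_coef_lap {u : L2} (h : MemHper0 2 u) (n : ℕ) :
    energy n (coef (lap u)) = energy (n + 2) (coef u) := by
  rw [← energy_stream h.coef_lap_zero, h.stream_coef_lap]

/-- The Fourier coefficients of a solution solve the equations mode by mode. -/
lemma IsSolution.isModeSolution (h : IsSolution ν Pr Nsq ψ₀ ρ₀ ψ ρ) (T : ℝ) :
    IsModeSolution ν (ν / Pr) Nsq T {0}ᶜ (fun t => coef (lap (ψ t))) (fun t => coef (ρ t)) := by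
  have h2 : ∀ t, 0 ≤ t → MemHper0 2 (ψ t) := fun t ht => (h.mem_psi t ht).mono (by norm_num)
  have hw0 : ∀ t ∈ Icc 0 T, coef (lap (ψ t)) 0 = 0 := fun t ht => (h2 t ht.1).coef_lap_zero
  have hcψ : ∀ k, ContinuousOn (fun t => coef (lap (ψ t)) k) (Icc 0 T) := fun k => by
    have hc := (continuous_coef k).comp_continuousOn
      (h.cont_psi.mono (Icc_subset_Ici_self : Icc 0 T ⊆ Ici 0))
    exact (continuousOn_const.mul hc).congr fun t ht => (h2 t ht.1).coef_lap k
  have hcρ : ∀ k, ContinuousOn (fun t => coef (ρ t) k) (Icc 0 T) := fun k =>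
    (continuous_coef k).comp_continuousOn (h.cont_rho.mono Icc_subset_Ici_self)
  have hbw : ∃ M, ∀ t ∈ Icc 0 T,
      FinEnergy 1 (coef (lap (ψ t))) ∧ energy 1 (coef (lap (ψ t))) ≤ M := by
    obtain ⟨M, hM⟩ := h.bdd_psi T
    refine ⟨2 ^ 3 * M ^ 2, fun t ht => ⟨(MemHper0.lap (h.mem_psi t ht.1)).finEnergy, ?_⟩⟩
    rw [energy_coef_lap (h2 t ht.1)]
    refine (h.mem_psi t ht.1).energy_le.trans ?_
    have h1 := hM t ht
    have h3 := sobolevNorm_nonneg 3 (ψ t)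
    gcongr
  have hbb : ∃ M, ∀ t ∈ Icc 0 T, FinEnergy 1 (coef (ρ t)) ∧ energy 1 (coef (ρ t)) ≤ M := by
    obtain ⟨M, hM⟩ := h.bdd_rho T
    refine ⟨2 ^ 1 * M ^ 2, fun t ht => ⟨(h.mem_rho t ht.1).finEnergy, ?_⟩⟩
    refine (h.mem_rho t ht.1).energy_le.trans ?_
    have h1 := hM t ht
    have h3 := sobolevNorm_nonneg 1 (ρ t)
    gcongr
  obtain ⟨M, hM⟩ := hbw
  obtain ⟨M', hM'⟩ := hbb
  have hA := fun t ht => And.intro (hM t ht).1 ((hM t ht).2.trans (le_max_left M M'))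
  have hB := fun t ht => And.intro (hM' t ht).1 ((hM' t ht).2.trans (le_max_right M M'))
  have hrW : ∀ k, ContinuousOn (fun t => rhsW ν (coef (lap (ψ t))) (coef (ρ t)) k) (Icc 0 T) :=
    fun k => ((continuousOn_adv hw0 hA hA hcψ hcψ k).neg.add
      (continuousOn_const.mul (hcρ k))).sub (continuousOn_const.mul (hcψ k))
  have hrB : ∀ k, ContinuousOn (fun t => rhsB (ν / Pr) Nsq (coef (lap (ψ t))) (coef (ρ t)) k)
      (Icc 0 T) := fun k => ((continuousOn_adv hw0 hA hB hcψ hcρ k).neg.sub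
      (continuousOn_const.mul (continuousOn_const.mul ((hcψ k).neg.div_const _)))).sub
      (continuousOn_const.mul (hcρ k))
  refine ⟨by simp, fun t ht k hk => ?_, fun t ht k hk => ?_, fun t _ => hermitian_coef _, hcψ, hcρ,
    ⟨M, hM⟩, ⟨M', hM'⟩, ?_, ?_, fun t ht k _ => ?_, fun t ht k _ => ?_⟩
  · rw [show k = 0 by simpa using hk]; exact hw0 t ht
  · rw [show k = 0 by simpa using hk]; exact (h.mem_rho t ht.1).coef_zero
  · refine lintegral_energy_two_ne_top ((h.sq_psi T).const_mul (2 ^ 4)) ?_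
    filter_upwards [ae_restrict_of_ae_restrict_of_subset Ioc_subset_Ioi_self h.mem4_psi] with t ht
    refine ⟨(MemHper0.lap ht).finEnergy, ?_⟩
    rw [energy_coef_lap (ht.mono (by norm_num))]
    exact ht.energy_le
  · refine lintegral_energy_two_ne_top ((h.sq_rho T).const_mul (2 ^ 2)) ?_
    filter_upwards [ae_restrict_of_ae_restrict_of_subset Ioc_subset_Ioi_self h.mem2_rho] with t ht
    exact ⟨ht.finEnergy, ht.energy_le⟩
  · refine hasDerivAt_of_integral_eq (u := fun s => coef (lap (ψ s)) k) (hrW k)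
      (fun s hs => coef_eq_of_re fun z => ?_) ht
    -- The weak equation tested with a monomial is the integrated equation of mode `k`. Its
    -- right-hand side is continuous in time, so the coefficient is differentiable.
    have he := h.eq_psi (trig z (-k)) (isTest_trig _ _) s hs.1
    rw [integral_mul_trig (integrable_L2 _), integral_mul_trig (integrable_L2 _), ← h.init_psi]
      at he
    rw [mul_sub, Complex.sub_re, he, ← integral_re_mul z
      (((hrW k).mono (Icc_subset_Icc_right hs.2)).intervalIntegrable_of_Icc hs.1)]
    refine intervalIntegral.integral_congr fun r hr => ?_
    rw [uIcc_of_le hs.1] at hr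
    exact vorticity_pairing_trig (h.mem_psi r hr.1) (h.mem_rho r hr.1) z k
  · refine hasDerivAt_of_integral_eq (u := fun s => coef (ρ s) k) (hrB k)
      (fun s hs => coef_eq_of_re fun z => ?_) ht
    have he := h.eq_rho (trig z (-k)) (isTest_trig _ _) s hs.1
    rw [integral_mul_trig (integrable_L2 _), integral_mul_trig (integrable_L2 _), ← h.init_rho]
      at he
    rw [mul_sub, Complex.sub_re, he, ← integral_re_mul z
      (((hrB k).mono (Icc_subset_Icc_right hs.2)).intervalIntegrable_of_Icc hs.1)]
    refine intervalIntegral.integral_congr fun r hr => ?_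
    rw [uIcc_of_le hs.1] at hr
    exact density_pairing_trig (h.mem_psi r hr.1) (h.mem_rho r hr.1) z k

lemma sqrt_mul_exp_le {Z β t y : ℝ} (hZ : 0 ≤ Z) (h : y ≤ Z * Real.exp (-β * t)) :
    Real.sqrt y ≤ Real.sqrt Z * Real.exp (-(β / 2) * t) := by
  refine (Real.sqrt_le_sqrt h).trans (le_of_eq ?_)
  rw [Real.sqrt_mul hZ, ← Real.exp_half]
  congr 2
  ring

lemma MemHper0.sobolevNorm_le {n : ℕ} {u : L2} (h : MemHper0 n u) :
    sobolevNorm n u ≤ (n + 1) * Real.sqrt (energy n (coef u)) := by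
  refine le_of_sq_le_sq ?_ (by positivity)
  rw [mul_pow, Real.sq_sqrt (energy_nonneg _ _)]
  exact h.sobolevNorm_sq_le

/-- Exponential decay of all solutions with given initial values. -/
theorem exists_decay (hν : 0 < ν) (hPr : 0 < Pr) (hN : 0 < Nsq) (ψ₀ ρ₀ : L2) :
    ∃ C α : ℝ, 0 ≤ C ∧ 0 < α ∧ ∀ ψ ρ : ℝ → L2, IsSolution ν Pr Nsq ψ₀ ρ₀ ψ ρ → ∀ t, 0 ≤ t →
      sobolevNorm 3 (ψ t) ≤ C * Real.exp (-α * t) ∧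
      sobolevNorm 1 (ρ t) ≤ C * Real.exp (-α * t) ∧
      gradNorm (lap (ψ t)) ≤ C * Real.exp (-α * t) ∧
      gradNorm (ρ t) ≤ C * Real.exp (-α * t) := by
  obtain ⟨Z, β, hβ, hZ⟩ := exists_apriori_bound hν (div_pos hν hPr) hN
    (max (energy 1 (coef (lap ψ₀))) (energy 1 (coef ρ₀)))
  -- The factor `4` is `n + 1` in `sobolevNorm_le` at order `3` and covers the other norms as well;
  -- the rate is halved because energies are squares of norms.
  refine ⟨4 * Real.sqrt Z, β / 2, by positivity, by positivity, fun ψ ρ h t ht => ?_⟩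
  have key := hZ t _ _ _ (h.isModeSolution t) (by simp [h.init_psi]) (by simp [h.init_rho]) t
    ⟨ht, le_rfl⟩
  have hZ0 : 0 ≤ Z := by
    have := (energy_nonneg _ _).trans key.1
    exact nonneg_of_mul_nonneg_left this (Real.exp_pos _)
  have h1 := sqrt_mul_exp_le hZ0 key.1
  have h2 := sqrt_mul_exp_le hZ0 key.2.1
  have h3 := (h.mem_psi t ht).sobolevNorm_le
  have h4 := (h.mem_rho t ht).sobolevNorm_le
  rw [(MemHper0.lap (h.mem_psi t ht)).gradNorm_eq, (h.mem_rho t ht).gradNorm_eq]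
  rw [← energy_coef_lap ((h.mem_psi t ht).mono (by norm_num))] at h3
  have h5 : 0 ≤ Real.sqrt Z * Real.exp (-(β / 2) * t) := by positivity
  norm_num at h3 h4
  refine ⟨?_, ?_, ?_, ?_⟩ <;> linarith

end Thermohaline

end

noncomputable section

namespace Thermohaline

open scoped ComplexConjugate Topology
open Filter UnitAddTorus

/-! ### Existence of solutions -/

lemma continuousOn_Ici_of_Icc {E : Type*} [TopologicalSpace E] {f : ℝ → E}
    (h : ∀ T, 0 ≤ T → ContinuousOn f (Icc 0 T)) : ContinuousOn f (Ici 0) := fun t ht => by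
  have ht' : (0 : ℝ) ≤ t := ht
  refine ((h (t + 1) (by linarith)) t ⟨ht', by linarith⟩).mono_of_mem_nhdsWithin ?_
  rw [← Ici_inter_Iic]
  exact inter_mem_nhdsWithin _ (Iic_mem_nhds (by linarith))

lemma FinEnergy.sub {n : ℕ} {u v : Mode → ℂ} (hu : FinEnergy n u) (hv : FinEnergy n v) :
    FinEnergy n (fun k => u k - v k) ∧
      energy n (fun k => u k - v k) ≤ 2 * energy n u + 2 * energy n v := by
  have hs := (Summable.mul_left 2 hu).add (Summable.mul_left 2 hv)
  have hle : ∀ k, eig k ^ n * ‖u k - v k‖ ^ 2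
      ≤ 2 * (eig k ^ n * ‖u k‖ ^ 2) + 2 * (eig k ^ n * ‖v k‖ ^ 2) := fun k => by
    have h1 : ‖u k - v k‖ ^ 2 ≤ 2 * ‖u k‖ ^ 2 + 2 * ‖v k‖ ^ 2 := by
      have := norm_sub_le (u k) (v k)
      nlinarith [sq_nonneg (‖u k‖ - ‖v k‖), norm_nonneg (u k - v k)]
    have h2 := mul_le_mul_of_nonneg_left h1 (pow_nonneg (eig_nonneg k) n)
    linarith
  have hd : FinEnergy n (fun k => u k - v k) := Summable.of_nonneg_of_le
    (fun k => mul_nonneg (pow_nonneg (eig_nonneg k) n) (sq_nonneg _)) hle hs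
  refine ⟨hd, (hd.tsum_le_tsum hle hs).trans (le_of_eq ?_)⟩
  rw [Summable.tsum_add (Summable.mul_left 2 hu) (Summable.mul_left 2 hv), tsum_mul_left,
    tsum_mul_left]
  rfl

/-- Outside a finite set of modes the mean-square norm is controlled by the energy. -/
lemma exists_finset_norm_sq_le {δ : ℝ} (hδ : 0 < δ) : ∃ F : Finset Mode, ∀ u : L2, MemHper0 1 u →
    ‖u‖ ^ 2 ≤ ∑ k ∈ F, ‖coef u k‖ ^ 2 + δ * energy 1 (coef u) := by
  classical
  -- All but finitely many modes satisfy `(eig k ^ 2)⁻¹ < δ ^ 2`, which is `1 < δ * eig k` on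
  -- nonzero modes.
  have hev := summable_inv_eig_sq.tendsto_cofinite_zero.eventually
    (gt_mem_nhds (show (0 : ℝ) < δ ^ 2 by positivity))
  rw [eventually_cofinite] at hev
  refine ⟨hev.toFinset, fun u hu => ?_⟩
  have h1 : HasSum (fun k => if k ∈ hev.toFinset then ‖coef u k‖ ^ 2 else 0)
      (∑ k ∈ hev.toFinset, ‖coef u k‖ ^ 2) := by
    have : HasSum (fun k => if k ∈ hev.toFinset then ‖coef u k‖ ^ 2 else 0)
        (∑ k ∈ hev.toFinset, if k ∈ hev.toFinset then ‖coef u k‖ ^ 2 else 0) :=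
      hasSum_sum_of_ne_finset_zero fun k hk => if_neg hk
    rwa [Finset.sum_congr rfl fun k hk => if_pos hk] at this
  have h2 := h1.add (HasSum.mul_left δ hu.finEnergy.hasSum)
  refine hasSum_le (fun k => ?_) (hasSum_norm_coef_sq u) h2
  have hE : 0 ≤ δ * (eig k ^ 1 * ‖coef u k‖ ^ 2) :=
    mul_nonneg hδ.le (mul_nonneg (pow_nonneg (eig_nonneg k) 1) (sq_nonneg _))
  by_cases hk : k ∈ hev.toFinset
  · rw [if_pos hk]; linarith
  · rw [if_neg hk, zero_add]
    by_cases hk0 : k = 0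
    · simp [hk0, hu.coef_zero]
    have hlt : (eig k ^ 2)⁻¹ < δ ^ 2 := by simpa using hk
    have he := eig_pos hk0
    have h3 : 1 < (δ * eig k) ^ 2 := by
      rw [mul_pow]
      calc (1 : ℝ) = (eig k ^ 2)⁻¹ * eig k ^ 2 := by field_simp
        _ < _ := by gcongr
    have h4 : 1 ≤ δ * eig k := by
      by_contra! hc
      have : 0 < δ * eig k := by positivity
      nlinarith
    rw [pow_one, ← mul_assoc]
    exact le_mul_of_one_le_left (sq_nonneg _) h4

/-- A curve bounded in `H¹` with continuous Fourier coefficients is continuous in `L²`. -/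
lemma continuousOn_of_coef {s : Set ℝ} {u : ℝ → L2} {Z : ℝ}
    (hc : ∀ k, ContinuousOn (fun t => coef (u t) k) s) (hmem : ∀ t ∈ s, MemHper0 1 (u t))
    (hZ : ∀ t ∈ s, energy 1 (coef (u t)) ≤ Z) : ContinuousOn u s := by
  intro t ht
  have hZ0 : 0 ≤ Z := (energy_nonneg _ _).trans (hZ t ht)
  have hdiff : ∀ r ∈ s, MemHper0 1 (u r - u t) ∧ energy 1 (coef (u r - u t : L2)) ≤ 4 * Z := by
    intro r hr
    have h := (hmem r hr).finEnergy.sub (hmem t ht).finEnergy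
    have he : coef (u r - u t : L2) = fun k => coef (u r) k - coef (u t) k :=
      funext (coef_L2_sub _ _)
    rw [memHper0_iff, he]
    refine ⟨⟨?_, h.1⟩, h.2.trans (by linarith [hZ r hr, hZ t ht])⟩
    simp only [(hmem r hr).coef_zero, (hmem t ht).coef_zero, sub_self]
  have hsq : Tendsto (fun r => ‖u r - u t‖ ^ 2) (𝓝[s] t) (𝓝 0) := by
    rw [Metric.tendsto_nhds]
    intro ε hε
    -- The energy of a difference is at most `4 * Z`, so this `δ` leaves at most `ε / 2` for the
    -- high modes; the finitely many others converge by continuity of coefficients.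
    obtain ⟨F, hF⟩ := exists_finset_norm_sq_le (δ := ε / (8 * Z + 8)) (by positivity)
    have hlim : Tendsto (fun r => ∑ k ∈ F, ‖coef (u r) k - coef (u t) k‖ ^ 2) (𝓝[s] t) (𝓝 0) := by
      have : Tendsto (fun r => ∑ k ∈ F, ‖coef (u r) k - coef (u t) k‖ ^ 2) (𝓝[s] t)
          (𝓝 (∑ k ∈ F, ‖coef (u t) k - coef (u t) k‖ ^ 2)) :=
        tendsto_finsetSum _ fun k _ => (((hc k t ht).tendsto.sub_const _).norm.pow 2)
      simpa using this
    filter_upwards [hlim.eventually (gt_mem_nhds (half_pos hε)), self_mem_nhdsWithin] with r h1 hr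
    rw [Real.dist_eq, sub_zero, abs_of_nonneg (sq_nonneg _)]
    have h2 := hF _ (hdiff r hr).1
    simp only [coef_L2_sub] at h2
    have h3 : ε / (8 * Z + 8) * energy 1 (coef (u r - u t : L2)) ≤ ε / 2 := by
      calc _ ≤ ε / (8 * Z + 8) * (4 * Z) := by
            have := (hdiff r hr).2
            gcongr
        _ ≤ ε / 2 := by
            rw [div_mul_eq_mul_div, div_le_div_iff₀ (by positivity) (by positivity)]
            nlinarith
    linarith
  refine tendsto_iff_norm_sub_tendsto_zero.2 ?_
  have := hsq.sqrt
  simpa only [Real.sqrt_sq (norm_nonneg _), Real.sqrt_zero] using this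

/-- The difficulty is measurability, since `weakD` is defined by choice. Almost everywhere the norm
equals a series of functions continuous in time. -/
lemma integrableOn_sobolevNorm_sq {n : ℕ} {T : ℝ} {u : ℝ → L2}
    (hc : ∀ k, ContinuousOn (fun t => coef (u t) k) (Icc 0 T))
    (hmem : ∀ᵐ t ∂(volume.restrict (Ioc 0 T)), MemHper0 n (u t))
    (hint : IntegrableOn (fun t => energy n (coef (u t))) (Ioc 0 T)) :
    IntegrableOn (fun t => sobolevNorm n (u t) ^ 2) (Ioc 0 T) := by
  refine Integrable.mono' (hint.const_mul ((n + 1) ^ 2)) ?_ ?_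
  · have hm : AEMeasurable (fun t => ∑ ab ∈ (Finset.range (n + 1) ×ˢ Finset.range (n + 1)).filter
        (fun ab => ab.1 + ab.2 ≤ n), ∑' k, ‖msym ab.1 ab.2 k‖ ^ 2 * ‖coef (u t) k‖ ^ 2)
        (volume.restrict (Ioc 0 T)) := by
      refine Finset.aemeasurable_fun_sum _ fun ab _ => AEMeasurable.tsum fun k => ?_
      exact ((continuousOn_const.mul ((hc k).norm.pow 2)).mono Ioc_subset_Icc_self).aemeasurable
        measurableSet_Ioc
    refine hm.aestronglyMeasurable.congr ?_
    filter_upwards [hmem] with t ht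
    rw [sobolevNorm_sq]
    refine Finset.sum_congr rfl fun ab hab => ?_
    rw [norm_weakD_sq (ht.2 ab.1 ab.2 (Finset.mem_filter.1 hab).2)]
  · filter_upwards [hmem] with t ht
    rw [Real.norm_eq_abs, abs_of_nonneg (sq_nonneg _)]
    exact ht.sobolevNorm_sq_le

lemma ae_Ioi_of_ae_Ioc {p : ℝ → Prop}
    (h : ∀ T, 0 ≤ T → ∀ᵐ t ∂(volume.restrict (Ioc 0 T)), p t) :
    ∀ᵐ t ∂(volume.restrict (Ioi (0 : ℝ))), p t := by
  have hU : Ioi (0 : ℝ) = ⋃ n : ℕ, Ioc 0 (n : ℝ) := by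
    ext t
    simp only [mem_Ioi, mem_iUnion, mem_Ioc]
    exact ⟨fun ht => (exists_nat_ge t).imp fun n hn => ⟨ht, hn⟩, fun ⟨n, hn⟩ => hn.1⟩
  rw [hU, ae_restrict_iUnion_iff]
  exact fun n => h n (Nat.cast_nonneg n)

/-- Growth linear in `eig` is harmless against the coefficients of a test function, which remain
summable after multiplication by `eig`. -/
lemma rateBound_le {ν κ Nsq Z : ℝ} (hν : 0 ≤ ν) (hκ : 0 ≤ κ) (hN : 0 ≤ Nsq) (hZ : 0 ≤ Z) :
    ∃ C, ∀ k, rateBound ν κ Nsq Z k ≤ C * (1 + eig k) := by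
  set S := ∑' k : Mode, (Real.sqrt (eig k ^ 3))⁻¹ with hS
  have hS0 : 0 ≤ S := tsum_nonneg fun k => by positivity
  refine ⟨Z * S + (1 + Nsq) * Real.sqrt Z + (ν + κ) * Real.sqrt Z, fun k => ?_⟩
  have he := eig_nonneg k
  have h1 : advBound Z k = Real.sqrt (eig k) * Z * S := by
    rw [advBound, tsum_mul_left, hS]
    congr 1
    exact (Equiv.subLeft k).tsum_eq (fun m : Mode => (Real.sqrt (eig m ^ 3))⁻¹)
  have h2 : Real.sqrt (eig k) ≤ 1 + eig k := by
    rw [Real.sqrt_le_left (by positivity)]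
    nlinarith
  have h3 : ‖dx k‖ ≤ 1 + eig k := (Real.le_sqrt_of_sq_le (norm_dx_sq_le k)).trans h2
  rw [rateBound, h1]
  calc _ ≤ (1 + eig k) * Z * S + (1 + Nsq) * (1 + eig k) * Real.sqrt Z
        + (ν + κ) * (1 + eig k) * Real.sqrt Z := by
        gcongr
        linarith
    _ = _ := by ring

lemma IsTest.summable_mul_rateBound {φ : Torus → ℝ} (hφ : IsTest φ) {ν κ Nsq Z : ℝ} (hν : 0 ≤ ν)
    (hκ : 0 ≤ κ) (hN : 0 ≤ Nsq) (hZ : 0 ≤ Z) :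
    Summable fun k => ‖coef φ k‖ * rateBound ν κ Nsq Z (-k) := by
  obtain ⟨C, hC⟩ := rateBound_le hν hκ hN hZ
  refine Summable.of_nonneg_of_le (fun k => ?_) (fun k => ?_)
    ((hφ.summable_norm_coef.add hφ.summable_eig_mul_norm_coef).mul_left C)
  · have : 0 ≤ advBound Z (-k) := tsum_nonneg fun l => by positivity
    have := eig_nonneg (-k)
    rw [rateBound]
    positivity
  · calc ‖coef φ k‖ * rateBound ν κ Nsq Z (-k) ≤ ‖coef φ k‖ * (C * (1 + eig (-k))) := by
          gcongr; exact hC _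
      _ = _ := by rw [eig_neg]; ring

/-- From the equations for the Fourier coefficients to the weak formulation. -/
lemma IsTest.integral_sub_eq {φ : Torus → ℝ} (hφ : IsTest φ) {t : ℝ} (ht : 0 ≤ t) {f₁ f₀ : L2}
    {r : ℝ → Mode → ℂ} {g : ℝ → ℝ} {B : Mode → ℝ} (hB : Summable fun k => ‖coef φ k‖ * B (-k))
    (hr : ∀ k, ContinuousOn (fun s => r s k) (Icc 0 t))
    (hrB : ∀ s ∈ Icc 0 t, ∀ k, ‖r s k‖ ≤ B k)
    (hint : ∀ k, ∫ s in (0 : ℝ)..t, r s k = coef f₁ k - coef f₀ k)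
    (hg : ∀ s ∈ Icc 0 t, HasSum (fun k => coef φ k * r s (-k)) (g s : ℂ)) :
    ∫ p, f₁ p * φ p ∂area - ∫ p, f₀ p * φ p ∂area = ∫ s in (0 : ℝ)..t, g s := by
  have huIoc : ∀ s ∈ uIoc 0 t, s ∈ Icc 0 t := fun s hs => by
    rw [uIoc_of_le ht] at hs
    exact Ioc_subset_Icc_self hs
  have h1 := intervalIntegral.hasSum_integral_of_dominated_convergence (μ := volume) (a := 0)
    (b := t) (F := fun k s => coef φ k * r s (-k)) (f := fun s => (g s : ℂ))
    (fun k _ => ‖coef φ k‖ * B (-k))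
    (fun k => by
      rw [uIoc_of_le ht]
      exact ((continuousOn_const.mul (hr (-k))).mono Ioc_subset_Icc_self).aestronglyMeasurable
        measurableSet_Ioc)
    (fun k => ae_of_all _ fun s hs => by
      rw [norm_mul]
      exact mul_le_mul_of_nonneg_left (hrB s (huIoc s hs) (-k)) (norm_nonneg _))
    (ae_of_all _ fun _ _ => hB) intervalIntegrable_const
    (ae_of_all _ fun s hs => hg s (huIoc s hs))
  have h2 := (hφ.hasSum_pairing (integrable_L2 f₁)).sub (hφ.hasSum_pairing (integrable_L2 f₀))
  simp only [intervalIntegral.integral_const_mul, hint, mul_sub] at h1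
  have h3 := h2.unique h1
  rw [intervalIntegral.integral_ofReal] at h3
  exact_mod_cast h3

lemma cross_zero_right (l : Mode) : cross l 0 = 0 := by simp [cross]

/-- The zero mode lies outside `{0}ᶜ` and has no evolution equation, but test functions have a mean;
here both sides of its integrated equation vanish. -/
lemma rhsW_zero (ν : ℝ) (w b : Mode → ℂ) : rhsW ν w b 0 = 0 := by
  simp [rhsW, adv, cross_zero_right, dx]

lemma rhsB_zero (κ Nsq : ℝ) (w b : Mode → ℂ) : rhsB κ Nsq w b 0 = 0 := by
  simp [rhsB, adv, cross_zero_right, dx]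

theorem exists_isSolution {ν Pr Nsq : ℝ} (hν : 0 < ν) (hPr : 0 < Pr) (hN : 0 < Nsq)
    {ψ₀ ρ₀ : L2} (hψ₀ : MemHper0 3 ψ₀) (hρ₀ : MemHper0 1 ρ₀) :
    ∃ ψ ρ : ℝ → L2, IsSolution ν Pr Nsq ψ₀ ρ₀ ψ ρ := by
  have hκ : 0 < ν / Pr := div_pos hν hPr
  have hψ₂ := hψ₀.mono (m := 2) (by norm_num)
  obtain ⟨w, b, hw0, hb0, hbh, hsol⟩ := exists_modeSolution hν hκ hN
    (hermitian_coef (lap ψ₀)) (hermitian_coef ρ₀) hψ₂.coef_lap_zero hρ₀.coef_zero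
    (MemHper0.lap hψ₀).finEnergy hρ₀.finEnergy
  have hmem : ∀ {t : ℝ}, 0 ≤ t → t ∈ Icc 0 t := fun ht => ⟨ht, le_rfl⟩
  have hwz : ∀ t, 0 ≤ t → w t 0 = 0 := fun t ht => (hsol t ht).w_zero (hmem ht)
  have hbz : ∀ t, 0 ≤ t → b t 0 = 0 := fun t ht => (hsol t ht).b_zero (hmem ht)
  have hw1 : ∀ t, 0 ≤ t → FinEnergy 1 (w t) := fun t ht => by
    obtain ⟨M, -, hM⟩ := (hsol t ht).exists_bound
    exact (hM t (hmem ht)).1.1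
  have hb1 : ∀ t, 0 ≤ t → FinEnergy 1 (b t) := fun t ht => by
    obtain ⟨M, -, hM⟩ := (hsol t ht).exists_bound
    exact (hM t (hmem ht)).2.1
  -- A solution is a function of all real times, constrained only on `[0, ∞)`; at negative times the
  -- value `0` is taken.
  have hexψ : ∀ t, ∃ u : L2, 0 ≤ t → coef u = stream (w t) := fun t => by
    by_cases ht : 0 ≤ t
    · obtain ⟨u, hu⟩ := exists_coef_eq ((hsol t ht).herm_w t (hmem ht)).stream
        (finEnergy_stream_of_le (hwz t ht) (hw1 t ht) (by norm_num))
      exact ⟨u, fun _ => hu⟩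
    · exact ⟨0, fun h => absurd h ht⟩
  have hexρ : ∀ t, ∃ u : L2, 0 ≤ t → coef u = b t := fun t => by
    by_cases ht : 0 ≤ t
    · obtain ⟨u, hu⟩ := exists_coef_eq (hbh t ht) ((hb1 t ht).mono (hbz t ht) (by norm_num))
      exact ⟨u, fun _ => hu⟩
    · exact ⟨0, fun h => absurd h ht⟩
  choose ψ hψ using hexψ
  choose ρ hρ using hexρ
  have hψm : ∀ n t, 0 ≤ t → FinEnergy n (w t) → MemHper0 (n + 2) (ψ t) := fun n t ht hn => by
    rw [memHper0_iff, hψ t ht]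
    exact ⟨stream_zero _, (finEnergy_stream (hwz t ht) n).2 hn⟩
  have hρm : ∀ n t, 0 ≤ t → FinEnergy n (b t) → MemHper0 n (ρ t) := fun n t ht hn => by
    rw [memHper0_iff, hρ t ht]
    exact ⟨hbz t ht, hn⟩
  have hψ3 : ∀ t, 0 ≤ t → MemHper0 3 (ψ t) := fun t ht => hψm 1 t ht (hw1 t ht)
  have hρ1 : ∀ t, 0 ≤ t → MemHper0 1 (ρ t) := fun t ht => hρm 1 t ht (hb1 t ht)
  have hlap : ∀ t, 0 ≤ t → coef (lap (ψ t)) = w t := fun t ht => by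
    ext k
    rw [((hψ3 t ht).mono (by norm_num)).coef_lap, hψ t ht]
    by_cases hk : k = 0
    · simp [hk, hwz t ht]
    · have : (eig k : ℂ) ≠ 0 := by exact_mod_cast eig_ne_zero hk
      rw [stream]
      field_simp
  have hψc : ∀ T, 0 ≤ T → ∀ k, ContinuousOn (fun t => coef (ψ t) k) (Icc 0 T) :=
    fun T hT k => (((hsol T hT).cont_w k).neg.div_const (eig k : ℂ)).congr fun t ht => by
      rw [hψ t ht.1]; rfl
  have hρc : ∀ T, 0 ≤ T → ∀ k, ContinuousOn (fun t => coef (ρ t) k) (Icc 0 T) :=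
    fun T hT k => ((hsol T hT).cont_b k).congr fun t ht => by rw [hρ t ht.1]
  have hψ0 : ψ 0 = ψ₀ := coef_injective (by rw [hψ 0 le_rfl, hw0, hψ₂.stream_coef_lap])
  have hρ0 : ρ 0 = ρ₀ := coef_injective (by rw [hρ 0 le_rfl, hb0])
  have hae := fun T (hT : (0 : ℝ) ≤ T) => (hsol T hT).ae_finEnergy
  have hψ4 : ∀ T, 0 ≤ T → ∀ᵐ t ∂(volume.restrict (Ioc 0 T)), MemHper0 4 (ψ t) := fun T hT => by
    filter_upwards [hae T hT] with t ht
    exact hψm 2 t ht.1.1 ht.2.1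
  have hρ2 : ∀ T, 0 ≤ T → ∀ᵐ t ∂(volume.restrict (Ioc 0 T)), MemHper0 2 (ρ t) := fun T hT => by
    filter_upwards [hae T hT] with t ht
    exact hρm 2 t ht.1.1 ht.2.2
  refine ⟨ψ, ρ, hψ0, hρ0, continuousOn_Ici_of_Icc fun T hT => ?_,
    continuousOn_Ici_of_Icc fun T hT => ?_, hψ3, fun T => ?_, hρ1, fun T => ?_,
    ae_Ioi_of_ae_Ioc hψ4, fun T => ?_, ae_Ioi_of_ae_Ioc hρ2, fun T => ?_,
    fun φ hφ t ht => ?_, fun φ hφ t ht => ?_⟩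
  · obtain ⟨M, -, hM⟩ := (hsol T hT).exists_bound
    refine continuousOn_of_coef (hψc T hT) (fun t ht => (hψ3 t ht.1).mono (by norm_num))
      (Z := M) fun t ht => ?_
    rw [hψ t ht.1]
    exact (energy_stream_le (hwz t ht.1) (hw1 t ht.1) (by norm_num)).trans (hM t ht).1.2
  · obtain ⟨M, -, hM⟩ := (hsol T hT).exists_bound
    refine continuousOn_of_coef (hρc T hT) (fun t ht => hρ1 t ht.1) (Z := M) fun t ht => ?_
    rw [hρ t ht.1]
    exact (hM t ht).2.2
  · obtain ⟨M, -, hM⟩ := (hsol (max T 0) (le_max_right _ _)).exists_bound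
    refine ⟨4 * Real.sqrt M, fun t ht => (hψ3 t ht.1).sobolevNorm_le.trans ?_⟩
    rw [hψ t ht.1, energy_stream (hwz t ht.1) 1]
    norm_num
    exact Real.sqrt_le_sqrt (hM t ⟨ht.1, ht.2.trans (le_max_left _ _)⟩).1.2
  · obtain ⟨M, -, hM⟩ := (hsol (max T 0) (le_max_right _ _)).exists_bound
    refine ⟨2 * Real.sqrt M, fun t ht => (hρ1 t ht.1).sobolevNorm_le.trans ?_⟩
    rw [hρ t ht.1]
    norm_num
    exact Real.sqrt_le_sqrt (hM t ⟨ht.1, ht.2.trans (le_max_left _ _)⟩).2.2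
  · rcases lt_or_ge T 0 with hT | hT
    · simp [Ioc_eq_empty (not_lt.2 hT.le)]
    refine integrableOn_sobolevNorm_sq (hψc T hT) (hψ4 T hT) ?_
    refine (ae_finEnergy_two (hsol T hT).cont_w (hsol T hT).sq_w).2.congr_fun (fun t ht => ?_)
      measurableSet_Ioc
    simp only [hψ t ht.1.le]
    exact (energy_stream (hwz t ht.1.le) 2).symm
  · rcases lt_or_ge T 0 with hT | hT
    · simp [Ioc_eq_empty (not_lt.2 hT.le)]
    refine integrableOn_sobolevNorm_sq (hρc T hT) (hρ2 T hT) ?_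
    refine (ae_finEnergy_two (hsol T hT).cont_b (hsol T hT).sq_b).2.congr_fun (fun t ht => ?_)
      measurableSet_Ioc
    simp only [hρ t ht.1.le]
  · obtain ⟨M, hM0, hM⟩ := (hsol t ht).exists_bound
    refine hφ.integral_sub_eq ht (r := fun s => rhsW ν (w s) (b s))
      (hφ.summable_mul_rateBound hν.le hκ.le hN.le hM0) (hsol t ht).continuousOn_rhsW
      (fun s hs => norm_rhsW_le hν.le hκ.le hN.le (hwz s hs.1) (hbz s hs.1) (hM s hs).1 (hM s hs).2)
      (fun k => ?_) (fun s hs => ?_)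
    · rw [hlap t ht, ← hw0]
      by_cases hk : k = 0
      · simp [hk, rhsW_zero, hwz t ht, hwz 0 le_rfl]
      · exact (hsol t ht).integral_rhsW hk le_rfl ht le_rfl
    · have := vorticity_pairing (ν := ν) hφ (hψ3 s hs.1) (hρ1 s hs.1)
      rwa [hlap s hs.1, hρ s hs.1] at this
  · obtain ⟨M, hM0, hM⟩ := (hsol t ht).exists_bound
    refine hφ.integral_sub_eq ht (r := fun s => rhsB (ν / Pr) Nsq (w s) (b s))
      (hφ.summable_mul_rateBound hν.le hκ.le hN.le hM0) (hsol t ht).continuousOn_rhsB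
      (fun s hs => norm_rhsB_le hν.le hκ.le hN.le (hwz s hs.1) (hbz s hs.1) (hM s hs).1 (hM s hs).2)
      (fun k => ?_) (fun s hs => ?_)
    · rw [hρ t ht, ← hb0]
      by_cases hk : k = 0
      · simp [hk, rhsB_zero, hbz t ht, hbz 0 le_rfl]
      · exact (hsol t ht).integral_rhsB hk le_rfl ht le_rfl
    · have := density_pairing (κ := ν / Pr) (Nsq := Nsq) hφ (hψ3 s hs.1) (hρ1 s hs.1)
      rwa [hlap s hs.1, hρ s hs.1] at this

end Thermohaline

end

open Thermohaline in
theorem theorem2p5 (ν Pr Nsq : ℝ) (hν : 0 < ν) (hPr : 0 < Pr) (hN : 0 < Nsq)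
    (ψ₀ ρ₀ : L2) (hψ₀ : MemHper0 3 ψ₀) (hρ₀ : MemHper0 1 ρ₀) :
    (∃ ψ ρ : ℝ → L2, IsSolution ν Pr Nsq ψ₀ ρ₀ ψ ρ) ∧
    (∃ C α : ℝ, 0 < α ∧ ∀ ψ ρ : ℝ → L2, IsSolution ν Pr Nsq ψ₀ ρ₀ ψ ρ →
      ∀ t : ℝ, 0 ≤ t →
        sobolevNorm 3 (ψ t) ≤ C * Real.exp (-α * t) ∧
        sobolevNorm 1 (ρ t) ≤ C * Real.exp (-α * t)) ∧
    (∃ t₁ t₂ T : ℝ, 0 < t₁ ∧ 0 < t₂ ∧ T = max t₁ t₂ ∧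
      ∃ M K β : ℝ, 0 < β ∧ ∀ ψ ρ : ℝ → L2, IsSolution ν Pr Nsq ψ₀ ρ₀ ψ ρ →
        ∀ t : ℝ, 0 ≤ t →
          (t ≤ T → gradNorm (ρ t) ≤ M ∧ gradNorm (lap (ψ t)) ≤ M) ∧
          (t₁ < t → gradNorm (ρ t) ≤ K * Real.exp (-β * t)) ∧
          (t₂ < t → gradNorm (lap (ψ t)) ≤ K * Real.exp (-β * t)) ∧
          (T < t → gradNorm (ρ t) ≤ K * Real.exp (-β * t) ∧
            gradNorm (lap (ψ t)) ≤ K * Real.exp (-β * t))) := by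
  obtain ⟨C, α, hC, hα, h⟩ := exists_decay hν hPr hN ψ₀ ρ₀
  refine ⟨exists_isSolution hν hPr hN hψ₀ hρ₀,
    ⟨C, α, hα, fun ψ ρ hs t ht => ⟨(h ψ ρ hs t ht).1, (h ψ ρ hs t ht).2.1⟩⟩,
    -- Any positive times would do, since the decay holds from time zero; the same `C` serves as `M`
    -- and `K`.
    1, 1, 1, one_pos, one_pos, (max_self 1).symm, C, C, α, hα, fun ψ ρ hs t ht => ?_⟩
  obtain ⟨-, -, h3, h4⟩ := h ψ ρ hs t ht
  have hle : C * Real.exp (-α * t) ≤ C :=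
    mul_le_of_le_one_right hC (Real.exp_le_one_iff.2 (by nlinarith))
  exact ⟨fun _ => ⟨h4.trans hle, h3.trans hle⟩, fun _ => h4, fun _ => h3, fun _ => ⟨h4, h3⟩⟩
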